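/- All objects are $C^\infty$. Let $X : M \to \mathbb{R}^3$ be an immersed surface, i.e. an immersion of a (Hausdorff, second countable) $2$-manifold $M$, and assume that $M$ is connected, orientable (it carries a continuous unit normal field $M \to \mathbb{R}^3$), and complete for the Riemannian distance induced by $X$. Let $\mathcal{F}$ be a planar geodesic foliation of the surface, i.e. a $1$-dimensional foliation of $M$ each leaf of which is a geodesic whose image lies in a plane of $\mathbb{R}^3$ such that, along the leaf, the normal to the surface is parallel to this plane. Then there are a map $\Phi : \mathbb{R}^2 \to M$, curves $\mathbf{r}, \mathbf{q}_1, \mathbf{q}_2 : \mathbb{R} \to \mathbb{R}^3$ and functions $x, y : \mathbb{R} \to \mathbb{R}$, all smooth, such that $$X(\Phi(u,v)) = \mathbf{r}(v) + x(u)\,\mathbf{q}_1(v) + y(u)\,\mathbf{q}_2(v) \qquad \text{for all } (u,v) \in \mathbb{R}^2,$$ and: 1. $|\mathbf{r}'| = 1$, and $(\mathbf{r}', \mathbf{q}_1, \mathbf{q}_2)$ is a rotation minimizing frame along $\mathbf{r}$: it is orthonormal, and $\mathbf{q}_1'$, $\mathbf{q}_2'$ are everywhere parallel to $\mathbf{r}'$;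 moreover $(x')^2 + (y')^2 = 1$. 2. $\mathbf{r}(v) = X(\Phi(0,v))$, and this curve in the surface is orthogonal to $\mathcal{F}$. 3. For each $v$, the curve $u \mapsto \Phi(u,v)$ is tangent to $\mathcal{F}$ and is a unit speed geodesic. 4. $\Phi$ is a surjective covering map and a local diffeomorphism, and $(u,v)$ are curvature line coordinates: all the coordinate curves $u \mapsto \Phi(u,v)$ and $v \mapsto \Phi(u,v)$ are lines of curvature, and the two families are orthogonal to each other. -/

import Mathlib

open Set Filter Topology Manifold
open scoped ContDiff ENNReal

/-! A vector space carries its identity chart; `TopCat.of.chartedSpace` would give the same chart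
under another name. -/
attribute [-instance] TopCat.of.chartedSpace

noncomputable section

namespace PGF

/-- Euclidean three-space. -/
abbrev E3 : Type := EuclideanSpace ℝ (Fin 3)

section Surfaces

variable {M : Type*} [TopologicalSpace M] [ChartedSpace (EuclideanSpace ℝ (Fin 2)) M]

/-- The differential at `p` of an `ℝ³`-valued map on a surface. -/
def dMap (X : M → E3) (p : M) : TangentSpace (𝓡 2) p →L[ℝ] E3 :=
  mfderiv (𝓡 2) 𝓘(ℝ, E3) X p

/-- The velocity vector of a curve in a surface. -/
def velocity (γ : ℝ → M) (t : ℝ) : TangentSpace (𝓡 2) (γ t) :=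
  mfderiv 𝓘(ℝ, ℝ) (𝓡 2) γ t (1 : ℝ)

/-- `X : M → ℝ³` is a smooth immersion, i.e. `(M, X)` is an immersed surface. -/
def IsImmersedSurface (X : M → E3) : Prop :=
  ContMDiff (𝓡 2) 𝓘(ℝ, E3) ∞ X ∧ ∀ p, Function.Injective (dMap X p)

/-- The tangent plane of the immersed surface at `p`, as a linear subspace of `ℝ³`. -/
def tangentPlane (X : M → E3) (p : M) : Submodule ℝ E3 :=
  LinearMap.range (dMap X p : TangentSpace (𝓡 2) p →ₗ[ℝ] E3)

/-- The normal line of the immersed surface at `p`, as a linear subspace of `ℝ³`. -/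
def normalLine (X : M → E3) (p : M) : Submodule ℝ E3 :=
  (tangentPlane X p)ᗮ

/-- `N` is a unit normal field of the surface on the set `U`. -/
def IsUnitNormalOn (X N : M → E3) (U : Set M) : Prop :=
  ∀ p ∈ U, ‖N p‖ = 1 ∧ N p ∈ normalLine X p

/-- The immersed surface is orientable: it carries a globally defined continuous unit normal. -/
def IsOrientable (X : M → E3) : Prop :=
  ∃ N : M → E3, Continuous N ∧ IsUnitNormalOn X N univ

/-- The distance of the Riemannian metric that the immersion induces on the surface: the infimum
of the `ℝ³`-lengths of the images of the `C^1` paths in `M` from `p` to `q`. -/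
def inducedEDist (X : M → E3) (p q : M) : ℝ≥0∞ :=
  letI : ∀ p : M, ENorm (TangentSpace (𝓡 2) p) := fun p => ⟨fun v => ‖dMap X p v‖ₑ⟩
  riemannianEDist (𝓡 2) p q

/-- The immersed surface is complete in its induced Riemannian metric: every Cauchy sequence of
the induced distance converges. -/
def IsCompleteSurface (X : M → E3) : Prop :=
  ∀ s : ℕ → M,
    (∀ ε : ℝ≥0∞, 0 < ε → ∃ n₀ : ℕ, ∀ m ≥ n₀, ∀ n ≥ n₀, inducedEDist X (s m) (s n) < ε) →
    ∃ p : M, Tendsto s atTop (𝓝 p)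

/-- `γ`, restricted to the set of parameters `J`, is a smooth unit speed curve in the surface. -/
def IsUnitSpeedOn (X : M → E3) (γ : ℝ → M) (J : Set ℝ) : Prop :=
  ContMDiffOn 𝓘(ℝ, ℝ) (𝓡 2) ∞ γ J ∧ ∀ t ∈ J, ‖deriv (X ∘ γ) t‖ = 1

/-- `γ` is a unit speed geodesic on `J`: its acceleration is normal to the surface. -/
def IsUnitSpeedGeodesicOn (X : M → E3) (γ : ℝ → M) (J : Set ℝ) : Prop :=
  IsUnitSpeedOn X γ J ∧ ∀ t ∈ J, deriv (deriv (X ∘ γ)) t ∈ normalLine X (γ t)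

/-- `P` is an affine plane of `ℝ³` that contains the curve `γ` (on `J`) and to which the normal of
the surface is parallel all along the curve. -/
def LiesInNormalPlane (X : M → E3) (γ : ℝ → M) (J : Set ℝ) (P : AffineSubspace ℝ E3) : Prop :=
  Module.finrank ℝ P.direction = 2 ∧
    ∀ t ∈ J, X (γ t) ∈ P ∧ normalLine X (γ t) ≤ P.direction

end Surfaces

/-- A smooth one-dimensional foliation of a surface, given by its tangent line field: a line in
each tangent space, locally spanned by a smooth nowhere vanishing vector field. The leaves are the
maximal integral curves of the line field. -/
structure Foliation (M : Type*) [TopologicalSpace M]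
    [ChartedSpace (EuclideanSpace ℝ (Fin 2)) M] [IsManifold (𝓡 2) ∞ M] where
  /-- The tangent line of the foliation at a point. -/
  line : ∀ p : M, Submodule ℝ (TangentSpace (𝓡 2) p)
  smooth : ∀ p : M, ∃ U : Set M, IsOpen U ∧ p ∈ U ∧
    ∃ T : ∀ q : M, TangentSpace (𝓡 2) q,
      ContMDiffOn (𝓡 2) (𝓡 2).tangent ∞ (fun q => (⟨q, T q⟩ : TangentBundle (𝓡 2) M)) U ∧
      ∀ q ∈ U, T q ≠ 0 ∧ line q = Submodule.span ℝ {T q}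

section PlanarGeodesicFoliations

variable {M : Type*} [TopologicalSpace M] [ChartedSpace (EuclideanSpace ℝ (Fin 2)) M]
  [IsManifold (𝓡 2) ∞ M]

/-- On the open interval `J`, the curve `γ` is a unit speed parameterization of (a connected
part of) a leaf of the foliation `F`. -/
def Foliation.IsLeafOn (F : Foliation M) (X : M → E3) (γ : ℝ → M) (J : Set ℝ) : Prop :=
  IsUnitSpeedOn X γ J ∧ ∀ t ∈ J, velocity γ t ∈ F.line (γ t)

/-- `F` is a planar geodesic foliation of the immersed surface: every leaf is a geodesic and lies
in a plane that is parallel to the surface normal along the leaf. The set `J` runs over all open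
intervals, bounded or not, so that maximal leaves are included. -/
def Foliation.IsPlanarGeodesic (F : Foliation M) (X : M → E3) : Prop :=
  ∀ (γ : ℝ → M) (J : Set ℝ), IsOpen J → J.OrdConnected → F.IsLeafOn X γ J →
    IsUnitSpeedGeodesicOn X γ J ∧ ∃ P : AffineSubspace ℝ E3, LiesInNormalPlane X γ J P

end PlanarGeodesicFoliations

section CurvatureLines

variable {M : Type*} [TopologicalSpace M] [ChartedSpace (EuclideanSpace ℝ (Fin 2)) M]

/-- `w` is a principal direction at `p`: for a smooth unit normal `N` near `p`, the derivative of
`N` in the direction `w` is a multiple of `w` (formula of Rodrigues). The choice of `N`, unique up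
to sign near `p`, does not matter. -/
def IsPrincipalDirection (X : M → E3) (p : M) (w : TangentSpace (𝓡 2) p) : Prop :=
  w ≠ 0 ∧ ∃ U : Set M, IsOpen U ∧ p ∈ U ∧ ∃ N : M → E3,
    ContMDiffOn (𝓡 2) 𝓘(ℝ, E3) ∞ N U ∧ IsUnitNormalOn X N U ∧
    ∃ k : ℝ, dMap N p w = -(k • dMap X p w)

/-- The curve `c` is a line of curvature of the surface. -/
def IsLineOfCurvature (X : M → E3) (c : ℝ → M) : Prop :=
  ContMDiff 𝓘(ℝ, ℝ) (𝓡 2) ∞ c ∧ ∀ t, IsPrincipalDirection X (c t) (velocity c t)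

/-- `Φ : ℝ² → M` consists of curvature line coordinates: `Φ` is a local diffeomorphism, its two
families of coordinate curves are lines of curvature, and they are orthogonal to one another. -/
structure IsCurvatureLineParam (X : M → E3) (Φ : ℝ × ℝ → M) : Prop where
  localDiffeo : IsLocalDiffeomorph 𝓘(ℝ, ℝ × ℝ) (𝓡 2) ∞ Φ
  u_curves : ∀ v, IsLineOfCurvature X (fun u => Φ (u, v))
  v_curves : ∀ u, IsLineOfCurvature X (fun v => Φ (u, v))
  orthogonal : ∀ u v,
    inner ℝ (deriv (fun u' => X (Φ (u', v))) u) (deriv (fun v' => X (Φ (u, v'))) v) = 0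

end CurvatureLines

/-- `(r' / |r'|, q₁, q₂)` is a rotation minimizing frame along the regular space curve `r`: it is
orthonormal, and the derivatives of `q₁` and `q₂` are parallel to `r'`. -/
structure IsRotationMinimizingFrame (r q₁ q₂ : ℝ → E3) : Prop where
  smooth_r : ContDiff ℝ ∞ r
  smooth_q₁ : ContDiff ℝ ∞ q₁
  smooth_q₂ : ContDiff ℝ ∞ q₂
  regular : ∀ v, deriv r v ≠ 0
  orthonormal : ∀ v, Orthonormal ℝ ![‖deriv r v‖⁻¹ • deriv r v, q₁ v, q₂ v]
  parallel_q₁ : ∀ v, ∃ a : ℝ, deriv q₁ v = a • deriv r v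
  parallel_q₂ : ∀ v, ∃ a : ℝ, deriv q₂ v = a • deriv r v

end PGF

end

/-!
Why the theorem holds. A planar geodesic foliation has an adapted orthonormal frame `(T, B, N)`:
`T` is the unit tangent of the leaves, `B` the tangent vector of the surface orthogonal to the
leaves, `N` the normal. The leaves are geodesics, so the derivative of `T` along a leaf is `k N`;
the plane of a leaf is spanned by `T` and `N`, so `B` is constant along the leaf. These two facts
and the Codazzi equation give the structure equations `PlanarFrame.fderiv_T_t` up to
`PlanarFrame.fderiv_curv_b`: the derivatives of `T` and `N` across the leaves are multiples of `B`,
and the curvature `k` of the leaves is constant along their orthogonal trajectories.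
`PlanarFrame.exists_box` integrates them to local coordinates (`AdaptedBox`) whose first coordinate
is arc length along the leaves.

The frame is global only up to signs, so the argument is carried out on the bundle of adapted
frames (`FrameBundle`), where two frames over a point differ by a sign change
(`FrameBundle.exists_flip_eq`). Completeness of the surface makes the integral curves of the first
two frame vectors, lifted to this bundle, exist for all time (`exists_complete_curve`). With `flow`
the resulting flows, the parameterization is the base point of
`sheet z (u, v) = flow 0 u (flow 1 v z)` for an arbitrary frame `z`. The flow along the leaves takes
orthogonal trajectories to orthogonal trajectories with positive speed (`flowsAlong_flow_comp`), so
the map is an immersion, and the leaves through the points of the spine `v ↦ flow 1 v z` have the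
same curvature as functions of arc length (`bend_sheet`). They are therefore congruent plane curves,
which is `X_sheet`; along the spine, `T` and `N` together with the tangent `B` form a rotation
minimizing frame, by the structure equations.

For the covering property it is shown that wherever two such parameterizations meet, either one
lifts through the other by a continuous map `ℝ² → ℝ²` (`exists_lift`). The point is that the curve
`v ↦ sheet z (u, v)` runs through the whole orthogonal trajectory of its points
(`exists_reparam`): transporting the trajectory back to the spine gives a curve there whose speed is
continuous on the whole line. Lifting yields that the image of the parameterization is closed, hence
all of `M` (`surjective_sheet`), and sections over neighborhoods of every point
(`isCoveringMap_sheet`).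
-/

noncomputable section

namespace PGF

/-! ### Linear algebra and calculus -/

theorem orthonormal_expansion {A : Fin 3 → E3} (h : Orthonormal ℝ A) (v : E3) :
    v = inner ℝ (A 0) v • A 0 + inner ℝ (A 1) v • A 1 + inner ℝ (A 2) v • A 2 := by
  have hs : Submodule.span ℝ (range A) = ⊤ :=
    h.linearIndependent.span_eq_top_of_card_eq_finrank (by simp)
  have := (OrthonormalBasis.mk h hs.ge).sum_repr' v
  simpa [Fin.sum_univ_three] using this.symm

/-- Near `x₀`, the solutions of an autonomous differential equation exist for a uniform time and
stay in a prescribed neighborhood during this time. -/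
theorem exists_trapped_solutions {E : Type*} [NormedAddCommGroup E] [NormedSpace ℝ E]
    [CompleteSpace E] {W : E → E} {x₀ : E} (hW : ContDiffAt ℝ 1 W x₀) {O : Set E}
    (hO : O ∈ 𝓝 x₀) :
    ∃ r > (0 : ℝ), ∃ ε > (0 : ℝ), ∀ x ∈ Metric.ball x₀ r, ∃ α : ℝ → E, α 0 = x ∧
      ∀ t ∈ Ioo (-ε) ε, HasDerivAt α (W (α t)) t ∧ α t ∈ O := by
  classical
  -- Outside a small ball the field is cut off to zero, so that solutions cannot move fast.
  obtain ⟨δ, hδ, hδO⟩ := Metric.mem_nhds_iff.1 (inter_mem hO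
    (hW.continuousAt.norm.eventually_lt_const (lt_add_one ‖W x₀‖)))
  set C := ‖W x₀‖ + 1 with hC
  have hCpos : 0 < C := by positivity
  let V : E → E := fun x => if x ∈ Metric.ball x₀ δ then W x else 0
  have hVW : V =ᶠ[𝓝 x₀] W := by
    filter_upwards [Metric.ball_mem_nhds x₀ hδ] with x hx using if_pos hx
  have hVC : ∀ x, ‖V x‖ ≤ C := fun x => by
    by_cases hx : x ∈ Metric.ball x₀ δ
    · simpa only [V, if_pos hx] using le_of_lt (hδO hx).2
    · simpa only [V, if_neg hx, norm_zero] using hCpos.le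
  obtain ⟨r, hr, ε, hε, H⟩ :=
    (hW.congr_of_eventuallyEq hVW).exists_forall_mem_closedBall_exists_eq_forall_mem_Ioo_hasDerivAt 0
  simp only [zero_sub, zero_add] at H
  refine ⟨min r (δ / 2), by positivity, min ε (δ / 2 / C), by positivity, fun x hx => ?_⟩
  rw [Metric.mem_ball, lt_min_iff] at hx
  obtain ⟨α, hα0, hα⟩ := H x (Metric.mem_closedBall.2 hx.1.le)
  have hsub : Ioo (-min ε (δ / 2 / C)) (min ε (δ / 2 / C)) ⊆ Ioo (-ε) ε := fun t ht =>
    ⟨by linarith [ht.1, min_le_left ε (δ / 2 / C)], by linarith [ht.2, min_le_left ε (δ / 2 / C)]⟩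
  refine ⟨α, hα0, fun t ht => ?_⟩
  have hb : α t ∈ Metric.ball x₀ δ := by
    have h0 : (0 : ℝ) ∈ Ioo (-min ε (δ / 2 / C)) (min ε (δ / 2 / C)) := by
      constructor <;> [rw [neg_lt_zero]; skip] <;> positivity
    have h1 := Convex.norm_image_sub_le_of_norm_hasDerivWithin_le
      (fun s hs => (hα s (hsub hs)).hasDerivWithinAt) (fun s _ => hVC (α s)) (convex_Ioo _ _) h0 ht
    have h2 : |t| < δ / 2 / C := (abs_lt.2 ht).trans_le (min_le_right _ _)
    rw [lt_div_iff₀ hCpos] at h2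
    rw [hα0, sub_zero, Real.norm_eq_abs] at h1
    rw [Metric.mem_ball]
    calc dist (α t) x₀ ≤ dist (α t) x + dist x x₀ := dist_triangle _ _ _
      _ < δ := by rw [dist_eq_norm (α t)]; linarith
  exact ⟨by simpa only [V, if_pos hb] using hα t (hsub ht), (hδO hb).1⟩

/-- Solutions of a differential equation with smooth right-hand side are smooth. -/
theorem contDiffOn_of_hasDerivAt {E : Type*} [NormedAddCommGroup E] [NormedSpace ℝ E]
    {W : E → E} {O : Set E} (hW : ContDiffOn ℝ ∞ W O) {α : ℝ → E} {I : Set ℝ} (hI : IsOpen I)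
    (hα : ∀ t ∈ I, HasDerivAt α (W (α t)) t ∧ α t ∈ O) : ContDiffOn ℝ ∞ α I := by
  rw [contDiffOn_infty]
  intro n
  induction n with
  | zero =>
    exact contDiffOn_zero.2 fun t ht => (hα t ht).1.continuousAt.continuousWithinAt
  | succ n ih =>
    rw [Nat.cast_add_one, contDiffOn_succ_iff_deriv_of_isOpen hI]
    refine ⟨fun t ht => (hα t ht).1.differentiableAt.differentiableWithinAt, by simp, ?_⟩
    refine ((hW.of_le (mod_cast le_top)).comp ih fun t ht => (hα t ht).2).congr fun t ht => ?_
    exact (hα t ht).1.deriv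

section Immersion

variable {G H A : Type*} [NormedAddCommGroup G] [NormedSpace ℝ G] [FiniteDimensional ℝ G]
  [NormedAddCommGroup H] [NormedSpace ℝ H] [FiniteDimensional ℝ H]
  [NormedAddCommGroup A] [NormedSpace ℝ A]

/-- By the inverse function theorem, an immersion has a smooth left inverse near every point. -/
theorem exists_smooth_leftInverse {Y : G → H} {x : G} (hY : ContDiffAt ℝ ∞ Y x)
    (hinj : Function.Injective (fderiv ℝ Y x)) :
    ∃ l : H → G, ContDiffAt ℝ ∞ l (Y x) ∧ ∀ᶠ x' in 𝓝 x, l (Y x') = x' := by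
  obtain ⟨P, hP⟩ := (fderiv ℝ Y x : G →ₗ[ℝ] H).exists_leftInverse_of_injective
    (LinearMap.ker_eq_bot.2 hinj)
  let P' : H →L[ℝ] G := LinearMap.toContinuousLinearMap P
  have hPY : ContDiffAt ℝ ∞ (P' ∘ Y) x := P'.contDiff.contDiffAt.comp x hY
  have hd : HasFDerivAt (P' ∘ Y) ((ContinuousLinearEquiv.refl ℝ G : G ≃L[ℝ] G) : G →L[ℝ] G) x := by
    refine (P'.hasFDerivAt.comp x (hY.differentiableAt (by simp)).hasFDerivAt).congr_fderiv ?_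
    ext v
    exact LinearMap.congr_fun hP v
  have hn : (∞ : WithTop ℕ∞) ≠ 0 := by simp
  have : CompleteSpace G := FiniteDimensional.complete ℝ G
  refine ⟨hPY.localInverse hd hn ∘ P', ?_, ?_⟩
  · exact (hPY.to_localInverse hd hn).comp (Y x) P'.contDiff.contDiffAt
  · exact (hPY.hasStrictFDerivAt' hd hn).eventually_left_inverse

/-- Composing with an immersion detects smoothness of continuous maps. -/
theorem contDiffAt_of_immersion_comp {Y : G → H} {w : A → G} {a : A}
    (hY : ContDiffAt ℝ ∞ Y (w a)) (hinj : Function.Injective (fderiv ℝ Y (w a)))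
    (hw : ContinuousAt w a) (hYw : ContDiffAt ℝ ∞ (Y ∘ w) a) : ContDiffAt ℝ ∞ w a := by
  obtain ⟨l, hl, hlY⟩ := exists_smooth_leftInverse hY hinj
  refine (ContDiffAt.comp a (g := l) hl hYw).congr_of_eventuallyEq ?_
  filter_upwards [hw.eventually hlY] with x hx using hx.symm

/-- Composing with an immersion detects the derivative of continuous maps. -/
theorem hasFDerivAt_of_immersion_comp {Y : G → H} {w : A → G} {a : A}
    (hY : ContDiffAt ℝ ∞ Y (w a)) (hinj : Function.Injective (fderiv ℝ Y (w a)))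
    (hw : ContinuousAt w a) {L : A →L[ℝ] G}
    (hYw : HasFDerivAt (Y ∘ w) ((fderiv ℝ Y (w a)).comp L) a) : HasFDerivAt w L a := by
  obtain ⟨l, hl, hlY⟩ := exists_smooth_leftInverse hY hinj
  have hld := (hl.differentiableAt (by simp)).hasFDerivAt
  have hid : (fderiv ℝ l (Y (w a))).comp (fderiv ℝ Y (w a)) = ContinuousLinearMap.id ℝ G :=
    (hld.comp (w a) (hY.differentiableAt (by simp)).hasFDerivAt).unique
      ((hasFDerivAt_id (w a)).congr_of_eventuallyEq hlY)
  have := (HasFDerivAt.comp a (g := l) hld hYw).congr_of_eventuallyEq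
    (f₁ := w) (by filter_upwards [hw.eventually hlY] with x hx using hx.symm)
  rwa [← ContinuousLinearMap.comp_assoc, hid, ContinuousLinearMap.id_comp] at this

theorem hasDerivAt_of_immersion_comp {Y : G → H} {w : ℝ → G} {a : ℝ}
    (hY : ContDiffAt ℝ ∞ Y (w a)) (hinj : Function.Injective (fderiv ℝ Y (w a)))
    (hw : ContinuousAt w a) {v : G}
    (hYw : HasDerivAt (Y ∘ w) (fderiv ℝ Y (w a) v) a) : HasDerivAt w v a := by
  rw [hasDerivAt_iff_hasFDerivAt] at hYw ⊢
  refine hasFDerivAt_of_immersion_comp hY hinj hw (hYw.congr_fderiv ?_)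
  ext
  simp

end Immersion

/-! ### A criterion for covering maps -/

/-- A local homeomorphism is a covering map if around every point of the base there is a connected
neighborhood over which a continuous section passes through every point. -/
theorem isCoveringMap_of_sections {E Y : Type*} [TopologicalSpace E] [TopologicalSpace Y]
    [T2Space E] {f : E → Y} (hf : IsLocalHomeomorph f)
    (h : ∀ y, ∃ U : Set Y, IsOpen U ∧ y ∈ U ∧ IsPreconnected U ∧ ∀ q, f q ∈ U →
      ∃ s : Y → E, ContinuousOn s U ∧ (∀ y' ∈ U, f (s y') = y') ∧ s (f q) = q) :
    IsCoveringMap f := by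
  intro y
  obtain ⟨U, hUo, hyU, hUc, hs⟩ := h y
  have hs' : ∀ q, ∃ s : Y → E, f q ∈ U →
      ContinuousOn s U ∧ (∀ y' ∈ U, f (s y') = y') ∧ s (f q) = q := fun q => by
    by_cases hq : f q ∈ U
    · exact (hs q hq).imp fun _ h _ => h
    · exact ⟨fun _ => q, fun h => absurd h hq⟩
  choose s hs using hs'
  have hsc := fun q hq => (hs q hq).1
  have hsf := fun q hq => (hs q hq).2.1
  have hsq := fun q hq => (hs q hq).2.2
  -- Sections over the connected set `U` that agree at a point agree on `U`. So `U` is covered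
  -- evenly, the sheet of a point `q` being recorded by the value at `y` of the section through `q`.
  have huniq : ∀ q q', f q ∈ U → f q' ∈ U → ∀ y' ∈ U, s q y' = s q' y' → EqOn (s q) (s q') U := by
    intro q q' hq hq' y' hy' he
    refine (T2Space.isSeparatedMap f).eqOn_of_comp_eqOn hf.isLocallyInjective hUc (hsc q hq)
      (hsc q' hq') (fun z hz => ?_) hy' he
    simp [hsf q hq z hz, hsf q' hq' z hz]
  have hdisc : DiscreteTopology (f ⁻¹' {y}) :=
    (IsDiscrete.of_openPartialHomeomorph f (subset_refl (f ⁻¹' {y})) fun e _ => by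
      obtain ⟨φ, h1, h2⟩ := hf e
      exact ⟨φ, h1, h2.symm⟩).1
  refine ⟨hdisc, U, hyU, hUo, hUo.preimage hf.continuous, ?_⟩
  have hconst : ∀ q₀, f q₀ ∈ U → ∀ᶠ q in 𝓝 q₀, f q ∈ U → s q y = s q₀ y := by
    intro q₀ hq₀
    obtain ⟨φ, hφ, rfl⟩ := hf q₀
    have hc : ContinuousAt (fun q => s q₀ (φ q)) q₀ :=
      ContinuousAt.comp (f := φ) ((hsc q₀ hq₀).continuousAt (hUo.mem_nhds hq₀))
        hf.continuous.continuousAt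
    have h1 : ∀ᶠ q in 𝓝 q₀, s q₀ (φ q) ∈ φ.source :=
      hc.eventually_mem (by rw [hsq q₀ hq₀]; exact φ.open_source.mem_nhds hφ)
    filter_upwards [h1, φ.open_source.mem_nhds hφ] with q h1 h2 hq
    refine huniq q q₀ hq hq₀ (φ q) hq ?_ hyU
    rw [hsq q hq]
    exact φ.injOn h2 h1 (hsf q₀ hq₀ _ hq).symm
  refine ⟨{
    toFun := fun q => (⟨f q, q.2⟩, ⟨s q y, hsf q q.2 y hyU⟩)
    invFun := fun z => ⟨s z.2 z.1, by
      have h2 : f z.2 ∈ U := by rw [z.2.2]; exact hyU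
      rw [mem_preimage, hsf z.2 h2 _ z.1.2]; exact z.1.2⟩
    left_inv := fun q => Subtype.ext ?_
    right_inv := fun z => ?_
    continuous_toFun := ?_
    continuous_invFun := ?_ }, fun _ => rfl⟩
  · have hq : f q ∈ U := q.2
    have hi : f (s q y) = y := hsf q hq y hyU
    have hi' : f (s q y) ∈ U := by rwa [hi]
    have := huniq (s q y) q hi' hq y hyU (by have h := hsq _ hi'; rwa [hi] at h)
    exact (this hq).trans (hsq q hq)
  · have h2 : f z.2 ∈ U := by rw [z.2.2]; exact hyU
    have hfz := hsf z.2 h2 z.1 z.1.2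
    have h3 : f (s z.2 z.1) ∈ U := by rw [hfz]; exact z.1.2
    refine Prod.ext (Subtype.ext hfz) (Subtype.ext ?_)
    have := huniq (s z.2 z.1) z.2 h3 h2 z.1 z.1.2 (by have h := hsq _ h3; rwa [hfz] at h)
    refine (this hyU).trans ?_
    have h4 := hsq _ h2
    have h5 : f z.2 = y := z.2.2
    rwa [h5] at h4
  · refine Continuous.prodMk (Continuous.subtype_mk (hf.continuous.comp continuous_subtype_val) _)
      (Continuous.subtype_mk ?_ _)
    rw [continuous_iff_continuousAt]
    intro q
    refine (continuousAt_const (y := s q y)).congr ?_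
    filter_upwards [continuous_subtype_val.continuousAt.eventually (hconst q q.2)] with q' hq'
    exact (hq' q'.2).symm
  · refine Continuous.subtype_mk ?_ _
    rw [continuous_prod_of_discrete_right]
    intro i
    have h2 : f i ∈ U := by rw [i.2]; exact hyU
    exact continuousOn_iff_continuous_domRestrict.1 (hsc i h2)

/-! ### Adapted coordinates in a parameter domain -/

section Plane

theorem one_add_one_le_infty : (1 + 1 : WithTop ℕ∞) ≤ (∞ : WithTop ℕ∞) := by
  rw [one_add_one_eq_two]
  exact WithTop.coe_le_coe.2 (le_top (a := (2 : ℕ∞)))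

variable {G : Type*} [NormedAddCommGroup G] [NormedSpace ℝ G]

/-- A smooth orthonormal frame field `(T, B, N)` along an immersed surface `Y` over the open set `O`
of parameters. The fields `T` and `B` are tangent to the surface, with preimages `t` and `b` under
the differential of `Y`. The integral curves of `t`, called leaves, are geodesics, and `B` is
constant along them; the latter says that the leaves are plane curves in planes spanned by `T` and
`N`. -/
structure PlanarFrame (O : Set G) (Y T B N : G → E3) (t b : G → G) : Prop where
  isOpen : IsOpen O
  smooth_Y : ContDiffOn ℝ ∞ Y O
  smooth_T : ContDiffOn ℝ ∞ T O
  smooth_B : ContDiffOn ℝ ∞ B O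
  smooth_N : ContDiffOn ℝ ∞ N O
  smooth_t : ContDiffOn ℝ ∞ t O
  smooth_b : ContDiffOn ℝ ∞ b O
  injective : ∀ x ∈ O, Function.Injective (fderiv ℝ Y x)
  orthonormal : ∀ x ∈ O, Orthonormal ℝ ![T x, B x, N x]
  fderiv_t : ∀ x ∈ O, fderiv ℝ Y x (t x) = T x
  fderiv_b : ∀ x ∈ O, fderiv ℝ Y x (b x) = B x
  normal : ∀ x ∈ O, ∀ w, inner ℝ (N x) (fderiv ℝ Y x w) = 0
  geodesic : ∀ x ∈ O, ∀ w, inner ℝ (fderiv ℝ T x (t x)) (fderiv ℝ Y x w) = 0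
  planar : ∀ x ∈ O, fderiv ℝ B x (t x) = 0

/-- Differentiating a constant inner product. -/
theorem inner_fderiv_eq_neg {O : Set G} (hO : IsOpen O) {f g : G → E3} (hf : ContDiffOn ℝ ∞ f O)
    (hg : ContDiffOn ℝ ∞ g O) {c : ℝ} (h : ∀ x ∈ O, inner ℝ (f x) (g x) = c) {x : G} (hx : x ∈ O)
    (w : G) : inner ℝ (fderiv ℝ f x w) (g x) = -inner ℝ (f x) (fderiv ℝ g x w) := by
  have hn : O ∈ 𝓝 x := hO.mem_nhds hx
  have h1 := ((hf.contDiffAt hn).differentiableAt (by simp)).hasFDerivAt.inner ℝ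
    ((hg.contDiffAt hn).differentiableAt (by simp)).hasFDerivAt
  have h2 : HasFDerivAt (fun y => inner ℝ (f y) (g y)) (0 : G →L[ℝ] ℝ) x :=
    (hasFDerivAt_const c x).congr_of_eventuallyEq (by filter_upwards [hn] with y hy using h y hy)
  have := congrArg (fun L : G →L[ℝ] ℝ => L w) (h1.unique h2)
  simp [fderivInnerCLM_apply] at this
  linarith

theorem fderiv_fderiv_apply {O : Set G} (hO : IsOpen O) {f : G → E3} (hf : ContDiffOn ℝ ∞ f O)
    {v : G → G} (hv : ContDiffOn ℝ ∞ v O) {x : G} (hx : x ∈ O) (w : G) :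
    fderiv ℝ (fun y => fderiv ℝ f y (v y)) x w
      = fderiv ℝ (fderiv ℝ f) x w (v x) + fderiv ℝ f x (fderiv ℝ v x w) := by
  have hn : O ∈ 𝓝 x := hO.mem_nhds hx
  have h1 : DifferentiableAt ℝ (fderiv ℝ f) x :=
    ((hf.contDiffAt hn).fderiv_right (m := 1) one_add_one_le_infty).differentiableAt (by simp)
  have h2 : DifferentiableAt ℝ v x := (hv.contDiffAt hn).differentiableAt (by simp)
  rw [(h1.hasFDerivAt.clm_apply h2.hasFDerivAt).fderiv]
  simp [add_comm]

theorem fderiv_fderiv_symm {O : Set G} (hO : IsOpen O) {f : G → E3} (hf : ContDiffOn ℝ ∞ f O)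
    {x : G} (hx : x ∈ O) (v w : G) :
    fderiv ℝ (fderiv ℝ f) x v w = fderiv ℝ (fderiv ℝ f) x w v :=
  ((hf.contDiffAt (hO.mem_nhds hx)).isSymmSndFDerivAt
    (by rw [minSmoothness_of_isRCLikeNormedField]; exact one_add_one_le_infty)).eq v w

/-- A vector field whose image under the differential of an immersion is smooth is smooth. -/
theorem contDiffOn_of_fderiv_apply [FiniteDimensional ℝ G] {O : Set G} (hO : IsOpen O)
    {Y V : G → E3} (hY : ContDiffOn ℝ ∞ Y O) (hinj : ∀ x ∈ O, Function.Injective (fderiv ℝ Y x))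
    (hV : ContDiffOn ℝ ∞ V O) {v : G → G} (hv : ∀ x ∈ O, fderiv ℝ Y x (v x) = V x) :
    ContDiffOn ℝ ∞ v O := by
  intro x hx
  have hn : O ∈ 𝓝 x := hO.mem_nhds hx
  have hYx := hY.contDiffAt hn
  obtain ⟨l, hl, hlY⟩ := exists_smooth_leftInverse hYx (hinj x hx)
  have hs : ContDiffAt ℝ ∞ (fun y => fderiv ℝ l (Y y) (V y)) x :=
    (ContDiffAt.comp x (g := fderiv ℝ l) (hl.fderiv_right (by simp)) hYx).clm_apply
      (hV.contDiffAt hn)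
  refine (hs.congr_of_eventuallyEq ?_).contDiffWithinAt
  have hl1 : ∀ᶠ y in 𝓝 x, DifferentiableAt ℝ l (Y y) :=
    hYx.continuousAt.eventually (((hl.of_le (m := 1) (by simp)).eventually (by simp)).mono
      fun y hy => hy.differentiableAt (by simp))
  filter_upwards [eventually_eventually_nhds.2 hlY, hl1, hn] with y h1 h2 h3
  have := (h2.hasFDerivAt.comp y ((hY.contDiffAt (hO.mem_nhds h3)).differentiableAt
    (by simp)).hasFDerivAt).unique ((hasFDerivAt_id y).congr_of_eventuallyEq h1)
  have := congrArg (fun L : G →L[ℝ] G => L (v y)) this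
  simp only [ContinuousLinearMap.comp_apply, ContinuousLinearMap.id_apply, hv y h3] at this
  exact this.symm

namespace PlanarFrame

variable {O : Set G} {Y T B N : G → E3} {t b : G → G}

/-- The curvature of the leaves. -/
def curv (T N : G → E3) (t : G → G) (x : G) : ℝ := inner ℝ (fderiv ℝ T x (t x)) (N x)

variable (h : PlanarFrame O Y T B N t b) {x : G} (hx : x ∈ O)
include h hx

theorem norm_T : inner ℝ (T x) (T x) = (1 : ℝ) := by
  have := (h.orthonormal x hx).1 0; simp at this; simp [this]
theorem norm_B : inner ℝ (B x) (B x) = (1 : ℝ) := by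
  have := (h.orthonormal x hx).1 1; simp at this; simp [this]
theorem norm_N : inner ℝ (N x) (N x) = (1 : ℝ) := by
  have := (h.orthonormal x hx).1 2; simp at this; simp [this]
theorem inner_TB : inner ℝ (T x) (B x) = (0 : ℝ) :=
  (h.orthonormal x hx).2 (i := 0) (j := 1) (by simp)
theorem inner_TN : inner ℝ (T x) (N x) = (0 : ℝ) :=
  (h.orthonormal x hx).2 (i := 0) (j := 2) (by simp)
theorem inner_BN : inner ℝ (B x) (N x) = (0 : ℝ) :=
  (h.orthonormal x hx).2 (i := 1) (j := 2) (by decide)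
theorem expansion (v : E3) :
    v = inner ℝ (T x) v • T x + inner ℝ (B x) v • B x + inner ℝ (N x) v • N x :=
  orthonormal_expansion (h.orthonormal x hx) v

theorem fderiv_T_t : fderiv ℝ T x (t x) = curv T N t x • N x := by
  have h1 := h.geodesic x hx (t x)
  have h2 := h.geodesic x hx (b x)
  rw [h.fderiv_t x hx] at h1
  rw [h.fderiv_b x hx] at h2
  rw [h.expansion hx (fderiv ℝ T x (t x)), real_inner_comm, h1, real_inner_comm, h2, curv,
    real_inner_comm (N x)]
  simp

theorem inner_T_fderiv_T (w : G) : inner ℝ (T x) (fderiv ℝ T x w) = 0 := by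
  have := inner_fderiv_eq_neg h.isOpen h.smooth_T h.smooth_T (fun y hy => h.norm_T hy) hx w
  rw [real_inner_comm] at this
  linarith

theorem inner_N_fderiv_N (w : G) : inner ℝ (N x) (fderiv ℝ N x w) = 0 := by
  have := inner_fderiv_eq_neg h.isOpen h.smooth_N h.smooth_N (fun y hy => h.norm_N hy) hx w
  rw [real_inner_comm] at this
  linarith

/-- The derivative of the leaf direction across the leaves is the image of a Lie bracket, hence
tangent to the surface. -/
theorem fderiv_T_b_eq :
    fderiv ℝ T x (b x) = fderiv ℝ Y x (fderiv ℝ t x (b x) - fderiv ℝ b x (t x)) := by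
  have e1 : fderiv ℝ (fun y => fderiv ℝ Y y (t y)) x = fderiv ℝ T x :=
    Filter.EventuallyEq.fderiv_eq
      (by filter_upwards [h.isOpen.mem_nhds hx] with y hy using h.fderiv_t y hy)
  have e2 : fderiv ℝ (fun y => fderiv ℝ Y y (b y)) x = fderiv ℝ B x :=
    Filter.EventuallyEq.fderiv_eq
      (by filter_upwards [h.isOpen.mem_nhds hx] with y hy using h.fderiv_b y hy)
  have h1 := fderiv_fderiv_apply h.isOpen h.smooth_Y h.smooth_t hx (b x)
  have h2 := fderiv_fderiv_apply h.isOpen h.smooth_Y h.smooth_b hx (t x)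
  rw [e1] at h1
  rw [e2, h.planar x hx, fderiv_fderiv_symm h.isOpen h.smooth_Y hx] at h2
  rw [h1, map_sub, eq_neg_of_add_eq_zero_left h2.symm]
  abel

theorem inner_N_fderiv_T_b : inner ℝ (fderiv ℝ T x (b x)) (N x) = 0 := by
  rw [h.fderiv_T_b_eq hx, real_inner_comm, h.normal x hx]

theorem fderiv_T_b : fderiv ℝ T x (b x) = inner ℝ (B x) (fderiv ℝ T x (b x)) • B x := by
  conv_lhs => rw [h.expansion hx (fderiv ℝ T x (b x))]
  rw [h.inner_T_fderiv_T hx, real_inner_comm, real_inner_comm _ (N x), h.inner_N_fderiv_T_b hx]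
  simp

/-- The Lie bracket of the fields `b` and `t` is a multiple of `b`. -/
theorem bracket_eq : fderiv ℝ t x (b x) - fderiv ℝ b x (t x)
    = (inner ℝ (B x) (fderiv ℝ T x (b x)) : ℝ) • b x := by
  apply h.injective x hx
  rw [← h.fderiv_T_b_eq hx, map_smul, h.fderiv_b x hx]
  exact h.fderiv_T_b hx

theorem fderiv_N_t : fderiv ℝ N x (t x) = -curv T N t x • T x := by
  have h1 := inner_fderiv_eq_neg h.isOpen h.smooth_T h.smooth_N (fun y hy => h.inner_TN hy) hx (t x)
  have h2 := inner_fderiv_eq_neg h.isOpen h.smooth_B h.smooth_N (fun y hy => h.inner_BN hy) hx (t x)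
  rw [h.planar x hx, inner_zero_left] at h2
  rw [h.expansion hx (fderiv ℝ N x (t x)), h.inner_N_fderiv_N hx, curv,
    show inner ℝ (B x) (fderiv ℝ N x (t x)) = (0 : ℝ) by linarith, h1]
  simp

theorem fderiv_N_b : fderiv ℝ N x (b x) = inner ℝ (B x) (fderiv ℝ N x (b x)) • B x := by
  have h1 := inner_fderiv_eq_neg h.isOpen h.smooth_T h.smooth_N (fun y hy => h.inner_TN hy) hx (b x)
  rw [h.inner_N_fderiv_T_b hx] at h1
  conv_lhs => rw [h.expansion hx (fderiv ℝ N x (b x)), h.inner_N_fderiv_N hx,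
    show inner ℝ (T x) (fderiv ℝ N x (b x)) = (0 : ℝ) by linarith]
  simp

omit hx in
theorem smooth_curv : ContDiffOn ℝ ∞ (curv T N t) O :=
  ((h.smooth_T.fderiv_of_isOpen h.isOpen (by simp)).clm_apply h.smooth_t).inner ℝ h.smooth_N

/-- By the Codazzi equation the curvature of the leaves is constant along their orthogonal
trajectories. -/
theorem fderiv_curv_b : fderiv ℝ (curv T N t) x (b x) = 0 := by
  have hn : O ∈ 𝓝 x := h.isOpen.mem_nhds hx
  have hDT : ContDiffOn ℝ ∞ (fun y => fderiv ℝ T y (t y)) O :=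
    (h.smooth_T.fderiv_of_isOpen h.isOpen (by simp)).clm_apply h.smooth_t
  have hDb : ContDiffOn ℝ ∞ (fun y => fderiv ℝ T y (b y)) O :=
    (h.smooth_T.fderiv_of_isOpen h.isOpen (by simp)).clm_apply h.smooth_b
  have hk : fderiv ℝ (curv T N t) x (b x)
      = inner ℝ (fderiv ℝ T x (t x)) (fderiv ℝ N x (b x))
        + inner ℝ (fderiv ℝ (fun y => fderiv ℝ T y (t y)) x (b x)) (N x) := by
    unfold curv
    rw [fderiv_inner_apply ℝ ((hDT.contDiffAt hn).differentiableAt (by simp))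
      ((h.smooth_N.contDiffAt hn).differentiableAt (by simp))]
  have h0 := inner_fderiv_eq_neg h.isOpen hDb h.smooth_N
    (fun y hy => h.inner_N_fderiv_T_b hy) hx (t x)
  have e1 : inner ℝ (fderiv ℝ T x (b x)) (fderiv ℝ N x (t x)) = (0 : ℝ) := by
    rw [h.fderiv_N_t hx, inner_smul_right, real_inner_comm, h.inner_T_fderiv_T hx, mul_zero]
  have e2 : inner ℝ (fderiv ℝ T x (t x)) (fderiv ℝ N x (b x)) = (0 : ℝ) := by
    rw [h.fderiv_T_t hx, inner_smul_left, h.inner_N_fderiv_N hx, mul_zero]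
  rw [e1, fderiv_fderiv_apply h.isOpen h.smooth_T h.smooth_b hx, inner_add_left] at h0
  rw [hk, e2, fderiv_fderiv_apply h.isOpen h.smooth_T h.smooth_t hx, inner_add_left,
    fderiv_fderiv_symm h.isOpen h.smooth_T hx]
  have e3 : fderiv ℝ T x (fderiv ℝ t x (b x)) = fderiv ℝ T x (fderiv ℝ b x (t x))
      + (inner ℝ (B x) (fderiv ℝ T x (b x)) : ℝ) • fderiv ℝ T x (b x) := by
    rw [← map_smul, ← h.bracket_eq hx, ← map_add]
    congr 1
    abel
  rw [e3, inner_add_left, inner_smul_left, h.inner_N_fderiv_T_b hx]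
  linarith

theorem eq_combination (w : G) : ∃ p q : ℝ, w = p • t x + q • b x := by
  refine ⟨inner ℝ (T x) (fderiv ℝ Y x w), inner ℝ (B x) (fderiv ℝ Y x w), h.injective x hx ?_⟩
  rw [map_add, map_smul, map_smul, h.fderiv_t x hx, h.fderiv_b x hx]
  conv_lhs => rw [h.expansion hx (fderiv ℝ Y x w), h.normal x hx]
  simp

/-- The one-form dual to the leaf direction is closed. -/
theorem fderiv_dual_form_symm (v w : G) :
    fderiv ℝ (fun y => (innerSL ℝ (T y)).comp (fderiv ℝ Y y)) x v w
      = fderiv ℝ (fun y => (innerSL ℝ (T y)).comp (fderiv ℝ Y y)) x w v := by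
  have hn : O ∈ 𝓝 x := h.isOpen.mem_nhds hx
  have hT := ((h.smooth_T.contDiffAt hn).differentiableAt (by simp)).hasFDerivAt
  have hY := (((h.smooth_Y.contDiffAt hn).fderiv_right (m := 1)
    one_add_one_le_infty).differentiableAt (by simp)).hasFDerivAt
  have hT' : HasFDerivAt (fun y => innerSL ℝ (T y)) ((innerSL ℝ).comp (fderiv ℝ T x)) x :=
    (innerSL ℝ (E := E3)).hasFDerivAt.comp x hT
  have key : ∀ v w, fderiv ℝ (fun y => (innerSL ℝ (T y)).comp (fderiv ℝ Y y)) x v w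
      = inner ℝ (T x) (fderiv ℝ (fderiv ℝ Y) x v w)
        + inner ℝ (fderiv ℝ T x v) (fderiv ℝ Y x w) := fun v w => by
    rw [(hT'.clm_comp hY).fderiv]
    simp
  have hs : inner ℝ (fderiv ℝ T x v) (fderiv ℝ Y x w)
      = (inner ℝ (fderiv ℝ T x w) (fderiv ℝ Y x v) : ℝ) := by
    obtain ⟨p, q, rfl⟩ := h.eq_combination hx v
    obtain ⟨p', q', rfl⟩ := h.eq_combination hx w
    have e1 : inner ℝ (fderiv ℝ T x (b x)) (T x) = (0 : ℝ) := by
      rw [real_inner_comm, h.inner_T_fderiv_T hx]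
    have e2 : inner ℝ (N x) (T x) = (0 : ℝ) := by rw [real_inner_comm, h.inner_TN hx]
    have e3 : inner ℝ (N x) (B x) = (0 : ℝ) := by rw [real_inner_comm, h.inner_BN hx]
    simp only [map_add, map_smul, h.fderiv_T_t hx, h.fderiv_t x hx, h.fderiv_b x hx,
      inner_add_left, inner_add_right, inner_smul_left, inner_smul_right, e1, e2, e3]
    simp
    ring
  rw [key, key, fderiv_fderiv_symm h.isOpen h.smooth_Y hx, hs]

end PlanarFrame

/-- The linear map `ℝ² → ℝ³` with prescribed values on the standard basis. -/
def ofCols (p q : E3) : ℝ × ℝ →L[ℝ] E3 :=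
  (ContinuousLinearMap.fst ℝ ℝ ℝ).smulRight p + (ContinuousLinearMap.snd ℝ ℝ ℝ).smulRight q

@[simp] theorem ofCols_apply (p q : E3) (w : ℝ × ℝ) : ofCols p q w = w.1 • p + w.2 • q := rfl

theorem eq_ofCols (L : ℝ × ℝ →L[ℝ] E3) : L = ofCols (L (1, 0)) (L (0, 1)) := by
  ext <;> simp

variable [FiniteDimensional ℝ G]

namespace PlanarFrame

variable {O : Set G} {Y T B N : G → E3} {t b : G → G}

/-- Around every point there are coordinates in which the leaves and their orthogonal trajectories
are the coordinate lines. The first coordinate is arc length along the leaves, a primitive of the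
closed form dual to `T`; the second one is `⟪Y - Y x₀, B⟫`, which is constant on the leaves because
`B` is. -/
theorem exists_box (h : PlanarFrame O Y T B N t b) {x₀ : G} (hx₀ : x₀ ∈ O) :
    ∃ (φ : OpenPartialHomeomorph G (ℝ × ℝ)) (ε : ℝ) (ρ c d : ℝ × ℝ → ℝ) (k : ℝ → ℝ),
      0 < ε ∧ x₀ ∈ φ.source ∧ φ x₀ = 0 ∧ φ.source ⊆ O ∧
      φ.target = Ioo (-ε) ε ×ˢ Ioo (-ε) ε ∧
      ContDiffOn ℝ ∞ φ φ.source ∧ ContDiffOn ℝ ∞ φ.symm φ.target ∧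
      ContDiffOn ℝ ∞ ρ φ.target ∧ ContDiffOn ℝ ∞ k (Ioo (-ε) ε) ∧
      ∀ w ∈ φ.target, 0 < ρ w ∧
        HasFDerivAt (Y ∘ φ.symm) (ofCols (T (φ.symm w)) (ρ w • B (φ.symm w))) w ∧
        HasFDerivAt (T ∘ φ.symm) (ofCols (k w.1 • N (φ.symm w)) (c w • B (φ.symm w))) w ∧
        HasFDerivAt (N ∘ φ.symm) (ofCols (-k w.1 • T (φ.symm w)) (d w • B (φ.symm w))) w ∧
        fderiv ℝ (B ∘ φ.symm) w (1, 0) = 0 := by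
  obtain ⟨δ, hδ, hδO⟩ := Metric.isOpen_iff.1 h.isOpen x₀ hx₀
  -- arc length along the leaves
  have hdiff : DifferentiableOn ℝ (fun y => (innerSL ℝ (T y)).comp (fderiv ℝ Y y))
      (Metric.ball x₀ δ) := fun y hy => by
    have hn := h.isOpen.mem_nhds (hδO hy)
    have hT := (h.smooth_T.contDiffAt hn).differentiableAt (by simp)
    have hY := ((h.smooth_Y.contDiffAt hn).fderiv_right (m := 1)
      one_add_one_le_infty).differentiableAt (by simp)
    have hT' : DifferentiableAt ℝ (fun y => innerSL ℝ (T y)) y :=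
      ((innerSL ℝ (E := E3)).hasFDerivAt.comp y hT.hasFDerivAt).differentiableAt
    exact (hT'.hasFDerivAt.clm_comp hY.hasFDerivAt).differentiableAt.differentiableWithinAt
  obtain ⟨u₀, hu₀⟩ := (convex_ball x₀ δ).exists_forall_hasFDerivAt_of_fderiv_symmetric
    Metric.isOpen_ball hdiff (fun y hy v w => h.fderiv_dual_form_symm (hδO hy) v w)
  let u : G → ℝ := fun y => u₀ y - u₀ x₀
  let g : G → ℝ := fun y => inner ℝ (Y y - Y x₀) (B y)
  have hu : ∀ y ∈ Metric.ball x₀ δ, HasFDerivAt u ((innerSL ℝ (T y)).comp (fderiv ℝ Y y)) y :=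
    fun y hy => (hu₀ y hy).sub_const _
  have hus : ContDiffOn ℝ ∞ u (Metric.ball x₀ δ) := by
    rw [show (∞ : WithTop ℕ∞) = (∞ : WithTop ℕ∞) + 1 from rfl,
      contDiffOn_succ_iff_fderiv_of_isOpen Metric.isOpen_ball]
    refine ⟨fun y hy => (hu y hy).differentiableAt.differentiableWithinAt, by simp, ?_⟩
    have : ContDiffOn ℝ ∞ (fun y => (innerSL ℝ (T y)).comp (fderiv ℝ Y y)) (Metric.ball x₀ δ) :=
      ((innerSL ℝ (E := E3)).contDiff.comp_contDiffOn (h.smooth_T.mono hδO)).clm_comp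
        ((h.smooth_Y.fderiv_of_isOpen h.isOpen (by simp)).mono hδO)
    exact this.congr fun y hy => (hu y hy).fderiv
  have hgs : ContDiffOn ℝ ∞ g O := (h.smooth_Y.sub contDiffOn_const).inner ℝ h.smooth_B
  have hgd : ∀ y ∈ O, ∀ w, fderiv ℝ g y w = inner ℝ (Y y - Y x₀) (fderiv ℝ B y w)
      + inner ℝ (fderiv ℝ Y y w) (B y) := fun y hy w => by
    have hn := h.isOpen.mem_nhds hy
    have hY := (h.smooth_Y.contDiffAt hn).differentiableAt (by simp)
    simp only [g]
    rw [fderiv_inner_apply ℝ (hY.sub_const _)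
      ((h.smooth_B.contDiffAt hn).differentiableAt (by simp)), fderiv_sub_const]
  have hgt : ∀ y ∈ O, fderiv ℝ g y (t y) = 0 := fun y hy => by
    rw [hgd y hy, h.planar y hy, h.fderiv_t y hy, h.inner_TB hy]; simp
  let m : G → ℝ := fun y => fderiv ℝ g y (b y)
  have hms : ContDiffOn ℝ ∞ m O :=
    (hgs.fderiv_of_isOpen h.isOpen (by simp)).clm_apply h.smooth_b
  have hm0 : m x₀ = 1 := by
    simp only [m]; rw [hgd x₀ hx₀, h.fderiv_b x₀ hx₀, h.norm_B hx₀]; simp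
  obtain ⟨δ', hδ', hδ'm⟩ := Metric.mem_nhds_iff.1 ((hms.continuousOn.continuousAt
    (h.isOpen.mem_nhds hx₀)).eventually_const_lt (show (0 : ℝ) < m x₀ by rw [hm0]; norm_num))
  -- where `m` is positive, the two functions have independent differentials
  let P := Metric.ball x₀ δ ∩ Metric.ball x₀ δ'
  have hPo : IsOpen P := Metric.isOpen_ball.inter Metric.isOpen_ball
  have hPO : P ⊆ O := fun y hy => hδO hy.1
  have hx₀P : x₀ ∈ P := ⟨Metric.mem_ball_self hδ, Metric.mem_ball_self hδ'⟩
  have hmP : ∀ y ∈ P, 0 < m y := fun y hy => hδ'm hy.2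
  let F : G → ℝ × ℝ := fun y => (u y, g y)
  have hFs : ContDiffOn ℝ ∞ F P := (hus.mono inter_subset_left).prodMk (hgs.mono hPO)
  -- the differential of the coordinates
  have hFd : ∀ y ∈ P, ∃ L : G ≃L[ℝ] ℝ × ℝ, HasFDerivAt F (L : G →L[ℝ] ℝ × ℝ) y ∧
      L (t y) = (1, 0) ∧ L (b y) = (0, m y) := by
    intro y hy
    have hd := (hu y hy.1).prodMk ((hgs.contDiffAt (h.isOpen.mem_nhds (hPO hy))).differentiableAt
      (by simp)).hasFDerivAt
    set L₀ := ((innerSL ℝ (T y)).comp (fderiv ℝ Y y)).prod (fderiv ℝ g y)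
    have ht : L₀ (t y) = (1, 0) := by
      refine Prod.ext ?_ (hgt y (hPO hy))
      change inner ℝ (T y) (fderiv ℝ Y y (t y)) = (1 : ℝ)
      rw [h.fderiv_t y (hPO hy), h.norm_T (hPO hy)]
    have hb : L₀ (b y) = (0, m y) := by
      simp [L₀, h.fderiv_b y (hPO hy), h.inner_TB (hPO hy), m]
    have hne := (hmP y hy).ne'
    refine ⟨ContinuousLinearEquiv.equivOfInverse L₀
      ((ContinuousLinearMap.fst ℝ ℝ ℝ).smulRight (t y)
        + (ContinuousLinearMap.snd ℝ ℝ ℝ).smulRight ((m y)⁻¹ • b y)) ?_ ?_, hd, ht, hb⟩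
    · intro w
      obtain ⟨p, q, rfl⟩ := h.eq_combination (hPO hy) w
      simp [ht, hb, smul_smul, hne]
    · intro w
      simp [ht, hb, hne]
  obtain ⟨L, hL, -, -⟩ := hFd x₀ hx₀P
  have hF0 : ContDiffAt ℝ ∞ F x₀ := hFs.contDiffAt (hPo.mem_nhds hx₀P)
  have hcomp : CompleteSpace G := FiniteDimensional.complete ℝ G
  let ψ₀ := (hF0.toOpenPartialHomeomorph F hL (by simp)).restrOpen P hPo
  have hψ₀F : (ψ₀ : G → ℝ × ℝ) = F := rfl
  have hψ₀x : x₀ ∈ ψ₀.source := ⟨hF0.mem_toOpenPartialHomeomorph_source hL (by simp), hx₀P⟩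
  have hψ₀P : ψ₀.source ⊆ P := fun y hy => hy.2
  have hFx₀ : F x₀ = 0 := by simp [F, u, g]
  have ht0 : ψ₀.target ∈ 𝓝 (0 : ℝ × ℝ) := by
    rw [← hFx₀]; exact ψ₀.open_target.mem_nhds (ψ₀.map_source hψ₀x)
  obtain ⟨ε, hε, hεt⟩ := Metric.mem_nhds_iff.1 ht0
  have hsq : Ioo (-ε) ε ×ˢ Ioo (-ε) ε = Metric.ball (0 : ℝ × ℝ) ε := by
    rw [← Prod.mk_zero_zero, ← ball_prod_same, Real.ball_eq_Ioo]; simp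
  let ψ := (ψ₀.symm.restrOpen (Ioo (-ε) ε ×ˢ Ioo (-ε) ε) (isOpen_Ioo.prod isOpen_Ioo)).symm
  have hψt : ψ.target = Ioo (-ε) ε ×ˢ Ioo (-ε) ε := by
    change ψ₀.target ∩ _ = _
    rw [inter_eq_right, hsq]; exact hεt
  have hψF : (ψ : G → ℝ × ℝ) = F := rfl
  have hψs : ψ.source ⊆ P := by
    intro y hy
    have h1 : ψ y ∈ ψ₀.target := hεt (by rw [← hsq, ← hψt]; exact ψ.map_source hy)
    have h2 : ψ₀.symm (ψ y) = y := ψ.left_inv hy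
    exact hψ₀P (h2 ▸ ψ₀.map_target h1)
  have hPw : ∀ w ∈ ψ.target, ψ.symm w ∈ P := fun w hw => hψs (ψ.map_target hw)
  have hψd : ∀ w ∈ ψ.target, ∃ M : G ≃L[ℝ] ℝ × ℝ, HasFDerivAt ψ (M : G →L[ℝ] ℝ × ℝ) (ψ.symm w) ∧
      M.symm (1, 0) = t (ψ.symm w) ∧ M.symm (0, 1) = (m (ψ.symm w))⁻¹ • b (ψ.symm w) := by
    intro w hw
    obtain ⟨M, hM, ht, hb⟩ := hFd _ (hPw w hw)
    refine ⟨M, hM, by rw [← ht, M.symm_apply_apply], ?_⟩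
    rw [ContinuousLinearEquiv.symm_apply_eq, map_smul, hb]
    simp [(hmP _ (hPw w hw)).ne']
  have hss : ContDiffOn ℝ ∞ ψ.symm ψ.target := fun w hw => by
    obtain ⟨M, hM, -, -⟩ := hψd w hw
    exact (ψ.contDiffAt_symm hw hM
      (hFs.contDiffAt (hPo.mem_nhds (hPw w hw)))).contDiffWithinAt
  have hmap : MapsTo ψ.symm ψ.target O := fun w hw => hPO (hPw w hw)
  -- the differential of any function in the new coordinates
  have hcomp : ∀ w ∈ ψ.target, ∀ f : G → E3, ContDiffOn ℝ ∞ f O →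
      HasFDerivAt (f ∘ ψ.symm) (ofCols (fderiv ℝ f (ψ.symm w) (t (ψ.symm w)))
        ((m (ψ.symm w))⁻¹ • fderiv ℝ f (ψ.symm w) (b (ψ.symm w)))) w := by
    intro w hw f hf
    obtain ⟨M, hM, ht, hb⟩ := hψd w hw
    have := (((hf.contDiffAt (h.isOpen.mem_nhds (hmap hw))).differentiableAt
      (by simp)).hasFDerivAt).comp w (ψ.hasFDerivAt_symm hw hM)
    rw [eq_ofCols (ContinuousLinearMap.comp _ _)] at this
    simpa [ht, hb] using this
  -- the curvature depends on the first coordinate only, as its derivative along `b` vanishes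
  have hcurv : ∀ w ∈ ψ.target, curv T N t (ψ.symm w) = curv T N t (ψ.symm (w.1, 0)) := by
    rintro ⟨s, τ⟩ hw
    have hw' : s ∈ Ioo (-ε) ε ∧ τ ∈ Ioo (-ε) ε := by rw [hψt] at hw; exact hw
    refine isOpen_Ioo.is_const_of_deriv_eq_zero (f := fun τ => curv T N t (ψ.symm (s, τ)))
      (s := Ioo (-ε) ε) (convex_Ioo _ _).isPreconnected ?_ ?_ hw'.2
      ⟨neg_lt_zero.2 hε, hε⟩
    all_goals
      intro τ' hτ'
      have hw'' : (s, τ') ∈ ψ.target := by rw [hψt]; exact ⟨hw'.1, hτ'⟩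
      obtain ⟨M, hM, -, hb⟩ := hψd _ hw''
      have hd := ((h.smooth_curv.contDiffAt (h.isOpen.mem_nhds (hmap hw''))).differentiableAt
        (by simp)).hasFDerivAt.comp_hasDerivAt τ' ((ψ.hasFDerivAt_symm hw'' hM).comp_hasDerivAt τ'
          ((hasDerivAt_const τ' s).prodMk (hasDerivAt_id τ')))
    · exact hd.differentiableAt.differentiableWithinAt
    · refine hd.deriv.trans ?_
      simp only [ContinuousLinearEquiv.coe_coe]
      rw [hb, map_smul, h.fderiv_curv_b (hmap hw''), smul_zero]
      rfl
  refine ⟨ψ, ε, fun w => (m (ψ.symm w))⁻¹,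
    fun w => (m (ψ.symm w))⁻¹ * inner ℝ (B (ψ.symm w)) (fderiv ℝ T (ψ.symm w) (b (ψ.symm w))),
    fun w => (m (ψ.symm w))⁻¹ * inner ℝ (B (ψ.symm w)) (fderiv ℝ N (ψ.symm w) (b (ψ.symm w))),
    fun s => curv T N t (ψ.symm (s, 0)), hε, ?_, hFx₀, hψs.trans hPO, hψt, hFs.mono hψs, hss,
    (hms.comp hss hmap).inv fun w hw => (hmP _ (hPw w hw)).ne', ?_, fun w hw =>
      ⟨inv_pos.2 (hmP _ (hPw w hw)), ?_, ?_, ?_, ?_⟩⟩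
  · have h0 : (0 : ℝ × ℝ) ∈ ψ.target := by rw [hψt, hsq]; exact Metric.mem_ball_self hε
    have h1 : ψ.symm 0 = x₀ := by
      rw [← hFx₀]; exact ψ₀.left_inv hψ₀x
    rw [← h1]; exact ψ.map_target h0
  · refine h.smooth_curv.comp (hss.comp (contDiff_id.prodMk contDiff_const).contDiffOn ?_) ?_
    all_goals
      intro s hs
      have hw : ((s, 0) : ℝ × ℝ) ∈ ψ.target := by rw [hψt]; exact ⟨hs, neg_lt_zero.2 hε, hε⟩
    exacts [hw, hmap hw]
  · have := hcomp w hw Y h.smooth_Y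
    rwa [h.fderiv_t _ (hmap hw), h.fderiv_b _ (hmap hw)] at this
  · have := hcomp w hw T h.smooth_T
    rwa [h.fderiv_T_t (hmap hw), h.fderiv_T_b (hmap hw), hcurv w hw, smul_smul] at this
  · have := hcomp w hw N h.smooth_N
    rwa [h.fderiv_N_t (hmap hw), h.fderiv_N_b (hmap hw), hcurv w hw, smul_smul] at this
  · rw [(hcomp w hw B h.smooth_B).fderiv, h.planar _ (hmap hw)]
    simp

end PlanarFrame

end Plane

/-! ### Adapted frames on the surface -/

section AdaptedFrames

variable {M : Type*} [TopologicalSpace M] [ChartedSpace (EuclideanSpace ℝ (Fin 2)) M]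
  [IsManifold (𝓡 2) ∞ M]

/-- `A` is an orthonormal basis of `ℝ³` that is adapted to the surface and the foliation at `p`:
`A 0` is tangent to the leaf, `A 1` is tangent to the surface, and `A 2` is normal to it. -/
structure IsAdaptedFrame (X : M → E3) (F : Foliation M) (p : M) (A : Fin 3 → E3) : Prop where
  orthonormal : Orthonormal ℝ A
  mem_line : A 0 ∈ (F.line p).map (dMap X p : TangentSpace (𝓡 2) p →ₗ[ℝ] E3)
  mem_tangentPlane : A 1 ∈ tangentPlane X p
  mem_normalLine : A 2 ∈ normalLine X p

theorem IsAdaptedFrame.leaf_mem_tangentPlane {X : M → E3} {F : Foliation M} {p : M} {A : Fin 3 → E3}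
    (h : IsAdaptedFrame X F p A) : A 0 ∈ tangentPlane X p := by
  obtain ⟨v, -, hv⟩ := h.mem_line
  exact ⟨v, hv⟩

omit [IsManifold (𝓡 2) ∞ M] in
theorem finrank_tangentPlane {X : M → E3} (hX : IsImmersedSurface X) (p : M) :
    Module.finrank ℝ (tangentPlane X p) = 2 := by
  rw [tangentPlane, LinearMap.finrank_range_of_inj (hX.2 p)]
  exact finrank_euclideanSpace_fin (𝕜 := ℝ) (n := 2)

theorem line_eq_span (F : Foliation M) (p : M) :
    ∃ v : TangentSpace (𝓡 2) p, v ≠ 0 ∧ F.line p = Submodule.span ℝ {v} := by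
  obtain ⟨U, -, hp, T, -, hT⟩ := F.smooth p
  exact ⟨T p, hT p hp⟩

/-- Unit vectors along the foliation differ at most by a sign. -/
theorem eq_or_eq_neg_of_mem_line {X : M → E3} {F : Foliation M} {p : M} {v w : E3}
    (hv : v ∈ (F.line p).map (dMap X p : TangentSpace (𝓡 2) p →ₗ[ℝ] E3))
    (hw : w ∈ (F.line p).map (dMap X p : TangentSpace (𝓡 2) p →ₗ[ℝ] E3))
    (hv1 : ‖v‖ = 1) (hw1 : ‖w‖ = 1) : v = w ∨ v = -w := by
  obtain ⟨u, -, hu⟩ := line_eq_span F p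
  rw [hu, Submodule.map_span, image_singleton, Submodule.mem_span_singleton] at hv hw
  obtain ⟨a, rfl⟩ := hv
  obtain ⟨b, rfl⟩ := hw
  set z := (dMap X p : TangentSpace (𝓡 2) p →ₗ[ℝ] E3) u
  rw [norm_smul, Real.norm_eq_abs] at hv1 hw1
  have hz : ‖z‖ ≠ 0 := fun h => by simp [h] at hv1
  have hab : |a| = |b| := mul_right_cancel₀ hz (hv1.trans hw1.symm)
  rcases abs_eq_abs.1 hab with h | h
  · exact Or.inl (by rw [h])
  · exact Or.inr (by rw [h, neg_smul])

theorem exists_isAdaptedFrame {X : M → E3} (hX : IsImmersedSurface X) (F : Foliation M) (p : M) :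
    ∃ A, IsAdaptedFrame X F p A := by
  obtain ⟨u, hu0, hu⟩ := line_eq_span F p
  have unit : ∀ S : Submodule ℝ E3, 0 < Module.finrank ℝ S → ∃ v ∈ S, ‖v‖ = 1 := fun S hS => by
    have : Nontrivial S := Module.nontrivial_of_finrank_pos hS
    obtain ⟨v, hv⟩ := exists_ne (0 : S)
    have hv' : ‖(v : E3)‖ ≠ 0 := by simpa using hv
    exact ⟨‖(v : E3)‖⁻¹ • (v : E3), S.smul_mem _ v.2, by rw [norm_smul]; simp [hv']⟩
  have hfin : Module.finrank ℝ ((F.line p).map (dMap X p : TangentSpace (𝓡 2) p →ₗ[ℝ] E3)) = 1 := by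
    rw [hu, Submodule.map_span, image_singleton]
    refine finrank_span_singleton fun h => hu0 (hX.2 p ?_)
    rw [map_zero]; exact h
  obtain ⟨t, ht, ht1⟩ := unit _ (by rw [hfin]; norm_num)
  have htp : t ∈ tangentPlane X p := by
    obtain ⟨v, -, hv⟩ := ht; exact ⟨v, hv⟩
  have ht0 : t ≠ 0 := fun h => by simp [h] at ht1
  have hfb := Submodule.finrank_add_inf_finrank_orthogonal (𝕜 := ℝ) (K₁ := Submodule.span ℝ {t})
    (K₂ := tangentPlane X p) (by simpa using htp)
  rw [finrank_span_singleton ht0, finrank_tangentPlane hX] at hfb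
  obtain ⟨b, hb, hb1⟩ := unit ((Submodule.span ℝ {t})ᗮ ⊓ tangentPlane X p) (by omega)
  have hfn := (tangentPlane X p).finrank_add_finrank_orthogonal
  rw [finrank_tangentPlane hX, finrank_euclideanSpace_fin] at hfn
  obtain ⟨n, hn, hn1⟩ := unit (tangentPlane X p)ᗮ (by omega)
  have htb : inner ℝ t b = (0 : ℝ) := Submodule.mem_orthogonal_singleton_iff_inner_right.1 hb.1
  have htn : inner ℝ t n = (0 : ℝ) := (Submodule.mem_orthogonal _ _).1 hn _ htp
  have hbn : inner ℝ b n = (0 : ℝ) := (Submodule.mem_orthogonal _ _).1 hn _ hb.2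
  refine ⟨![t, b, n], ?_, ht, hb.2, hn⟩
  constructor
  · intro i; fin_cases i <;> simp [ht1, hb1, hn1]
  · intro i j hij
    fin_cases i <;> fin_cases j <;>
      simp [htb, htn, hbn, real_inner_comm t b, real_inner_comm t n,
        real_inner_comm b n] at hij ⊢

/-- Changing the signs of the three vectors of a frame. -/
def signFlip (σ : Fin 3 → ℝ) (A : Fin 3 → E3) : Fin 3 → E3 := fun i => σ i • A i

/-- A triple of signs. -/
def IsSign (σ : Fin 3 → ℝ) : Prop := ∀ i, σ i = 1 ∨ σ i = -1

theorem IsSign.mul_self {σ : Fin 3 → ℝ} (h : IsSign σ) (i : Fin 3) : σ i * σ i = 1 := by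
  rcases h i with h | h <;> simp [h]

theorem IsSign.abs_eq_one {σ : Fin 3 → ℝ} (h : IsSign σ) (i : Fin 3) : |σ i| = 1 := by
  rcases h i with h | h <;> simp [h]

theorem IsAdaptedFrame.flip_signs {X : M → E3} {F : Foliation M} {p : M} {A : Fin 3 → E3}
    (h : IsAdaptedFrame X F p A) {σ : Fin 3 → ℝ} (hσ : IsSign σ) :
    IsAdaptedFrame X F p (signFlip σ A) := by
  refine ⟨⟨fun i => ?_, fun i j hij => ?_⟩, Submodule.smul_mem _ _ h.mem_line,
    Submodule.smul_mem _ _ h.mem_tangentPlane, Submodule.smul_mem _ _ h.mem_normalLine⟩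
  · change ‖σ i • A i‖ = 1
    rw [norm_smul, h.orthonormal.1 i, Real.norm_eq_abs, hσ.abs_eq_one, mul_one]
  · change inner ℝ (σ i • A i) (σ j • A j) = 0
    rw [inner_smul_left, inner_smul_right, h.orthonormal.2 hij]
    simp

/-- Two adapted frames at the same point differ only by signs. -/
theorem IsAdaptedFrame.eq_flip {X : M → E3} {F : Foliation M} {p : M} {A A' : Fin 3 → E3}
    (h : IsAdaptedFrame X F p A) (h' : IsAdaptedFrame X F p A') :
    ∃ σ, IsSign σ ∧ A' = signFlip σ A := by
  have key : ∀ v w : E3, ‖v‖ = 1 → ‖w‖ = 1 → (∃ c : ℝ, w = c • v) →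
      w = (1 : ℝ) • v ∨ w = (-1 : ℝ) • v := by
    rintro v _ hv hw ⟨c, rfl⟩
    rw [norm_smul, hv, mul_one, Real.norm_eq_abs] at hw
    rcases eq_or_eq_neg_of_abs_eq hw with h | h <;> simp [h]
  have h0 : A' 0 = (1 : ℝ) • A 0 ∨ A' 0 = (-1 : ℝ) • A 0 := by
    simpa using eq_or_eq_neg_of_mem_line h'.mem_line h.mem_line (h'.orthonormal.1 0)
      (h.orthonormal.1 0)
  have h0' : ∃ c : ℝ, A 0 = c • A' 0 := by
    rcases h0 with h | h
    · exact ⟨1, by simp [h]⟩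
    · exact ⟨-1, by simp [h]⟩
  obtain ⟨c, hc⟩ := h0'
  have e1 : inner ℝ (A 0) (A' 1) = (0 : ℝ) := by
    rw [hc, inner_smul_left, h'.orthonormal.2 (by decide : (0 : Fin 3) ≠ 1), mul_zero]
  have e2 : inner ℝ (A 2) (A' 1) = (0 : ℝ) := by
    rw [real_inner_comm]
    exact (Submodule.mem_orthogonal _ _).1 h.mem_normalLine _ h'.mem_tangentPlane
  have e3 : inner ℝ (A 0) (A' 2) = (0 : ℝ) :=
    (Submodule.mem_orthogonal _ _).1 h'.mem_normalLine _ h.leaf_mem_tangentPlane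
  have e4 : inner ℝ (A 1) (A' 2) = (0 : ℝ) :=
    (Submodule.mem_orthogonal _ _).1 h'.mem_normalLine _ h.mem_tangentPlane
  have h1 := key (A 1) (A' 1) (h.orthonormal.1 1) (h'.orthonormal.1 1)
    ⟨inner ℝ (A 1) (A' 1), by
      conv_lhs => rw [orthonormal_expansion h.orthonormal (A' 1), e1, e2]
      simp⟩
  have h2 := key (A 2) (A' 2) (h.orthonormal.1 2) (h'.orthonormal.1 2)
    ⟨inner ℝ (A 2) (A' 2), by
      conv_lhs => rw [orthonormal_expansion h.orthonormal (A' 2), e3, e4]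
      simp⟩
  have h012 : ∀ i, ∃ s : ℝ, (s = 1 ∨ s = -1) ∧ A' i = s • A i := by
    have aux : ∀ i, (A' i = (1 : ℝ) • A i ∨ A' i = (-1 : ℝ) • A i) →
        ∃ s : ℝ, (s = 1 ∨ s = -1) ∧ A' i = s • A i := by
      rintro i (h | h)
      exacts [⟨1, Or.inl rfl, h⟩, ⟨-1, Or.inr rfl, h⟩]
    intro i
    fin_cases i
    exacts [aux 0 h0, aux 1 h1, aux 2 h2]
  choose σ hσ hA using h012
  exact ⟨σ, hσ, funext hA⟩

/-! ### The surface in a chart -/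

theorem fderiv_comp_chart_symm {X : M → E3} (hX : IsImmersedSurface X) (p : M)
    {x : EuclideanSpace ℝ (Fin 2)} (hx : x ∈ (chartAt (EuclideanSpace ℝ (Fin 2)) p).target)
    (w : EuclideanSpace ℝ (Fin 2)) :
    fderiv ℝ (X ∘ (chartAt (EuclideanSpace ℝ (Fin 2)) p).symm) x w
      = dMap X ((chartAt (EuclideanSpace ℝ (Fin 2)) p).symm x)
        (mfderiv (𝓡 2) (𝓡 2) (chartAt (EuclideanSpace ℝ (Fin 2)) p).symm x w) := by
  have h1 := (mdifferentiable_chart (I := 𝓡 2) p).mdifferentiableAt_symm hx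
  have h2 : MDifferentiableAt (𝓡 2) 𝓘(ℝ, E3) X
    ((chartAt (EuclideanSpace ℝ (Fin 2)) p).symm x) := hX.1.mdifferentiableAt (by simp)
  rw [← mfderiv_eq_fderiv, mfderiv_comp x h2 h1]
  rfl

theorem injective_fderiv_comp_chart_symm {X : M → E3} (hX : IsImmersedSurface X) (p : M)
    {x : EuclideanSpace ℝ (Fin 2)} (hx : x ∈ (chartAt (EuclideanSpace ℝ (Fin 2)) p).target) :
    Function.Injective (fderiv ℝ (X ∘ (chartAt (EuclideanSpace ℝ (Fin 2)) p).symm) x) := by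
  intro v w hvw
  rw [fderiv_comp_chart_symm hX p hx, fderiv_comp_chart_symm hX p hx] at hvw
  exact (mdifferentiable_chart (I := 𝓡 2) p).symm.mfderiv_injective hx (hX.2 _ hvw)

theorem mem_tangentPlane_chart {X : M → E3} (hX : IsImmersedSurface X) (p : M)
    {x : EuclideanSpace ℝ (Fin 2)} (hx : x ∈ (chartAt (EuclideanSpace ℝ (Fin 2)) p).target)
    (v : E3) : v ∈ tangentPlane X ((chartAt (EuclideanSpace ℝ (Fin 2)) p).symm x) ↔
      ∃ w, fderiv ℝ (X ∘ (chartAt (EuclideanSpace ℝ (Fin 2)) p).symm) x w = v := by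
  constructor
  · rintro ⟨u, hu⟩
    obtain ⟨w, hw⟩ := (mdifferentiable_chart (I := 𝓡 2) p).symm.mfderiv_surjective hx u
    exact ⟨w, (fderiv_comp_chart_symm hX p hx w).trans ((congrArg (dMap X _) hw).trans hu)⟩
  · rintro ⟨w, rfl⟩
    exact ⟨_, (fderiv_comp_chart_symm hX p hx w).symm⟩

theorem contDiffOn_comp_chart_symm {X : M → E3} (hX : IsImmersedSurface X) (p : M) :
    ContDiffOn ℝ ∞ (X ∘ (chartAt (EuclideanSpace ℝ (Fin 2)) p).symm)
      (chartAt (EuclideanSpace ℝ (Fin 2)) p).target := by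
  rw [← contMDiffOn_iff_contDiffOn]
  exact hX.1.comp_contMDiffOn contMDiffOn_chart_symm

/-- The unit tangent field of the foliation, as an `ℝ³`-valued field in a chart. -/
theorem exists_leaf_field {X : M → E3} (hX : IsImmersedSurface X) (F : Foliation M) (p : M)
    {v : E3} (hv : v ∈ (F.line p).map (dMap X p : TangentSpace (𝓡 2) p →ₗ[ℝ] E3)) (hv1 : ‖v‖ = 1) :
    ∃ (O : Set (EuclideanSpace ℝ (Fin 2))) (T : EuclideanSpace ℝ (Fin 2) → E3), IsOpen O ∧
      chartAt (EuclideanSpace ℝ (Fin 2)) p p ∈ O ∧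
      O ⊆ (chartAt (EuclideanSpace ℝ (Fin 2)) p).target ∧ ContDiffOn ℝ ∞ T O ∧
      (∀ x ∈ O, ‖T x‖ = 1 ∧
        T x ∈ (F.line ((chartAt (EuclideanSpace ℝ (Fin 2)) p).symm x)).map
          (dMap X ((chartAt (EuclideanSpace ℝ (Fin 2)) p).symm x) :
            TangentSpace (𝓡 2) ((chartAt (EuclideanSpace ℝ (Fin 2)) p).symm x) →ₗ[ℝ] E3)) ∧
      T (chartAt (EuclideanSpace ℝ (Fin 2)) p p) = v := by
  set c := chartAt (EuclideanSpace ℝ (Fin 2)) p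
  obtain ⟨U, hUo, hpU, S, hS, hline⟩ := F.smooth p
  let V : M → E3 := fun q => dMap X q (S q)
  have hV : ContMDiffOn (𝓡 2) 𝓘(ℝ, E3) ∞ V U :=
    (contMDiff_snd_tangentBundle_modelSpace E3 𝓘(ℝ, E3)).comp_contMDiffOn
      ((hX.1.contMDiff_tangentMap (m := ∞) le_rfl).comp_contMDiffOn hS)
  have hV0 : ∀ q ∈ U, V q ≠ 0 := fun q hq h0 =>
    (hline q hq).1 (hX.2 q (by rw [map_zero]; exact h0))
  let O := c.target ∩ c.symm ⁻¹' U
  have hcs : ContMDiffOn (𝓡 2) (𝓡 2) ∞ c.symm c.target := contMDiffOn_chart_symm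
  have hO : IsOpen O := c.isOpen_inter_preimage_symm hUo
  have hpO : c p ∈ O := ⟨c.map_source (mem_chart_source _ p), by
    rw [mem_preimage, c.left_inv (mem_chart_source _ p)]; exact hpU⟩
  have hVc : ContDiffOn ℝ ∞ (fun x => V (c.symm x)) O := by
    rw [← contMDiffOn_iff_contDiffOn]
    exact hV.comp (hcs.mono inter_subset_left) fun x hx => hx.2
  have hVmem : ∀ q ∈ U, ∀ a : ℝ,
      a • V q ∈ (F.line q).map (dMap X q : TangentSpace (𝓡 2) q →ₗ[ℝ] E3) := fun q hq a =>
    Submodule.smul_mem _ _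
      ⟨S q, by rw [(hline q hq).2]; exact Submodule.mem_span_singleton_self _, rfl⟩
  have hnorm : ∀ q ∈ U, ‖(‖V q‖⁻¹ : ℝ) • V q‖ = 1 := fun q hq => by
    rw [norm_smul]; simp [hV0 q hq]
  have hTs : ContDiffOn ℝ ∞ (fun x => ‖V (c.symm x)‖⁻¹ • V (c.symm x)) O :=
    ((hVc.norm ℝ fun x hx => hV0 _ hx.2).inv fun x hx => by simpa using hV0 _ hx.2).smul hVc
  have hcp : c.symm (c p) = p := c.left_inv (mem_chart_source _ p)
  rcases eq_or_eq_neg_of_mem_line hv (hVmem p hpU _) hv1 (hnorm p hpU) with h | h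
  · exact ⟨O, _, hO, hpO, inter_subset_left, hTs, fun x hx => ⟨hnorm _ hx.2, hVmem _ hx.2 _⟩, by
      simp only [hcp, h]⟩
  · exact ⟨O, _, hO, hpO, inter_subset_left, hTs.neg,
      fun x hx => ⟨by rw [norm_neg]; exact hnorm _ hx.2,
        Submodule.neg_mem _ (hVmem _ hx.2 _)⟩, by simp only [hcp, h]⟩

/-- In the image of a two-dimensional space, spanned by orthonormal vectors `t` and `b`, everything
is orthogonal to `n`. -/
theorem inner_fderiv_eq_zero_of_orthonormal {G : Type*} [NormedAddCommGroup G] [NormedSpace ℝ G]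
    (hG : Module.finrank ℝ G = 2) {L : G →L[ℝ] E3} {t b n : E3} (h : Orthonormal ℝ ![t, b, n])
    (ht : ∃ w, L w = t) (hb : ∃ w, L w = b) (w : G) : inner ℝ n (L w) = 0 := by
  obtain ⟨w₁, rfl⟩ := ht
  obtain ⟨w₂, rfl⟩ := hb
  have hon : Orthonormal ℝ ![L w₁, L w₂] := by
    convert h.comp (Fin.castSucc : Fin 2 → Fin 3) (Fin.castSucc_injective 2) using 1
    ext i; fin_cases i <;> rfl
  have hli : LinearIndependent ℝ ![L w₁, L w₂] := hon.linearIndependent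
  have hli' : LinearIndependent ℝ ![w₁, w₂] := by
    refine LinearIndependent.of_comp (L : G →ₗ[ℝ] E3) ?_
    convert hli using 1
    ext i; fin_cases i <;> rfl
  have hspan := hli'.span_eq_top_of_card_eq_finrank (by simp [hG])
  have hw : w ∈ Submodule.span ℝ (range ![w₁, w₂]) := by rw [hspan]; trivial
  rw [Matrix.range_cons, Matrix.range_cons, Matrix.range_empty, union_empty, singleton_union,
    Submodule.mem_span_pair] at hw
  obtain ⟨p, q, rfl⟩ := hw
  have e1 : inner ℝ n (L w₁) = (0 : ℝ) := h.2 (i := 2) (j := 0) (by decide)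
  have e2 : inner ℝ n (L w₂) = (0 : ℝ) := h.2 (i := 2) (j := 1) (by decide)
  simp [inner_add_right, inner_smul_right, e1, e2]

/-- The component of `v` orthogonal to the unit vector `a`. -/
def orth (a v : E3) : E3 := v - (inner ℝ a v : ℝ) • a

theorem inner_orth {a v : E3} (ha : ‖a‖ = 1) : inner ℝ a (orth a v) = 0 := by
  simp [orth, inner_sub_right, inner_smul_right, ha]

theorem orth_eq_self {a v : E3} (h : inner ℝ a v = 0) : orth a v = v := by
  simp [orth, h]

theorem inner_orth_of_inner_eq_zero {a b v : E3} (h : inner ℝ b a = 0) :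
    inner ℝ b (orth a v) = inner ℝ b v := by
  simp [orth, inner_sub_right, inner_smul_right, h]

theorem ContDiffOn.orth {G : Type*} [NormedAddCommGroup G] [NormedSpace ℝ G] {O : Set G}
    {a v : G → E3} (ha : ContDiffOn ℝ ∞ a O) (hv : ContDiffOn ℝ ∞ v O) :
    ContDiffOn ℝ ∞ (fun x => PGF.orth (a x) (v x)) O :=
  hv.sub ((ha.inner ℝ hv).smul ha)

/-- Every adapted frame extends to a smooth field of adapted frames near its base point. -/
theorem exists_frame_field {X : M → E3} (hX : IsImmersedSurface X) (F : Foliation M) (p : M)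
    {A : Fin 3 → E3} (hA : IsAdaptedFrame X F p A) :
    ∃ (O : Set (EuclideanSpace ℝ (Fin 2))) (T B N : EuclideanSpace ℝ (Fin 2) → E3), IsOpen O ∧
      chartAt (EuclideanSpace ℝ (Fin 2)) p p ∈ O ∧
      O ⊆ (chartAt (EuclideanSpace ℝ (Fin 2)) p).target ∧
      ContDiffOn ℝ ∞ T O ∧ ContDiffOn ℝ ∞ B O ∧ ContDiffOn ℝ ∞ N O ∧
      (∀ x ∈ O, IsAdaptedFrame X F ((chartAt (EuclideanSpace ℝ (Fin 2)) p).symm x)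
        ![T x, B x, N x]) ∧
      T (chartAt (EuclideanSpace ℝ (Fin 2)) p p) = A 0 ∧
      B (chartAt (EuclideanSpace ℝ (Fin 2)) p p) = A 1 ∧
      N (chartAt (EuclideanSpace ℝ (Fin 2)) p p) = A 2 := by
  obtain ⟨O, T, hO, hpO, hOc, hT, hTO, hTp⟩ :=
    exists_leaf_field hX F p hA.mem_line (hA.orthonormal.1 0)
  set c := chartAt (EuclideanSpace ℝ (Fin 2)) p with hc
  have hcp : c.symm (c p) = p := c.left_inv (mem_chart_source _ p)
  have i01 : inner ℝ (A 0) (A 1) = (0 : ℝ) := hA.orthonormal.2 (by decide)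
  have i02 : inner ℝ (A 0) (A 2) = (0 : ℝ) := hA.orthonormal.2 (by decide)
  have i12 : inner ℝ (A 1) (A 2) = (0 : ℝ) := hA.orthonormal.2 (by decide)
  have n1 := hA.orthonormal.1 1
  have n2 := hA.orthonormal.1 2
  obtain ⟨w₀, hw₀⟩ := (mem_tangentPlane_chart hX p (hOc hpO) (A 1)).1
    (by rw [← hc, hcp]; exact hA.mem_tangentPlane)
  have hYs : ContDiffOn ℝ ∞ (fun x => fderiv ℝ (X ∘ c.symm) x w₀) O :=
    (((contDiffOn_comp_chart_symm hX p).mono hOc).fderiv_of_isOpen hO (by simp)).clm_apply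
      contDiffOn_const
  -- Gram–Schmidt applied to `T`, the image of a constant vector, and the constant normal vector
  let B₀ : EuclideanSpace ℝ (Fin 2) → E3 := fun x => orth (T x) (fderiv ℝ (X ∘ c.symm) x w₀)
  have hB₀s : ContDiffOn ℝ ∞ B₀ O := ContDiffOn.orth hT hYs
  have hB₀p : B₀ (c p) = A 1 := by
    simp only [B₀]; rw [hTp, hw₀, orth_eq_self i01]
  let B : EuclideanSpace ℝ (Fin 2) → E3 := fun x => ‖B₀ x‖⁻¹ • B₀ x
  have hBp : B (c p) = A 1 := by simp only [B]; rw [hB₀p, n1]; simp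
  let O₁ := O ∩ {x | B₀ x ≠ 0}
  have hO₁ : IsOpen O₁ := hB₀s.continuousOn.isOpen_inter_preimage hO isOpen_ne
  have hBs : ContDiffOn ℝ ∞ B O₁ :=
    (((hB₀s.mono inter_subset_left).norm ℝ fun x hx => hx.2).inv
      fun x hx => norm_ne_zero_iff.2 hx.2).smul (hB₀s.mono inter_subset_left)
  have hTB : ∀ x ∈ O, inner ℝ (T x) (B x) = (0 : ℝ) := fun x hx => by
    simp only [B, B₀]; rw [inner_smul_right, inner_orth (hTO x hx).1, mul_zero]
  have hB1 : ∀ x ∈ O₁, ‖B x‖ = 1 := fun x hx => by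
    have : B₀ x ≠ 0 := hx.2
    simp only [B]; rw [norm_smul]; simp [this]
  let N₀ : EuclideanSpace ℝ (Fin 2) → E3 := fun x => orth (B x) (orth (T x) (A 2))
  have hN₀s : ContDiffOn ℝ ∞ N₀ O₁ :=
    ContDiffOn.orth hBs (ContDiffOn.orth (hT.mono inter_subset_left) contDiffOn_const)
  have hN₀p : N₀ (c p) = A 2 := by
    simp only [N₀]; rw [hTp, hBp, orth_eq_self i02, orth_eq_self i12]
  let N : EuclideanSpace ℝ (Fin 2) → E3 := fun x => ‖N₀ x‖⁻¹ • N₀ x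
  let O₂ := O₁ ∩ {x | N₀ x ≠ 0}
  have hO₂ : IsOpen O₂ := hN₀s.continuousOn.isOpen_inter_preimage hO₁ isOpen_ne
  have hNs : ContDiffOn ℝ ∞ N O₂ :=
    (((hN₀s.mono inter_subset_left).norm ℝ fun x hx => hx.2).inv
      fun x hx => norm_ne_zero_iff.2 hx.2).smul (hN₀s.mono inter_subset_left)
  have hO₂O : O₂ ⊆ O := fun x hx => hx.1.1
  have hne : ∀ i, A i ≠ 0 := fun i h => by simpa [h] using hA.orthonormal.1 i
  refine ⟨O₂, T, B, N, hO₂, ⟨⟨hpO, ?_⟩, ?_⟩, hO₂O.trans hOc, hT.mono hO₂O,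
    hBs.mono inter_subset_left, hNs, fun x hx => ?_, hTp, hBp, ?_⟩
  · rw [mem_ofPred_eq, hB₀p]; exact hne 1
  · rw [mem_ofPred_eq, hN₀p]; exact hne 2
  · have hxO := hO₂O hx
    have hN1 : ‖N x‖ = 1 := by
      have : N₀ x ≠ 0 := hx.2
      simp only [N]; rw [norm_smul]; simp [this]
    have hTN : inner ℝ (T x) (N x) = (0 : ℝ) := by
      simp only [N, N₀]
      rw [inner_smul_right, inner_orth_of_inner_eq_zero (hTB x hxO), inner_orth (hTO x hxO).1,
        mul_zero]
    have hBN : inner ℝ (B x) (N x) = (0 : ℝ) := by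
      simp only [N, N₀]
      rw [inner_smul_right, inner_orth (hB1 x hx.1), mul_zero]
    have hon : Orthonormal ℝ ![T x, B x, N x] := by
      constructor
      · intro i; fin_cases i <;> simp [(hTO x hxO).1, hB1 x hx.1, hN1]
      · intro i j hij
        fin_cases i <;> fin_cases j <;>
          simp [hTB x hxO, hTN, hBN, real_inner_comm (T x) (B x), real_inner_comm (T x) (N x),
            real_inner_comm (B x) (N x)] at hij ⊢
    have hTt : T x ∈ tangentPlane X (c.symm x) := by
      obtain ⟨v, -, hv⟩ := (hTO x hxO).2
      exact ⟨v, hv⟩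
    have hBt : B x ∈ tangentPlane X (c.symm x) := by
      refine Submodule.smul_mem _ _ (Submodule.sub_mem _ ?_ (Submodule.smul_mem _ _ hTt))
      exact (mem_tangentPlane_chart hX p (hOc hxO) _).2 ⟨w₀, rfl⟩
    refine ⟨hon, (hTO x hxO).2, hBt, ?_⟩
    refine (Submodule.mem_orthogonal _ _).2 fun v hv => ?_
    obtain ⟨w, rfl⟩ := (mem_tangentPlane_chart hX p (hOc hxO) _).1 hv
    rw [real_inner_comm]
    exact inner_fderiv_eq_zero_of_orthonormal finrank_euclideanSpace_fin hon
      ((mem_tangentPlane_chart hX p (hOc hxO) _).1 hTt)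
      ((mem_tangentPlane_chart hX p (hOc hxO) _).1 hBt) w
  · simp only [N]; rw [hN₀p, n2]; simp

/-- The velocity of a curve that stays in an affine subspace lies in its direction. -/
theorem deriv_mem_direction {P : AffineSubspace ℝ E3} {f : ℝ → E3} {J : Set ℝ} (hJ : IsOpen J)
    (hf : ∀ s ∈ J, f s ∈ P) {s : ℝ} (hs : s ∈ J) {v : E3} (hv : HasDerivAt f v s) :
    v ∈ P.direction := by
  rw [← Submodule.orthogonal_orthogonal P.direction, Submodule.mem_orthogonal]
  intro y hy
  have h1 : HasDerivAt (fun r => inner ℝ y (f r - f s)) (inner ℝ y v) s := by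
    simpa using (hasDerivAt_const s y).inner ℝ (hv.sub_const (f s))
  have h2 : HasDerivAt (fun r => inner ℝ y (f r - f s)) 0 s := by
    refine (hasDerivAt_const s (0 : ℝ)).congr_of_eventuallyEq ?_
    filter_upwards [hJ.mem_nhds hs] with r hr
    rw [real_inner_comm]
    exact (Submodule.mem_orthogonal _ _).1 hy _
      (AffineSubspace.vsub_mem_direction (hf r hr) (hf s hs))
  exact h1.unique h2

omit [IsManifold (𝓡 2) ∞ M] in
theorem IsImmersedSurface.mdifferentiableAt {X : M → E3} (hX : IsImmersedSurface X) (p : M) :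
    MDifferentiableAt (𝓡 2) 𝓘(ℝ, E3) X p :=
  hX.1.mdifferentiableAt (by simp)

omit [IsManifold (𝓡 2) ∞ M] in
/-- The chain rule for a map on the surface and a curve in it. -/
theorem dMap_velocity {X : M → E3} {g : ℝ → M} {s : ℝ}
    (hX : MDifferentiableAt (𝓡 2) 𝓘(ℝ, E3) X (g s))
    (hg : MDifferentiableAt 𝓘(ℝ, ℝ) (𝓡 2) g s) {v : E3} (hv : HasDerivAt (X ∘ g) v s) :
    dMap X (g s) (velocity g s) = v := by
  rw [← hv.deriv, ← fderiv_apply_one_eq_deriv, ← mfderiv_eq_fderiv, mfderiv_comp s hX hg]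
  rfl

/-- In a chart, a planar geodesic foliation has a smooth adapted frame field in which the leaves
are geodesics and the conormal direction of the leaves is parallel along them. -/
theorem exists_planarFrame {X : M → E3} (hX : IsImmersedSurface X) {F : Foliation M}
    (hF : F.IsPlanarGeodesic X) (p : M) {A : Fin 3 → E3} (hA : IsAdaptedFrame X F p A) :
    ∃ (O : Set (EuclideanSpace ℝ (Fin 2))) (T B N : EuclideanSpace ℝ (Fin 2) → E3)
      (t b : EuclideanSpace ℝ (Fin 2) → EuclideanSpace ℝ (Fin 2)),
      chartAt (EuclideanSpace ℝ (Fin 2)) p p ∈ O ∧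
      O ⊆ (chartAt (EuclideanSpace ℝ (Fin 2)) p).target ∧
      PlanarFrame O (X ∘ (chartAt (EuclideanSpace ℝ (Fin 2)) p).symm) T B N t b ∧
      (∀ x ∈ O, IsAdaptedFrame X F ((chartAt (EuclideanSpace ℝ (Fin 2)) p).symm x)
        ![T x, B x, N x]) ∧
      T (chartAt (EuclideanSpace ℝ (Fin 2)) p p) = A 0 ∧
      B (chartAt (EuclideanSpace ℝ (Fin 2)) p p) = A 1 ∧
      N (chartAt (EuclideanSpace ℝ (Fin 2)) p p) = A 2 := by
  obtain ⟨O, T, B, N, hO, hpO, hOc, hT, hB, hN, hfr, hp0, hp1, hp2⟩ := exists_frame_field hX F p hA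
  set c := chartAt (EuclideanSpace ℝ (Fin 2)) p with hc
  have hYs : ContDiffOn ℝ ∞ (X ∘ c.symm) O := (contDiffOn_comp_chart_symm hX p).mono hOc
  have hinj : ∀ x ∈ O, Function.Injective (fderiv ℝ (X ∘ c.symm) x) := fun x hx =>
    injective_fderiv_comp_chart_symm hX p (hOc hx)
  have hTr : ∀ x, ∃ w, x ∈ O → fderiv ℝ (X ∘ c.symm) x w = T x := fun x => by
    by_cases hx : x ∈ O
    · obtain ⟨w, hw⟩ := (mem_tangentPlane_chart hX p (hOc hx) _).1 (hfr x hx).leaf_mem_tangentPlane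
      exact ⟨w, fun _ => hw⟩
    · exact ⟨0, fun h => absurd h hx⟩
  have hBr : ∀ x, ∃ w, x ∈ O → fderiv ℝ (X ∘ c.symm) x w = B x := fun x => by
    by_cases hx : x ∈ O
    · obtain ⟨w, hw⟩ := (mem_tangentPlane_chart hX p (hOc hx) _).1 (hfr x hx).mem_tangentPlane
      exact ⟨w, fun _ => hw⟩
    · exact ⟨0, fun h => absurd h hx⟩
  choose t ht using hTr
  choose b hb using hBr
  have hts : ContDiffOn ℝ ∞ t O := contDiffOn_of_fderiv_apply hO hYs hinj hT ht
  have hbs : ContDiffOn ℝ ∞ b O := contDiffOn_of_fderiv_apply hO hYs hinj hB hb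
  have hcs : ContMDiffOn (𝓡 2) (𝓡 2) ∞ c.symm c.target := contMDiffOn_chart_symm
  -- the leaf through a point
  have leaf : ∀ x ∈ O, ∃ (α : ℝ → EuclideanSpace ℝ (Fin 2)) (J : Set ℝ), IsOpen J ∧ (0 : ℝ) ∈ J ∧
      α 0 = x ∧ (∀ s ∈ J, HasDerivAt α (t (α s)) s ∧ α s ∈ O) ∧
      (∀ s ∈ J, HasDerivAt (X ∘ c.symm ∘ α) (T (α s)) s) ∧
      IsUnitSpeedGeodesicOn X (c.symm ∘ α) J ∧
      ∃ P : AffineSubspace ℝ E3, LiesInNormalPlane X (c.symm ∘ α) J P := by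
    intro x hx
    obtain ⟨r, hr, ε, hε, H⟩ := exists_trapped_solutions
      ((hts.contDiffAt (hO.mem_nhds hx)).of_le (by simp)) (hO.mem_nhds hx)
    obtain ⟨α, hα0, hα⟩ := H x (Metric.mem_ball_self hr)
    have hd : ∀ s ∈ Ioo (-ε) ε, HasDerivAt (X ∘ c.symm ∘ α) (T (α s)) s := fun s hs => by
      have h1 := ((hYs.contDiffAt (hO.mem_nhds (hα s hs).2)).differentiableAt
        (by simp)).hasFDerivAt.comp_hasDerivAt s (hα s hs).1
      rwa [ht _ (hα s hs).2] at h1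
    have hαs := contDiffOn_of_hasDerivAt hts isOpen_Ioo hα
    have hγs : ContMDiffOn 𝓘(ℝ, ℝ) (𝓡 2) ∞ (c.symm ∘ α) (Ioo (-ε) ε) :=
      hcs.comp hαs.contMDiffOn fun s hs => hOc (hα s hs).2
    have hL : F.IsLeafOn X (c.symm ∘ α) (Ioo (-ε) ε) := by
      refine ⟨⟨hγs, fun s hs => ?_⟩, fun s hs => ?_⟩
      · rw [(hd s hs).deriv]; exact (hfr _ (hα s hs).2).orthonormal.1 0
      · have hm : MDifferentiableAt 𝓘(ℝ, ℝ) (𝓡 2) (c.symm ∘ α) s :=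
          (hγs.contMDiffAt (isOpen_Ioo.mem_nhds hs)).mdifferentiableAt (by simp)
        have h1 := dMap_velocity (hX.mdifferentiableAt _) hm (hd s hs)
        obtain ⟨v, hv, hvT⟩ := (hfr _ (hα s hs).2).mem_line
        have h2 : velocity (c.symm ∘ α) s = v := hX.2 _ (h1.trans hvT.symm)
        rw [h2]; exact hv
    obtain ⟨h1, h2⟩ := hF (c.symm ∘ α) (Ioo (-ε) ε) isOpen_Ioo ordConnected_Ioo hL
    exact ⟨α, Ioo (-ε) ε, isOpen_Ioo, ⟨neg_lt_zero.2 hε, hε⟩, hα0, hα, hd, h1, h2⟩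
  refine ⟨O, T, B, N, t, b, hpO, hOc, ⟨hO, hYs, hT, hB, hN, hts, hbs, hinj,
    fun x hx => (hfr x hx).orthonormal, ht, hb, fun x hx w => ?_, fun x hx w => ?_,
    fun x hx => ?_⟩, hfr, hp0, hp1, hp2⟩
  · rw [real_inner_comm]
    exact (Submodule.mem_orthogonal _ _).1 (hfr x hx).mem_normalLine _
      ((mem_tangentPlane_chart hX p (hOc hx) _).2 ⟨w, rfl⟩)
  · obtain ⟨α, J, hJ, h0, hα0, hα, hd, hgeo, -⟩ := leaf x hx
    have h1 := hgeo.2 0 h0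
    have h2 : deriv (X ∘ c.symm ∘ α) =ᶠ[𝓝 0] T ∘ α := by
      filter_upwards [hJ.mem_nhds h0] with s hs using (hd s hs).deriv
    have h3 : HasDerivAt (T ∘ α) (fderiv ℝ T x (t x)) 0 := by
      have := ((hT.contDiffAt (hO.mem_nhds (hα 0 h0).2)).differentiableAt
        (by simp)).hasFDerivAt.comp_hasDerivAt 0 (hα 0 h0).1
      rwa [hα0] at this
    have h4 : deriv (deriv (X ∘ c.symm ∘ α)) 0 = fderiv ℝ T x (t x) := by
      rw [h2.deriv_eq, h3.deriv]
    have h5 : fderiv ℝ T x (t x) ∈ normalLine X (c.symm x) := by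
      rw [← h4, ← hα0]; exact h1
    rw [real_inner_comm]
    exact (Submodule.mem_orthogonal _ _).1 h5 _
      ((mem_tangentPlane_chart hX p (hOc hx) _).2 ⟨w, rfl⟩)
  · obtain ⟨α, J, hJ, h0, hα0, hα, hd, -, P, hP2, hP⟩ := leaf x hx
    have hTP : ∀ s ∈ J, T (α s) ∈ P.direction := fun s hs =>
      deriv_mem_direction hJ (fun s hs => (hP s hs).1) hs (hd s hs)
    have hNP : ∀ s ∈ J, N (α s) ∈ P.direction := fun s hs =>
      (hP s hs).2 (hfr _ (hα s hs).2).mem_normalLine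
    -- `P` is spanned by `T` and `N`, hence orthogonal to `B`
    have hBP : ∀ s ∈ J, ∀ y ∈ P.direction, inner ℝ (B (α s)) y = (0 : ℝ) := by
      intro s hs y hy
      have hon := (hfr _ (hα s hs).2).orthonormal
      have hon' : Orthonormal ℝ ![T (α s), N (α s), B (α s)] := by
        convert hon.comp ![(0 : Fin 3), 2, 1] (by decide) using 1
        ext i; fin_cases i <;> rfl
      exact inner_fderiv_eq_zero_of_orthonormal (L := P.direction.subtypeL) hP2 hon'
        ⟨⟨_, hTP s hs⟩, rfl⟩ ⟨⟨_, hNP s hs⟩, rfl⟩ ⟨y, hy⟩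
    have hB' : HasDerivAt (B ∘ α) (fderiv ℝ B x (t x)) 0 := by
      have := ((hB.contDiffAt (hO.mem_nhds (hα 0 h0).2)).differentiableAt
        (by simp)).hasFDerivAt.comp_hasDerivAt 0 (hα 0 h0).1
      rwa [hα0] at this
    have hzero : ∀ y ∈ P.direction, inner ℝ (fderiv ℝ B x (t x)) y = (0 : ℝ) := fun y hy => by
      have e1 : HasDerivAt (fun s => inner ℝ ((B ∘ α) s) y) (inner ℝ (fderiv ℝ B x (t x)) y) 0 := by
        simpa using hB'.inner ℝ (hasDerivAt_const (0 : ℝ) y)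
      refine e1.unique ((hasDerivAt_const (0 : ℝ) (0 : ℝ)).congr_of_eventuallyEq ?_)
      filter_upwards [hJ.mem_nhds h0] with s hs using hBP s hs y hy
    have hon := (hfr x hx).orthonormal
    have e0 := hzero _ (hTP 0 h0)
    have e2 := hzero _ (hNP 0 h0)
    rw [hα0] at e0 e2
    have e1 : inner ℝ (B x) (fderiv ℝ B x (t x)) = (0 : ℝ) := by
      have hBB : ∀ y ∈ O, inner ℝ (B y) (B y) = (1 : ℝ) := fun y hy => by
        have : ‖B y‖ = 1 := (hfr y hy).orthonormal.1 1
        rw [real_inner_self_eq_norm_sq, this, one_pow]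
      have := inner_fderiv_eq_neg hO hB hB hBB hx (t x)
      rw [real_inner_comm] at this
      linarith
    rw [orthonormal_expansion hon (fderiv ℝ B x (t x))]
    rw [real_inner_comm] at e0 e2
    simp [e0, e1, e2]

end AdaptedFrames

/-! ### Boxes and the bundle of adapted frames -/

section Boxes

variable {M : Type*} [TopologicalSpace M] [ChartedSpace (EuclideanSpace ℝ (Fin 2)) M]
  [IsManifold (𝓡 2) ∞ M]

/-- Coordinates on a neighborhood of `p` that take the leaves and their orthogonal trajectories to
the coordinate lines of a square, with a smooth field of adapted frames extending the frame `A` at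
`p`. All fields are functions of the box coordinates; the first coordinate is arc length along the
leaves, and the curvature of the leaves depends on this coordinate only. -/
structure AdaptedBox (X : M → E3) (F : Foliation M) (p : M) (A : Fin 3 → E3) where
  /-- The coordinates; the image is an open square centered at the origin. -/
  chart : OpenPartialHomeomorph M (ℝ × ℝ)
  /-- Half the side of the square. -/
  radius : ℝ
  /-- The frame field: leaf tangent, its orthogonal complement in the tangent plane, normal. -/
  frame : Fin 3 → ℝ × ℝ → E3
  /-- The length of the second coordinate vector. -/
  stretch : ℝ × ℝ → ℝ
  /-- The derivative of the leaf tangent in the second coordinate is this multiple of `frame 1`. -/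
  turnT : ℝ × ℝ → ℝ
  /-- The derivative of the normal in the second coordinate is this multiple of `frame 1`. -/
  turnN : ℝ × ℝ → ℝ
  /-- The curvature of the leaves as a function of the first coordinate. -/
  curv : ℝ → ℝ
  radius_pos : 0 < radius
  mem_source : p ∈ chart.source
  chart_center : chart p = 0
  target_eq : chart.target = Ioo (-radius) radius ×ˢ Ioo (-radius) radius
  smooth_chart : ContMDiffOn (𝓡 2) 𝓘(ℝ, ℝ × ℝ) ∞ chart chart.source
  smooth_symm : ContMDiffOn 𝓘(ℝ, ℝ × ℝ) (𝓡 2) ∞ chart.symm chart.target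
  smooth_frame : ∀ i, ContDiffOn ℝ ∞ (frame i) chart.target
  smooth_stretch : ContDiffOn ℝ ∞ stretch chart.target
  smooth_curv : ContDiffOn ℝ ∞ curv (Ioo (-radius) radius)
  frame_center : ∀ i, frame i 0 = A i
  adapted : ∀ w ∈ chart.target, IsAdaptedFrame X F (chart.symm w) fun i => frame i w
  stretch_pos : ∀ w ∈ chart.target, 0 < stretch w
  hasFDerivAt_X : ∀ w ∈ chart.target,
    HasFDerivAt (X ∘ chart.symm) (ofCols (frame 0 w) (stretch w • frame 1 w)) w
  hasFDerivAt_T : ∀ w ∈ chart.target,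
    HasFDerivAt (frame 0) (ofCols (curv w.1 • frame 2 w) (turnT w • frame 1 w)) w
  hasFDerivAt_N : ∀ w ∈ chart.target,
    HasFDerivAt (frame 2) (ofCols (-curv w.1 • frame 0 w) (turnN w • frame 1 w)) w
  fderiv_B : ∀ w ∈ chart.target, fderiv ℝ (frame 1) w (1, 0) = 0

/-- Every adapted frame is the center of a box. -/
theorem exists_adaptedBox {X : M → E3} (hX : IsImmersedSurface X) {F : Foliation M}
    (hF : F.IsPlanarGeodesic X) {p : M} {A : Fin 3 → E3} (hA : IsAdaptedFrame X F p A) :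
    Nonempty (AdaptedBox X F p A) := by
  obtain ⟨O, T, B, N, t, b, hpO, hOc, hPF, hfr, h0, h1, h2⟩ := exists_planarFrame hX hF p hA
  set c := chartAt (EuclideanSpace ℝ (Fin 2)) p with hc
  obtain ⟨φ, ε, ρ, d, d', k, hε, hφs, hφ0, hφO, hφt, hφ, hφsymm, hρ, hk, H⟩ := hPF.exists_box hpO
  have hmap : MapsTo φ.symm φ.target O := fun w hw => hφO (φ.map_target hw)
  have hsrc : (c.trans φ).source = c.source ∩ c ⁻¹' φ.source := rfl
  have htgt : (c.trans φ).target = φ.target := by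
    rw [OpenPartialHomeomorph.trans_target, inter_eq_left]
    exact fun w hw => hOc (hmap hw)
  have hpc := mem_chart_source (EuclideanSpace ℝ (Fin 2)) p
  have hcs : ContMDiffOn (𝓡 2) (𝓡 2) ∞ c c.source := contMDiffOn_chart
  have hcs' : ContMDiffOn (𝓡 2) (𝓡 2) ∞ c.symm c.target := contMDiffOn_chart_symm
  have hφsymm0 : φ.symm 0 = c p := by rw [← hφ0]; exact φ.left_inv hφs
  refine ⟨{
    chart := c.trans φ
    radius := ε
    frame := ![T ∘ φ.symm, B ∘ φ.symm, N ∘ φ.symm]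
    stretch := ρ
    turnT := d
    turnN := d'
    curv := k
    radius_pos := hε
    mem_source := ⟨hpc, hφs⟩
    chart_center := hφ0
    target_eq := htgt.trans hφt
    smooth_chart := hφ.contMDiffOn.comp (hcs.mono inter_subset_left) fun x hx => hx.2
    smooth_symm := ?_
    smooth_frame := ?_
    smooth_stretch := by rw [htgt]; exact hρ
    smooth_curv := hk
    frame_center := ?_
    adapted := fun w hw => ?_
    stretch_pos := fun w hw => (H w (htgt ▸ hw)).1
    hasFDerivAt_X := fun w hw => (H w (htgt ▸ hw)).2.1
    hasFDerivAt_T := fun w hw => (H w (htgt ▸ hw)).2.2.1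
    hasFDerivAt_N := fun w hw => (H w (htgt ▸ hw)).2.2.2.1
    fderiv_B := fun w hw => (H w (htgt ▸ hw)).2.2.2.2 }⟩
  · rw [htgt]
    exact hcs'.comp hφsymm.contMDiffOn fun w hw => hOc (hmap hw)
  · rw [htgt]
    intro i
    fin_cases i
    exacts [hPF.smooth_T.comp hφsymm hmap, hPF.smooth_B.comp hφsymm hmap,
      hPF.smooth_N.comp hφsymm hmap]
  · intro i
    fin_cases i
    · change T (φ.symm 0) = _; rw [hφsymm0]; exact h0
    · change B (φ.symm 0) = _; rw [hφsymm0]; exact h1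
    · change N (φ.symm 0) = _; rw [hφsymm0]; exact h2
  · rw [htgt] at hw
    have h3 : (fun i => (![T ∘ φ.symm, B ∘ φ.symm, N ∘ φ.symm] : Fin 3 → ℝ × ℝ → E3) i w)
        = ![T (φ.symm w), B (φ.symm w), N (φ.symm w)] := by
      funext i; fin_cases i <;> rfl
    rw [h3]
    exact hfr _ (hmap hw)

namespace AdaptedBox

variable {X : M → E3} {F : Foliation M} {p : M} {A : Fin 3 → E3} (β : AdaptedBox X F p A)

/-- The unit fields along the leaves (`i = 0`) and along their orthogonal trajectories in box
coordinates. -/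
def field (i : Fin 3) (w : ℝ × ℝ) : ℝ × ℝ := if i = 0 then (1, 0) else (0, (β.stretch w)⁻¹)

theorem zero_mem_target : (0 : ℝ × ℝ) ∈ β.chart.target := by
  rw [← β.chart_center]; exact β.chart.map_source β.mem_source

theorem symm_zero : β.chart.symm 0 = p := by
  rw [← β.chart_center]; exact β.chart.left_inv β.mem_source

theorem smooth_field (i : Fin 3) : ContDiffOn ℝ ∞ (β.field i) β.chart.target := by
  unfold field
  by_cases hi : i = 0
  · simpa only [hi, if_true] using contDiffOn_const
  · simp only [hi, if_false]
    exact contDiffOn_const.prodMk (β.smooth_stretch.inv fun w hw => (β.stretch_pos w hw).ne')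

theorem contDiffAt_X (hX : IsImmersedSurface X) {w : ℝ × ℝ} (hw : w ∈ β.chart.target) :
    ContDiffAt ℝ ∞ (X ∘ β.chart.symm) w := by
  have h : ContMDiffOn 𝓘(ℝ, ℝ × ℝ) 𝓘(ℝ, E3) ∞ (X ∘ β.chart.symm) β.chart.target :=
    hX.1.comp_contMDiffOn β.smooth_symm
  exact h.contDiffOn.contDiffAt (β.chart.open_target.mem_nhds hw)

theorem fderiv_X {w : ℝ × ℝ} (hw : w ∈ β.chart.target) (v : ℝ × ℝ) :
    fderiv ℝ (X ∘ β.chart.symm) w v = v.1 • β.frame 0 w + (v.2 * β.stretch w) • β.frame 1 w := by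
  rw [(β.hasFDerivAt_X w hw).fderiv, ofCols_apply, smul_smul]

theorem inner_frame {w : ℝ × ℝ} (hw : w ∈ β.chart.target) (i j : Fin 3) :
    inner ℝ (β.frame i w) (β.frame j w) = if i = j then (1 : ℝ) else 0 :=
  orthonormal_iff_ite.1 (β.adapted w hw).orthonormal i j

theorem injective_fderiv_X {w : ℝ × ℝ} (hw : w ∈ β.chart.target) :
    Function.Injective (fderiv ℝ (X ∘ β.chart.symm) w) := by
  rw [injective_iff_map_eq_zero]
  intro v hv
  rw [β.fderiv_X hw] at hv
  have h0 := congrArg (inner ℝ (β.frame 0 w)) hv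
  have h1 := congrArg (inner ℝ (β.frame 1 w)) hv
  rw [inner_add_right, inner_smul_right, inner_smul_right, β.inner_frame hw, β.inner_frame hw,
    inner_zero_right] at h0 h1
  simp at h0 h1
  exact Prod.ext h0 (h1.resolve_right (β.stretch_pos w hw).ne')

theorem fderiv_X_field {w : ℝ × ℝ} (hw : w ∈ β.chart.target) {i : Fin 3} (hi : i ≠ 2) :
    fderiv ℝ (X ∘ β.chart.symm) w (β.field i w) = β.frame i w := by
  rw [β.fderiv_X hw]
  have := (β.stretch_pos w hw).ne'
  fin_cases i
  · simp [field]
  · simp [field, this]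
  · exact absurd rfl hi

theorem comp_chart_eventuallyEq {S : Type*} [TopologicalSpace S] {g : S → M} {s : S}
    (hg : ContinuousAt g s) (hs : g s ∈ β.chart.source) :
    (X ∘ β.chart.symm) ∘ (β.chart ∘ g) =ᶠ[𝓝 s] X ∘ g := by
  filter_upwards [hg.eventually_mem (β.chart.open_source.mem_nhds hs)] with r hr
  simp [β.chart.left_inv hr]

theorem continuousAt_chart_comp {S : Type*} [TopologicalSpace S] {g : S → M} {s : S}
    (hg : ContinuousAt g s) (hs : g s ∈ β.chart.source) : ContinuousAt (β.chart ∘ g) s :=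
  ContinuousAt.comp (β.chart.continuousAt hs) hg

/-- The box coordinates of a curve are differentiable if its image in `ℝ³` is: `X` being an
immersion, continuity of the curve in the surface suffices. -/
theorem hasDerivAt_chart_comp (hX : IsImmersedSurface X) {g : ℝ → M} {s : ℝ}
    (hg : ContinuousAt g s) (hs : g s ∈ β.chart.source) {i : Fin 3} (hi : i ≠ 2) {l : ℝ}
    (h : HasDerivAt (X ∘ g) (l • β.frame i (β.chart (g s))) s) :
    HasDerivAt (β.chart ∘ g) (l • β.field i (β.chart (g s))) s := by
  refine hasDerivAt_of_immersion_comp (Y := X ∘ β.chart.symm) (w := β.chart ∘ g)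
    (β.contDiffAt_X hX (β.chart.map_source hs))
    (β.injective_fderiv_X (β.chart.map_source hs)) (β.continuousAt_chart_comp hg hs) ?_
  refine HasDerivAt.congr_of_eventuallyEq ?_ (β.comp_chart_eventuallyEq hg hs)
  rw [Function.comp_apply, map_smul, β.fderiv_X_field (β.chart.map_source hs) hi]
  exact h

theorem contDiffAt_chart_comp (hX : IsImmersedSurface X) {S : Type*} [NormedAddCommGroup S]
    [NormedSpace ℝ S] {g : S → M} {s : S} (hg : ContinuousAt g s) (hs : g s ∈ β.chart.source)
    (h : ContDiffAt ℝ ∞ (X ∘ g) s) : ContDiffAt ℝ ∞ (β.chart ∘ g) s :=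
  contDiffAt_of_immersion_comp (Y := X ∘ β.chart.symm) (w := β.chart ∘ g)
    (β.contDiffAt_X hX (β.chart.map_source hs))
    (β.injective_fderiv_X (β.chart.map_source hs)) (β.continuousAt_chart_comp hg hs)
    (h.congr_of_eventuallyEq (β.comp_chart_eventuallyEq hg hs))

end AdaptedBox

/-- The bundle of adapted frames, topologized as a subspace of `M × (ℝ³)³`. -/
abbrev FrameBundle (X : M → E3) (F : Foliation M) : Type _ :=
  {z : M × (Fin 3 → E3) // IsAdaptedFrame X F z.1 z.2}

namespace FrameBundle

variable {X : M → E3} {F : Foliation M}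

/-- The base point of a frame. -/
abbrev pt (z : FrameBundle X F) : M := z.1.1
/-- The vectors of a frame. -/
abbrev fr (z : FrameBundle X F) : Fin 3 → E3 := z.1.2

theorem continuous_pt : Continuous (pt : FrameBundle X F → M) :=
  continuous_fst.comp continuous_subtype_val

theorem continuous_fr (i : Fin 3) : Continuous fun z : FrameBundle X F => z.fr i :=
  (continuous_apply i).comp (continuous_snd.comp continuous_subtype_val)

theorem ext' {z z' : FrameBundle X F} (h : z.pt = z'.pt) (h' : ∀ i, z.fr i = z'.fr i) : z = z' :=
  Subtype.ext (Prod.ext h (funext h'))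

theorem norm_fr (z : FrameBundle X F) (i : Fin 3) : ‖z.fr i‖ = 1 := z.2.orthonormal.1 i

/-- Changing the signs of a frame. -/
def flip {σ : Fin 3 → ℝ} (hσ : IsSign σ) (z : FrameBundle X F) : FrameBundle X F :=
  ⟨(z.pt, signFlip σ z.fr), z.2.flip_signs hσ⟩

@[simp] theorem flip_fr {σ : Fin 3 → ℝ} (hσ : IsSign σ) (z : FrameBundle X F) (i : Fin 3) :
    (flip hσ z).fr i = σ i • z.fr i := rfl

theorem flip_flip {σ : Fin 3 → ℝ} (hσ : IsSign σ) (z : FrameBundle X F) :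
    flip hσ (flip hσ z) = z :=
  ext' rfl fun i => by simp only [flip_fr, smul_smul, hσ.mul_self, one_smul]

theorem continuous_flip {σ : Fin 3 → ℝ} (hσ : IsSign σ) :
    Continuous (flip hσ : FrameBundle X F → FrameBundle X F) :=
  Continuous.subtype_mk (continuous_pt.prodMk (continuous_pi fun i =>
    (continuous_fr i).const_smul (σ i))) _

theorem exists_flip_eq {z z' : FrameBundle X F} (h : z.pt = z'.pt) :
    ∃ (σ : Fin 3 → ℝ) (hσ : IsSign σ), z' = flip hσ z := by
  obtain ⟨⟨p, A⟩, hz⟩ := z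
  obtain ⟨⟨p', A'⟩, hz'⟩ := z'
  change p = p' at h
  subst h
  obtain ⟨σ, hσ, hA⟩ := hz.eq_flip hz'
  exact ⟨σ, hσ, Subtype.ext (Prod.ext rfl hA)⟩

end FrameBundle

namespace AdaptedBox

variable {X : M → E3} {F : Foliation M} {z : FrameBundle X F} (β : AdaptedBox X F z.pt z.fr)

open Classical in
/-- The frame field of a box as a map into the bundle of frames. Outside the square the value is
arbitrary. -/
def lift (w : ℝ × ℝ) : FrameBundle X F :=
  if hw : w ∈ β.chart.target then ⟨(β.chart.symm w, fun i => β.frame i w), β.adapted w hw⟩ else z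

theorem lift_pt {w : ℝ × ℝ} (hw : w ∈ β.chart.target) : (β.lift w).pt = β.chart.symm w := by
  simp [lift, hw]

theorem lift_fr {w : ℝ × ℝ} (hw : w ∈ β.chart.target) (i : Fin 3) :
    (β.lift w).fr i = β.frame i w := by
  simp [lift, hw]

theorem lift_zero : β.lift 0 = z :=
  FrameBundle.ext' (by rw [β.lift_pt β.zero_mem_target, β.symm_zero])
    fun i => by rw [β.lift_fr β.zero_mem_target, β.frame_center]

theorem continuousOn_lift : ContinuousOn β.lift β.chart.target := by
  refine IsInducing.subtypeVal.continuousOn_iff.2 ?_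
  have : ContinuousOn (fun w => (β.chart.symm w, fun i => β.frame i w)) β.chart.target :=
    β.chart.continuousOn_symm.prodMk (continuousOn_pi.2 fun i => (β.smooth_frame i).continuousOn)
  exact this.congr fun w hw => by simp [lift, hw]

/-- The part of the bundle of frames described by a box: the frames over the domain of the
coordinates that have the same signs as the frame field of the box. -/
def nhd : Set (FrameBundle X F) :=
  {y | y.pt ∈ β.chart.source ∧ β.lift (β.chart y.pt) = y}

theorem mem_nhd_self : z ∈ β.nhd := ⟨β.mem_source, by rw [β.chart_center, β.lift_zero]⟩

theorem lift_mem_nhd {w : ℝ × ℝ} (hw : w ∈ β.chart.target) : β.lift w ∈ β.nhd := by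
  constructor
  · rw [β.lift_pt hw]; exact β.chart.map_target hw
  · rw [β.lift_pt hw, β.chart.right_inv hw]

theorem mem_target {y : FrameBundle X F} (hy : y ∈ β.nhd) : β.chart y.pt ∈ β.chart.target :=
  β.chart.map_source hy.1

theorem fr_eq {y : FrameBundle X F} (hy : y ∈ β.nhd) (i : Fin 3) :
    y.fr i = β.frame i (β.chart y.pt) := by
  rw [← β.lift_fr (β.mem_target hy), hy.2]

theorem isOpen_nhd : IsOpen β.nhd := by
  -- A frame over the box is determined up to signs, so it suffices to fix these.
  have hset : β.nhd = (FrameBundle.pt ⁻¹' β.chart.source) ∩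
      {y | ∀ i, 0 < inner ℝ (y.fr i) (β.frame i (β.chart y.pt))} := by
    ext y
    constructor
    · intro hy
      refine ⟨hy.1, fun i => ?_⟩
      rw [← β.fr_eq hy, real_inner_self_eq_norm_sq, y.norm_fr]; norm_num
    · rintro ⟨hy, hy'⟩
      have ht := β.chart.map_source hy
      refine ⟨hy, ?_⟩
      obtain ⟨σ, hσ, h⟩ := FrameBundle.exists_flip_eq (z := β.lift (β.chart y.pt)) (z' := y)
        (by rw [β.lift_pt ht, β.chart.left_inv hy])
      refine FrameBundle.ext' (by rw [β.lift_pt ht, β.chart.left_inv hy]) fun i => ?_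
      have hfr : y.fr i = σ i • (β.lift (β.chart y.pt)).fr i := congrArg (fun z => z.fr i) h
      have := hy' i
      rw [hfr, ← β.lift_fr ht, inner_smul_left, real_inner_self_eq_norm_sq,
        FrameBundle.norm_fr] at this
      rcases hσ i with h1 | h1
      · rw [hfr, h1, one_smul]
      · rw [h1] at this; norm_num at this
  rw [hset]
  have hc : ContinuousOn (fun y : FrameBundle X F => fun i =>
      inner ℝ (y.fr i) (β.frame i (β.chart y.pt))) (FrameBundle.pt ⁻¹' β.chart.source) :=
    continuousOn_pi.2 fun i => (FrameBundle.continuous_fr i).continuousOn.inner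
      ((β.smooth_frame i).continuousOn.comp
        (β.chart.continuousOn.comp FrameBundle.continuous_pt.continuousOn fun y hy => hy)
        fun y hy => β.chart.map_source hy)
  have ho : IsOpen {x : Fin 3 → ℝ | ∀ i, 0 < x i} := by
    simp only [ofPred_forall]
    exact isOpen_iInter_of_finite fun i => isOpen_lt continuous_const (continuous_apply i)
  exact hc.isOpen_inter_preimage (β.chart.open_source.preimage FrameBundle.continuous_pt) ho

theorem nhd_mem_nhds {y : FrameBundle X F} (hy : y ∈ β.nhd) : β.nhd ∈ 𝓝 y :=
  β.isOpen_nhd.mem_nhds hy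

theorem continuousOn_chart_pt : ContinuousOn (fun y : FrameBundle X F => β.chart y.pt) β.nhd :=
  β.chart.continuousOn.comp FrameBundle.continuous_pt.continuousOn fun _ hy => hy.1

end AdaptedBox

/-! ### Curves along the frame vectors -/

/-- At the parameter `s`, the curve `γ` of frames moves with velocity `l s` times the `i`-th vector
of the frame. Only the image in `ℝ³` of the base point is differentiated; together with continuity
in the bundle of frames this determines the motion of the whole frame. -/
def FlowsAlong {X : M → E3} {F : Foliation M} (i : Fin 3) (l : ℝ → ℝ) (γ : ℝ → FrameBundle X F)
    (s : ℝ) : Prop :=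
  ContinuousAt γ s ∧ HasDerivAt (fun r => X (γ r).pt) (l s • (γ s).fr i) s

namespace FlowsAlong

variable {X : M → E3} {F : Foliation M} {i : Fin 3} {l : ℝ → ℝ} {γ γ' : ℝ → FrameBundle X F}
  {s : ℝ}

theorem congr (h : FlowsAlong i l γ s) (h' : γ' =ᶠ[𝓝 s] γ) : FlowsAlong i l γ' s := by
  refine ⟨h.1.congr h'.symm, ?_⟩
  rw [h'.self_of_nhds]
  exact h.2.congr_of_eventuallyEq
    (h'.mono fun r hr => congrArg (fun y : FrameBundle X F => X y.pt) hr)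

theorem comp_add (a : ℝ) (h : FlowsAlong i l γ (s + a)) :
    FlowsAlong i (fun r => l (r + a)) (fun r => γ (r + a)) s :=
  ⟨ContinuousAt.comp (f := fun r : ℝ => r + a) h.1 (by fun_prop), h.2.comp_add_const s a⟩

theorem hasDerivAt_chart (hX : IsImmersedSurface X) (h : FlowsAlong i l γ s) (hi : i ≠ 2)
    {z : FrameBundle X F} (β : AdaptedBox X F z.pt z.fr) (hγ : γ s ∈ β.nhd) :
    HasDerivAt (fun r => β.chart (γ r).pt) (l s • β.field i (β.chart (γ s).pt)) s := by
  refine β.hasDerivAt_chart_comp hX (g := fun r => (γ r).pt)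
    (FrameBundle.continuous_pt.continuousAt.comp h.1) hγ.1 hi ?_
  have := h.2
  rw [β.fr_eq hγ] at this
  exact this

end FlowsAlong

/-- Solutions of the differential equation in box coordinates lift to the bundle of frames. -/
theorem flowsAlong_lift {X : M → E3} {F : Foliation M} {z : FrameBundle X F}
    (β : AdaptedBox X F z.pt z.fr) {i : Fin 3} (hi : i ≠ 2) {l : ℝ → ℝ} {α : ℝ → ℝ × ℝ} {s : ℝ}
    (hα : HasDerivAt α (l s • β.field i (α s)) s) (hs : α s ∈ β.chart.target) :
    FlowsAlong i l (fun r => β.lift (α r)) s := by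
  refine ⟨ContinuousAt.comp (f := α) (β.continuousOn_lift.continuousAt
    (β.chart.open_target.mem_nhds hs)) hα.continuousAt, ?_⟩
  have h1 := (β.hasFDerivAt_X _ hs).comp_hasDerivAt s hα
  rw [← (β.hasFDerivAt_X _ hs).fderiv, map_smul, β.fderiv_X_field hs hi] at h1
  rw [β.lift_fr hs]
  refine h1.congr_of_eventuallyEq ?_
  filter_upwards [hα.continuousAt.eventually_mem (β.chart.open_target.mem_nhds hs)] with r hr
  rw [β.lift_pt hr]; rfl

variable {X : M → E3} {F : Foliation M}

theorem exists_box_at (hX : IsImmersedSurface X) (hF : F.IsPlanarGeodesic X)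
    (z : FrameBundle X F) : Nonempty (AdaptedBox X F z.pt z.fr) :=
  exists_adaptedBox hX hF z.2

/-- Local uniqueness of curves along frame vectors. -/
theorem FlowsAlong.eventuallyEq (hX : IsImmersedSurface X) (hF : F.IsPlanarGeodesic X) {i : Fin 3}
    (hi : i ≠ 2) {l : ℝ → ℝ} {γ γ' : ℝ → FrameBundle X F} {s₀ : ℝ} (hl : ContinuousAt l s₀)
    (h : ∀ᶠ s in 𝓝 s₀, FlowsAlong i l γ s) (h' : ∀ᶠ s in 𝓝 s₀, FlowsAlong i l γ' s)
    (h0 : γ s₀ = γ' s₀) : γ =ᶠ[𝓝 s₀] γ' := by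
  obtain ⟨β⟩ := exists_box_at hX hF (γ s₀)
  have hn : ∀ᶠ s in 𝓝 s₀, γ s ∈ β.nhd :=
    h.self_of_nhds.1.eventually_mem (β.nhd_mem_nhds β.mem_nhd_self)
  have hn' : ∀ᶠ s in 𝓝 s₀, γ' s ∈ β.nhd :=
    h'.self_of_nhds.1.eventually_mem (β.nhd_mem_nhds (h0 ▸ β.mem_nhd_self))
  obtain ⟨K, O, hO, hK⟩ := (((β.smooth_field i).contDiffAt
    (β.chart.open_target.mem_nhds β.zero_mem_target)).of_le (by simp)).exists_lipschitzOnWith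
  have hO' : O ∈ 𝓝 (β.chart (γ s₀).pt) := by rw [β.chart_center]; exact hO
  have hc : ContinuousAt (fun y : FrameBundle X F => β.chart y.pt) (γ s₀) :=
    β.continuousOn_chart_pt.continuousAt (β.nhd_mem_nhds β.mem_nhd_self)
  have hm : ∀ᶠ s in 𝓝 s₀, β.chart (γ s).pt ∈ O :=
    (ContinuousAt.comp (f := γ) hc h.self_of_nhds.1).eventually_mem hO'
  have hm' : ∀ᶠ s in 𝓝 s₀, β.chart (γ' s).pt ∈ O :=
    (ContinuousAt.comp (f := γ') (by rw [← h0]; exact hc) h'.self_of_nhds.1).eventually_mem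
      (by rw [Function.comp_apply, ← h0]; exact hO')
  have hlip : ∀ᶠ s in 𝓝 s₀, LipschitzOnWith (Real.toNNReal (|l s₀| + 1) * K)
      (fun w => l s • β.field i w) O := by
    filter_upwards [hl.abs.eventually_lt_const (lt_add_one |l s₀|)] with s hs
    refine LipschitzOnWith.of_dist_le_mul fun x hx y hy => ?_
    rw [dist_smul₀, Real.norm_eq_abs, NNReal.coe_mul, Real.coe_toNNReal _ (by positivity),
      mul_assoc]
    exact mul_le_mul hs.le (hK.dist_le_mul x hx y hy) dist_nonneg (by positivity)
  have key := ODE_solution_unique_of_eventually (s := fun _ => O)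
    (f := fun s => β.chart (γ s).pt) (g := fun s => β.chart (γ' s).pt) hlip
    (by filter_upwards [h, hn, hm] with s h1 h2 h3 using ⟨h1.hasDerivAt_chart hX hi β h2, h3⟩)
    (by filter_upwards [h', hn', hm'] with s h1 h2 h3 using ⟨h1.hasDerivAt_chart hX hi β h2, h3⟩)
    (congrArg (fun y : FrameBundle X F => β.chart y.pt) h0)
  filter_upwards [key, hn, hn'] with s h1 h2 h3
  rw [← h2.2, ← h3.2, h1]

/-- Uniqueness of curves along frame vectors on intervals. -/
theorem FlowsAlong.eqOn [T2Space M] (hX : IsImmersedSurface X) (hF : F.IsPlanarGeodesic X)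
    {i : Fin 3} (hi : i ≠ 2) {l : ℝ → ℝ} (hl : Continuous l) {γ γ' : ℝ → FrameBundle X F}
    {I : Set ℝ} (hIo : IsOpen I) (hI : IsPreconnected I) (h : ∀ s ∈ I, FlowsAlong i l γ s)
    (h' : ∀ s ∈ I, FlowsAlong i l γ' s) {s₀ : ℝ} (hs₀ : s₀ ∈ I) (h0 : γ s₀ = γ' s₀) :
    EqOn γ γ' I := by
  have key : ∀ s ∈ I, γ s = γ' s → γ =ᶠ[𝓝 s] γ' := fun s hs hss =>
    FlowsAlong.eventuallyEq hX hF hi hl.continuousAt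
      (by filter_upwards [hIo.mem_nhds hs] with r hr using h r hr)
      (by filter_upwards [hIo.mem_nhds hs] with r hr using h' r hr) hss
  have hsub : I ⊆ {s | γ =ᶠ[𝓝 s] γ'} := by
    refine hI.subset_of_closure_inter_subset isOpen_setOfPred_eventually_nhds
      ⟨s₀, hs₀, key s₀ hs₀ h0⟩ ?_
    rintro s ⟨hsc, hs⟩
    refine key s hs (tendsto_nhds_unique_of_frequently_eq (h s hs).1 (h' s hs).1 ?_)
    exact (mem_closure_iff_frequently.1 hsc).mono fun r (hr : γ =ᶠ[𝓝 r] γ') => hr.eq_of_nhds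
  exact fun s hs => Filter.EventuallyEq.eq_of_nhds (hsub hs)

/-- Curves along frame vectors exist locally, for a uniform time near each frame. -/
theorem exists_flowsAlong_uniform (hX : IsImmersedSurface X) (hF : F.IsPlanarGeodesic X) {i : Fin 3}
    (hi : i ≠ 2) (z : FrameBundle X F) :
    ∃ V ∈ 𝓝 z, ∃ ε > (0 : ℝ), ∀ z' ∈ V, ∃ γ : ℝ → FrameBundle X F, γ 0 = z' ∧
      ∀ s ∈ Ioo (-ε) ε, FlowsAlong i (fun _ => 1) γ s := by
  obtain ⟨β⟩ := exists_box_at hX hF z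
  have ht := β.chart.open_target.mem_nhds β.zero_mem_target
  obtain ⟨r, hr, ε, hε, H⟩ := exists_trapped_solutions
    (((β.smooth_field i).contDiffAt ht).of_le (by simp)) ht
  have hc : ContinuousAt (fun y : FrameBundle X F => β.chart y.pt) z :=
    β.continuousOn_chart_pt.continuousAt (β.nhd_mem_nhds β.mem_nhd_self)
  refine ⟨β.nhd ∩ (fun y => β.chart y.pt) ⁻¹' Metric.ball 0 r,
    inter_mem (β.nhd_mem_nhds β.mem_nhd_self) (hc.preimage_mem_nhds
      (by rw [β.chart_center]; exact Metric.ball_mem_nhds _ hr)), ε, hε, fun z' hz' => ?_⟩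
  obtain ⟨α, hα0, hα⟩ := H _ hz'.2
  refine ⟨fun s => β.lift (α s), by simp only [hα0]; exact hz'.1.2, fun s hs => ?_⟩
  exact flowsAlong_lift β hi (by simpa using (hα s hs).1) (hα s hs).2

/-- Curves along frame vectors are smooth. -/
theorem FlowsAlong.smooth (hX : IsImmersedSurface X) (hF : F.IsPlanarGeodesic X) {i : Fin 3}
    (hi : i ≠ 2) {γ : ℝ → FrameBundle X F} {s₀ : ℝ}
    (h : ∀ᶠ s in 𝓝 s₀, FlowsAlong i (fun _ => 1) γ s) :
    ContMDiffAt 𝓘(ℝ, ℝ) (𝓡 2) ∞ (fun s => (γ s).pt) s₀ ∧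
      ∀ j, ContDiffAt ℝ ∞ (fun s => (γ s).fr j) s₀ := by
  obtain ⟨β⟩ := exists_box_at hX hF (γ s₀)
  have hn : ∀ᶠ s in 𝓝 s₀, γ s ∈ β.nhd :=
    h.self_of_nhds.1.eventually_mem (β.nhd_mem_nhds β.mem_nhd_self)
  obtain ⟨I, hI, hIo, hs₀⟩ := eventually_nhds_iff.1 (h.and hn)
  have hcs : ContDiffAt ℝ ∞ (fun s => β.chart (γ s).pt) s₀ :=
    (contDiffOn_of_hasDerivAt (β.smooth_field i) hIo fun s hs =>
      ⟨by simpa using (hI s hs).1.hasDerivAt_chart hX hi β (hI s hs).2,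
        β.mem_target (hI s hs).2⟩).contDiffAt (hIo.mem_nhds hs₀)
  have ht := β.chart.open_target.mem_nhds (β.mem_target (hI s₀ hs₀).2)
  refine ⟨?_, fun j => ?_⟩
  · have := ((β.smooth_symm).contMDiffAt ht).comp s₀ hcs.contMDiffAt
    refine this.congr_of_eventuallyEq ?_
    filter_upwards [hn] with s hs
    exact (β.chart.left_inv hs.1).symm
  · have := ((β.smooth_frame j).contDiffAt ht).comp s₀ hcs
    refine this.congr_of_eventuallyEq ?_
    filter_upwards [hn] with s hs using β.fr_eq hs j

end Boxes

/-! ### Completeness: curves along frame vectors are defined for all times -/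

section Completeness

variable {M : Type*} [TopologicalSpace M] [ChartedSpace (EuclideanSpace ℝ (Fin 2)) M]
  [IsManifold (𝓡 2) ∞ M] {X : M → E3} {F : Foliation M}

omit [IsManifold (𝓡 2) ∞ M] in
theorem inducedEDist_comm (X : M → E3) (p q : M) : inducedEDist X p q = inducedEDist X q p := by
  let inst : ∀ p : M, ENorm (TangentSpace (𝓡 2) p) := fun p => ⟨fun v => ‖dMap X p v‖ₑ⟩
  have : ∀ x : M, ENormSMulClass ℝ (TangentSpace (𝓡 2) x) := fun x => ⟨fun r v => by
    change ‖dMap X x (r • v)‖ₑ = ‖r‖ₑ * ‖dMap X x v‖ₑ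
    rw [map_smul, enorm_smul]⟩
  exact riemannianEDist_comm

/-- Curves along frame vectors have unit speed, so their duration bounds the distance covered. -/
theorem inducedEDist_le (hX : IsImmersedSurface X) (hF : F.IsPlanarGeodesic X) {i : Fin 3}
    (hi : i ≠ 2) {γ : ℝ → FrameBundle X F} {I : Set ℝ} (hIo : IsOpen I)
    (h : ∀ s ∈ I, FlowsAlong i (fun _ => 1) γ s) {a b : ℝ} (hab : a ≤ b) (hI : Icc a b ⊆ I) :
    inducedEDist X (γ a).pt (γ b).pt ≤ ENNReal.ofReal (b - a) := by
  have hsm : ∀ s ∈ I, ContMDiffAt 𝓘(ℝ, ℝ) (𝓡 2) ∞ (fun s => (γ s).pt) s := fun s hs =>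
    (FlowsAlong.smooth hX hF hi (by filter_upwards [hIo.mem_nhds hs] with r hr using h r hr)).1
  let inst : ∀ p : M, ENorm (TangentSpace (𝓡 2) p) := fun p => ⟨fun v => ‖dMap X p v‖ₑ⟩
  have : ∀ x : M, ENormSMulClass ℝ (TangentSpace (𝓡 2) x) := fun x => ⟨fun r v => by
    change ‖dMap X x (r • v)‖ₑ = ‖r‖ₑ * ‖dMap X x v‖ₑ
    rw [map_smul, enorm_smul]⟩
  have h1 : riemannianEDist (𝓡 2) (γ a).pt (γ b).pt
      ≤ pathELength (𝓡 2) (fun s => (γ s).pt) a b :=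
    riemannianEDist_le_pathELength
      (fun s hs => ((hsm s (hI hs)).of_le (by simp)).contMDiffWithinAt) rfl rfl hab
  refine h1.trans ?_
  rw [pathELength_eq_lintegral_mfderiv_Icc]
  have h2 : ∀ s ∈ Icc a b,
      ‖mfderiv 𝓘(ℝ, ℝ) (𝓡 2) (fun s => (γ s).pt) s (1 : ℝ)‖ₑ = 1 := fun s hs => by
    have h3 := dMap_velocity (hX.mdifferentiableAt _)
      ((hsm s (hI hs)).mdifferentiableAt (by simp)) (h s (hI hs)).2
    change ‖dMap X (γ s).pt (velocity (fun s => (γ s).pt) s)‖ₑ = 1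
    rw [h3, one_smul, ← ofReal_norm, FrameBundle.norm_fr, ENNReal.ofReal_one]
  refine (MeasureTheory.setLIntegral_congr_fun (μ := MeasureTheory.volume)
    measurableSet_Icc h2).le.trans ?_
  simp

/-- Limits of adapted frames are adapted frames. -/
theorem isAdaptedFrame_of_tendsto (hX : IsImmersedSurface X) (hF : F.IsPlanarGeodesic X)
    {p : ℕ → M} {A : ℕ → Fin 3 → E3} (hA : ∀ n, IsAdaptedFrame X F (p n) (A n)) {p₀ : M}
    {A₀ : Fin 3 → E3} (hp : Tendsto p atTop (𝓝 p₀)) (hA₀ : Tendsto A atTop (𝓝 A₀)) :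
    IsAdaptedFrame X F p₀ A₀ := by
  obtain ⟨A₁, hA₁⟩ := exists_isAdaptedFrame hX F p₀
  obtain ⟨β⟩ := exists_adaptedBox hX hF hA₁
  have hev : ∀ᶠ n in atTop, p n ∈ β.chart.source :=
    hp.eventually_mem (β.chart.open_source.mem_nhds β.mem_source)
  have hfr : ∀ i, Tendsto (fun n => β.frame i (β.chart (p n))) atTop (𝓝 (A₁ i)) := fun i => by
    rw [← β.frame_center i, ← β.chart_center]
    have hc : ContinuousAt (β.frame i) (β.chart p₀) :=
      (β.smooth_frame i).continuousOn.continuousAt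
        (β.chart.open_target.mem_nhds (β.chart.map_source β.mem_source))
    exact hc.tendsto.comp ((β.chart.continuousAt β.mem_source).tendsto.comp hp)
  have hAi : ∀ i, Tendsto (fun n => A n i) atTop (𝓝 (A₀ i)) := fun i =>
    ((continuous_apply i).tendsto A₀).comp hA₀
  let σ : Fin 3 → ℝ := fun i => inner ℝ (A₁ i) (A₀ i)
  have hσt : ∀ i, Tendsto (fun n => inner ℝ (β.frame i (β.chart (p n))) (A n i)) atTop (𝓝 (σ i)) :=
    fun i => (hfr i).inner (hAi i)
  have hrel : ∀ᶠ n in atTop, ∀ i,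
      (inner ℝ (β.frame i (β.chart (p n))) (A n i) = (1 : ℝ) ∨
        inner ℝ (β.frame i (β.chart (p n))) (A n i) = (-1 : ℝ)) ∧
      A n i = (inner ℝ (β.frame i (β.chart (p n))) (A n i) : ℝ) • β.frame i (β.chart (p n)) := by
    filter_upwards [hev] with n hn i
    have had := β.adapted _ (β.chart.map_source hn)
    rw [β.chart.left_inv hn] at had
    obtain ⟨τ, hτ, hAτ⟩ := had.eq_flip (hA n)
    have e : A n i = τ i • β.frame i (β.chart (p n)) := by rw [hAτ]; rfl
    have e' : inner ℝ (β.frame i (β.chart (p n))) (A n i) = τ i := by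
      rw [e, inner_smul_right, real_inner_self_eq_norm_sq,
        show ‖β.frame i (β.chart (p n))‖ = 1 from had.orthonormal.1 i]
      ring
    rw [e']
    exact ⟨hτ i, e⟩
  have hσ : IsSign σ := fun i => by
    have : σ i ∈ ({1, -1} : Set ℝ) := (Set.toFinite _).isClosed.mem_of_tendsto (hσt i)
      (hrel.mono fun n hn => by simpa using (hn i).1)
    simpa using this
  have hA₀' : A₀ = signFlip σ A₁ := funext fun i =>
    tendsto_nhds_unique (hAi i) (((hσt i).smul (hfr i)).congr'
      (hrel.mono fun n hn => (hn i).2.symm))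
  rw [hA₀']
  exact hA₁.flip_signs hσ

/-- On a complete surface, a curve along frame vectors accumulates at a frame when time tends to a
finite value. -/
theorem exists_limit_frame (hX : IsImmersedSurface X) (hF : F.IsPlanarGeodesic X)
    (hC : IsCompleteSurface X) {i : Fin 3} (hi : i ≠ 2) {γ : ℝ → FrameBundle X F} {a b : ℝ}
    (hab : a < b) (h : ∀ s ∈ Ioo a b, FlowsAlong i (fun _ => 1) γ s) :
    ∃ (z : FrameBundle X F) (t : ℕ → ℝ), (∀ n, t n ∈ Ioo a b) ∧ Tendsto t atTop (𝓝 b) ∧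
      Tendsto (fun n => γ (t n)) atTop (𝓝 z) := by
  obtain ⟨t, -, htm, htt⟩ := exists_seq_strictMono_tendsto' hab
  have hd : ∀ s ∈ Ioo a b, ∀ s' ∈ Ioo a b,
      inducedEDist X (γ s).pt (γ s').pt ≤ ENNReal.ofReal |s - s'| := by
    intro s hs s' hs'
    rcases le_total s s' with hss | hss
    · rw [abs_sub_comm, abs_of_nonneg (by linarith)]
      exact inducedEDist_le hX hF hi isOpen_Ioo h hss (Icc_subset_Ioo hs.1 hs'.2)
    · rw [abs_of_nonneg (by linarith)]
      rw [inducedEDist_comm]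
      exact inducedEDist_le hX hF hi isOpen_Ioo h hss (Icc_subset_Ioo hs'.1 hs.2)
  obtain ⟨p, hp⟩ := hC (fun n => (γ (t n)).pt) fun ε hε => by
    obtain ⟨δ, hδ, hδε⟩ : ∃ δ : ℝ, 0 < δ ∧ ENNReal.ofReal δ < ε := by
      obtain ⟨r, hr, hrε⟩ := ENNReal.lt_iff_exists_nnreal_btwn.1 hε
      exact ⟨r, by simpa using hr, by simpa using hrε⟩
    obtain ⟨n₀, hn₀⟩ := Metric.cauchySeq_iff.1 htt.cauchySeq δ hδ
    refine ⟨n₀, fun m hm n hn => (hd _ (htm m) _ (htm n)).trans_lt ?_⟩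
    refine lt_of_le_of_lt (ENNReal.ofReal_le_ofReal ?_) hδε
    have := hn₀ m hm n hn
    rw [Real.dist_eq] at this
    exact this.le
  have hbd : ∀ n, (γ (t n)).fr ∈ Metric.closedBall (0 : Fin 3 → E3) 1 := fun n => by
    rw [mem_closedBall_zero_iff, pi_norm_le_iff_of_nonneg zero_le_one]
    exact fun j => ((γ (t n)).norm_fr j).le
  obtain ⟨A, -, φ, hφ, hA⟩ := (isCompact_closedBall (0 : Fin 3 → E3) 1).tendsto_subseq hbd
  have hp' := hp.comp hφ.tendsto_atTop
  have had := isAdaptedFrame_of_tendsto hX hF (fun n => (γ (t (φ n))).2) hp' hA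
  refine ⟨⟨(p, A), had⟩, t ∘ φ, fun n => htm _, htt.comp hφ.tendsto_atTop, ?_⟩
  rw [tendsto_subtype_rng]
  exact hp'.prodMk_nhds hA

/-- Times that are reached by a curve along the `i`-th frame vector starting at `z`. -/
def Reaches (i : Fin 3) (z : FrameBundle X F) (s : ℝ) : Prop :=
  ∃ (γ : ℝ → FrameBundle X F) (J : Set ℝ), IsOpen J ∧ J.OrdConnected ∧ 0 ∈ J ∧ s ∈ J ∧ γ 0 = z ∧
    ∀ r ∈ J, FlowsAlong i (fun _ => 1) γ r

/-- By uniqueness, the curves that reach the times of an open set containing `0` fit together. -/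
theorem exists_flowsAlong_of_reaches [T2Space M] (hX : IsImmersedSurface X)
    (hF : F.IsPlanarGeodesic X) {i : Fin 3} (hi : i ≠ 2) {z : FrameBundle X F} {I : Set ℝ}
    (h0 : (0 : ℝ) ∈ I) (hI : ∀ s ∈ I, Reaches i z s) (hIo : IsOpen I) :
    ∃ γ : ℝ → FrameBundle X F, γ 0 = z ∧ ∀ s ∈ I, FlowsAlong i (fun _ => 1) γ s := by
  classical
  have hI' : ∀ s, ∃ (γ : ℝ → FrameBundle X F) (J : Set ℝ), s ∈ I → IsOpen J ∧ J.OrdConnected ∧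
      0 ∈ J ∧ s ∈ J ∧ γ 0 = z ∧ ∀ r ∈ J, FlowsAlong i (fun _ => 1) γ r := fun s => by
    by_cases hs : s ∈ I
    · obtain ⟨γ, J, h⟩ := hI s hs
      exact ⟨γ, J, fun _ => h⟩
    · exact ⟨fun _ => z, ∅, fun h => absurd h hs⟩
  choose γ J H using hI'
  refine ⟨fun s => γ s s, (H 0 h0).2.2.2.2.1, fun s hs => ?_⟩
  obtain ⟨hJo, hJc, hJ0, hJs, hγ0, hγ⟩ := H s hs
  refine (hγ s hJs).congr ?_
  filter_upwards [hJo.mem_nhds hJs, hIo.mem_nhds hs] with r hr hrI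
  obtain ⟨hJo', hJc', hJ0', hJs', hγ0', hγ'⟩ := H r hrI
  exact FlowsAlong.eqOn hX hF hi continuous_const (hJo'.inter hJo)
    (hJc'.inter hJc).isPreconnected (fun q hq => hγ' q hq.1) (fun q hq => hγ q hq.2)
    ⟨hJ0', hJ0⟩ (hγ0'.trans hγ0.symm) ⟨hJs', hr⟩

/-- The times that are reached form an open set; by completeness it is closed in `[0, ∞)`. -/
theorem reaches_of_nonneg [T2Space M] (hX : IsImmersedSurface X) (hF : F.IsPlanarGeodesic X)
    (hC : IsCompleteSurface X) {i : Fin 3} (hi : i ≠ 2) (z : FrameBundle X F) {s : ℝ}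
    (hs : 0 ≤ s) : Reaches i z s := by
  obtain ⟨V, hV, δ, hδ, Hδ⟩ := exists_flowsAlong_uniform hX hF hi z
  obtain ⟨γ₀, hγ₀, hγ₀'⟩ := Hδ z (mem_of_mem_nhds hV)
  have hloc : ∀ r ∈ Ioo (-δ) δ, Reaches i z r := fun r hr =>
    ⟨γ₀, Ioo (-δ) δ, isOpen_Ioo, ordConnected_Ioo, ⟨neg_lt_zero.2 hδ, hδ⟩, hr, hγ₀, hγ₀'⟩
  have hopen : IsOpen {r | Reaches i z r} := by
    rw [isOpen_iff_mem_nhds]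
    rintro r ⟨γ, J, h1, h2, h3, h4, h5⟩
    filter_upwards [h1.mem_nhds h4] with q hq using ⟨γ, J, h1, h2, h3, hq, h5⟩
  have hdown : ∀ r, Reaches i z r → ∀ q ∈ Icc 0 r, Reaches i z q := by
    rintro r ⟨γ, J, h1, h2, h3, h4, h5⟩ q hq
    exact ⟨γ, J, h1, h2, h3, h2.out h3 h4 hq, h5⟩
  refine isPreconnected_Ici.subset_of_closure_inter_subset (s := Ici (0 : ℝ)) hopen
    ⟨0, mem_Ici.2 le_rfl, hloc 0 ⟨neg_lt_zero.2 hδ, hδ⟩⟩ ?_ hs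
  rintro b ⟨hbc, hb0⟩
  by_cases hbδ : b < δ
  · exact hloc b ⟨by linarith [show (0 : ℝ) ≤ b from hb0], hbδ⟩
  have hb : 0 < b := by linarith
  have hI : ∀ r ∈ Ioo (-δ) b, Reaches i z r := fun r hr => by
    by_cases hr0 : r < 0
    · exact hloc r ⟨hr.1, by linarith⟩
    · obtain ⟨q, hq, hqr⟩ := (mem_closure_iff.1 hbc) (Ioi r) isOpen_Ioi hr.2
      exact hdown q (show Reaches i z q from hqr) r (mem_Icc.2 ⟨not_lt.1 hr0, le_of_lt hq⟩)
  obtain ⟨γ, hγ0, hγ⟩ := exists_flowsAlong_of_reaches hX hF hi (I := Ioo (-δ) b)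
    ⟨neg_lt_zero.2 hδ, hb⟩ hI isOpen_Ioo
  obtain ⟨y, t, ht, htb, hty⟩ := exists_limit_frame hX hF hC hi (by linarith) hγ
  obtain ⟨W, hW, ε, hε, Hε⟩ := exists_flowsAlong_uniform hX hF hi y
  obtain ⟨n, hn1, hn2⟩ := ((hty.eventually_mem hW).and
    (htb.eventually_mem (Ioi_mem_nhds (show max 0 (b - ε) < b from max_lt hb (by linarith))))).exists
  obtain ⟨η, hη0, hη⟩ := Hε _ hn1
  have hn0 : 0 < t n := (le_max_left _ _).trans_lt hn2
  have hnb : b < t n + ε := by linarith [(le_max_right 0 (b - ε)).trans_lt hn2]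
  -- continue `γ` from time `t n` on by the curve starting at `γ (t n)`
  have hη' : ∀ r ∈ Ioo (t n - ε) (t n + ε), FlowsAlong i (fun _ => 1) (fun q => η (q + -t n)) r :=
    fun r hr => (hη (r + -t n) ⟨by linarith [hr.1], by linarith [hr.2]⟩).comp_add (-t n)
  have hjoin : γ =ᶠ[𝓝 (t n)] fun q => η (q + -t n) := by
    refine FlowsAlong.eventuallyEq hX hF hi continuousAt_const
      (by filter_upwards [Ioo_mem_nhds (ht n).1 (ht n).2] with r hr using hγ r hr) ?_
      (by simp [hη0])
    filter_upwards [Ioo_mem_nhds (show t n - ε < t n by linarith)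
      (show t n < t n + ε by linarith)] with r hr using hη' r hr
  refine ⟨fun q => if q < t n then γ q else η (q + -t n), Ioo (-δ) (t n + ε), isOpen_Ioo,
    ordConnected_Ioo, ⟨neg_lt_zero.2 hδ, by linarith⟩, ⟨by linarith, hnb⟩, by simp [hn0, hγ0], ?_⟩
  intro r hr
  rcases lt_trichotomy r (t n) with hrt | hrt | hrt
  · refine (hγ r ⟨hr.1, hrt.trans (ht n).2⟩).congr ?_
    filter_upwards [Iio_mem_nhds hrt] with q hq using if_pos hq
  · rw [hrt]
    refine (hγ (t n) (ht n)).congr ?_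
    filter_upwards [hjoin] with q hq
    by_cases hqt : q < t n
    · exact if_pos hqt
    · rw [if_neg hqt]; exact hq.symm
  · refine (hη' r ⟨by linarith, hr.2⟩).congr ?_
    filter_upwards [Ioi_mem_nhds hrt] with q hq using if_neg (not_lt.2 (le_of_lt hq))

/-- Sign changes of the frame act on curves along frame vectors, possibly reversing them. -/
theorem FlowsAlong.flip {i : Fin 3} {l : ℝ → ℝ} {γ : ℝ → FrameBundle X F} {σ : Fin 3 → ℝ}
    (hσ : IsSign σ) {s : ℝ} (h : FlowsAlong i l γ s) :
    FlowsAlong i (fun r => σ i * l r) (fun r => (γ r).flip hσ) s := by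
  refine ⟨(FrameBundle.continuous_flip hσ).continuousAt.comp h.1, ?_⟩
  have := h.2
  rwa [FrameBundle.flip_fr, smul_smul, mul_right_comm, hσ.mul_self, one_mul]

theorem FlowsAlong.comp_mul {i : Fin 3} {l : ℝ → ℝ} {γ : ℝ → FrameBundle X F} (c : ℝ) {s : ℝ}
    (h : FlowsAlong i l γ (c * s)) :
    FlowsAlong i (fun r => c * l (c * r)) (fun r => γ (c * r)) s := by
  refine ⟨ContinuousAt.comp (f := fun r : ℝ => c * r) h.1 (by fun_prop), ?_⟩
  have h1 : HasDerivAt (fun r : ℝ => c * r) c s := by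
    simpa using (hasDerivAt_id s).const_mul c
  have := HasDerivAt.scomp s h.2 h1
  rwa [smul_smul] at this

theorem isSign_neg_one : IsSign fun _ => -1 := fun _ => Or.inr rfl

/-- On a complete surface, the curves along frame vectors are defined for all times. -/
theorem exists_complete_curve [T2Space M] (hX : IsImmersedSurface X) (hF : F.IsPlanarGeodesic X)
    (hC : IsCompleteSurface X) {i : Fin 3} (hi : i ≠ 2) (z : FrameBundle X F) :
    ∃ γ : ℝ → FrameBundle X F, γ 0 = z ∧ ∀ s, FlowsAlong i (fun _ => 1) γ s := by
  have hr : ∀ s, Reaches i z s := fun s => by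
    by_cases hs : 0 ≤ s
    · exact reaches_of_nonneg hX hF hC hi z hs
    -- negative times are positive times for the reversed frame
    obtain ⟨γ, J, h1, h2, h3, h4, h5, h6⟩ := reaches_of_nonneg hX hF hC hi
      (z.flip isSign_neg_one) (show 0 ≤ -s by linarith)
    refine ⟨fun r => (γ (-1 * r)).flip isSign_neg_one, (fun r => -1 * r) ⁻¹' J,
      h1.preimage (by fun_prop), ⟨fun x hx y hy w hw => ?_⟩, by simpa using h3, by simpa using h4,
      by simp [h5, FrameBundle.flip_flip], fun r hr => ?_⟩
    · exact h2.out hy hx ⟨by linarith [hw.2], by linarith [hw.1]⟩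
    · have := ((h6 (-1 * r) hr).comp_mul (-1)).flip isSign_neg_one
      simpa using this
  obtain ⟨γ, h0, h⟩ := exists_flowsAlong_of_reaches hX hF hi (mem_univ 0) (fun s _ => hr s)
    isOpen_univ
  exact ⟨γ, h0, fun s => h s trivial⟩

end Completeness

/-! ### The flows of the frame vectors -/

section Flows

variable {M : Type*} [TopologicalSpace M] [ChartedSpace (EuclideanSpace ℝ (Fin 2)) M]
  [IsManifold (𝓡 2) ∞ M] {X : M → E3} {F : Foliation M}

/-- A complete immersed surface with a planar geodesic foliation. -/
structure IsCompletePlanar (X : M → E3) (F : Foliation M) : Prop where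
  immersed : IsImmersedSurface X
  planar : F.IsPlanarGeodesic X
  complete : IsCompleteSurface X

open Classical in
/-- The flow of the `i`-th frame vector on the bundle of adapted frames. The default value is never
used for `i = 0` and `i = 1` on a complete surface. -/
def flow (i : Fin 3) (s : ℝ) (z : FrameBundle X F) : FrameBundle X F :=
  if h : ∃ γ : ℝ → FrameBundle X F, γ 0 = z ∧ ∀ r, FlowsAlong i (fun _ => 1) γ r then h.choose s
  else z

variable [T2Space M] (H : IsCompletePlanar X F)

include H

theorem flow_zero {i : Fin 3} (hi : i ≠ 2) (z : FrameBundle X F) : flow i 0 z = z := by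
  have h := exists_complete_curve H.immersed H.planar H.complete hi z
  rw [flow, dif_pos h]
  exact h.choose_spec.1

theorem flowsAlong_flow {i : Fin 3} (hi : i ≠ 2) (z : FrameBundle X F) (s : ℝ) :
    FlowsAlong i (fun _ => 1) (fun r => flow i r z) s := by
  have h := exists_complete_curve H.immersed H.planar H.complete hi z
  simp only [flow, dif_pos h]
  exact h.choose_spec.2 s

/-- A curve along the `i`-th frame vector that starts at time `0` is an orbit of the flow. -/
theorem eq_flow {i : Fin 3} (hi : i ≠ 2) {γ : ℝ → FrameBundle X F} {I : Set ℝ} (hIo : IsOpen I)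
    (hI : IsPreconnected I) (h0 : (0 : ℝ) ∈ I) (h : ∀ s ∈ I, FlowsAlong i (fun _ => 1) γ s) {s : ℝ}
    (hs : s ∈ I) : flow i s (γ 0) = γ s :=
  FlowsAlong.eqOn H.immersed H.planar hi continuous_const hIo hI
    (fun r _ => flowsAlong_flow H hi (γ 0) r) h h0 (flow_zero H hi _) hs

theorem flow_add {i : Fin 3} (hi : i ≠ 2) (s t : ℝ) (z : FrameBundle X F) :
    flow i (s + t) z = flow i s (flow i t z) := by
  have := eq_flow H hi (γ := fun r => flow i (r + t) z) isOpen_univ isPreconnected_univ trivial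
    (fun r _ => (flowsAlong_flow H hi z (r + t)).comp_add t) (mem_univ s)
  simpa using this.symm

theorem flow_flip {i : Fin 3} (hi : i ≠ 2) {σ : Fin 3 → ℝ} (hσ : IsSign σ) (s : ℝ)
    (z : FrameBundle X F) : flow i s (z.flip hσ) = (flow i (σ i * s) z).flip hσ := by
  have := eq_flow H hi (γ := fun r => (flow i (σ i * r) z).flip hσ) isOpen_univ isPreconnected_univ
    trivial (fun r _ => ?_) (mem_univ s)
  · simpa [flow_zero H hi] using this
  · have := ((flowsAlong_flow H hi z (σ i * r)).comp_mul (σ i)).flip hσ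
    simpa [hσ.mul_self] using this

/-- In box coordinates, the flow along the leaves is translation in the first coordinate. -/
theorem flow_box {z : FrameBundle X F} (β : AdaptedBox X F z.pt z.fr) {y : FrameBundle X F}
    (hy : y ∈ β.nhd) {s : ℝ} (hs : β.chart y.pt + (s, 0) ∈ β.chart.target) :
    flow 0 s y = β.lift (β.chart y.pt + (s, 0)) := by
  set w := β.chart y.pt with hw
  have hmem : ∀ r, w + (r, 0) ∈ β.chart.target ↔ r ∈ Ioo (-β.radius - w.1) (β.radius - w.1) := by
    intro r
    have h2 : w ∈ β.chart.target := β.mem_target hy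
    rw [β.target_eq] at h2 ⊢
    have h3 : (w + (r, 0)).2 ∈ Ioo (-β.radius) β.radius := by simpa using h2.2
    rw [mem_prod, and_iff_left h3]
    simp only [Prod.fst_add, mem_Ioo]
    constructor <;> rintro ⟨h4, h5⟩ <;> constructor <;> linarith
  have h0 : w + ((0 : ℝ), (0 : ℝ)) = w := add_zero w
  have := eq_flow H (i := 0) (by decide) (γ := fun r => β.lift (w + (r, 0))) isOpen_Ioo
    isPreconnected_Ioo ((hmem 0).1 (by rw [h0]; exact β.mem_target hy)) (fun r hr => ?_)
    ((hmem s).1 hs)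
  · simp only [h0] at this
    rwa [hw, hy.2, ← hw] at this
  · refine flowsAlong_lift β (by decide) ?_ ((hmem r).2 hr)
    have h1 : HasDerivAt (fun r : ℝ => (r, (0 : ℝ))) (1, 0) r :=
      (hasDerivAt_id r).prodMk (hasDerivAt_const r 0)
    simpa [AdaptedBox.field] using h1.const_add w

/-- The flow along the leaves takes orthogonal trajectories to orthogonal trajectories, within a
box. -/
theorem flowsAlong_flow_comp_box {z : FrameBundle X F} (β : AdaptedBox X F z.pt z.fr)
    {γ : ℝ → FrameBundle X F} {l : ℝ → ℝ} {v t : ℝ} (h : FlowsAlong 1 l γ v) (hl : 0 < l v)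
    (hγ : γ v ∈ β.nhd) (ht : β.chart (γ v).pt + (t, 0) ∈ β.chart.target) :
    ∃ m > 0, FlowsAlong 1 (fun _ => m) (fun r => flow 0 t (γ r)) v := by
  have hd := h.hasDerivAt_chart H.immersed (by decide) β hγ
  set α : ℝ → ℝ × ℝ := fun r => β.chart (γ r).pt + (t, 0) with hα
  have hd' : HasDerivAt α (l v • β.field 1 (β.chart (γ v).pt)) v := hd.add_const _
  have hs1 := β.stretch_pos _ (β.mem_target hγ)
  have hs2 := β.stretch_pos _ ht
  refine ⟨l v * (β.stretch (β.chart (γ v).pt))⁻¹ * β.stretch (α v), by positivity, ?_⟩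
  refine FlowsAlong.congr (γ := fun r => β.lift (α r)) (flowsAlong_lift β (by decide) ?_ ht) ?_
  · have hf : ∀ w, β.field 1 w = (0, (β.stretch w)⁻¹) := fun w => rfl
    rw [hf] at hd' ⊢
    convert hd' using 1
    have : β.stretch (α v) ≠ 0 := hs2.ne'
    ext
    · simp
    · simp; field_simp
  · filter_upwards [h.1.eventually_mem (β.nhd_mem_nhds hγ),
      hd'.continuousAt.eventually_mem (β.chart.open_target.mem_nhds ht)] with r h1 h2
    exact flow_box H β h1 h2

/-- The flow along the leaves takes orthogonal trajectories to orthogonal trajectories, without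
reversing or stopping them. -/
theorem flowsAlong_flow_comp {γ : ℝ → FrameBundle X F} {l : ℝ → ℝ} {v : ℝ}
    (h : FlowsAlong 1 l γ v) (hl : 0 < l v) (u : ℝ) :
    ∃ m > 0, FlowsAlong 1 (fun _ => m) (fun r => flow 0 u (γ r)) v := by
  -- The claim propagates from every time to all nearby ones, in both directions, by the local
  -- result in a box around the frame reached at that time.
  let P : ℝ → Prop := fun u => ∃ m > 0, FlowsAlong 1 (fun _ => m) (fun r => flow 0 u (γ r)) v
  have hstep : ∀ u, ∀ᶠ u' in 𝓝 u, (P u → P u') ∧ (P u' → P u) := by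
    intro u
    obtain ⟨β⟩ := exists_box_at H.immersed H.planar (flow 0 u (γ v))
    have hc := (flowsAlong_flow H (i := 0) (by decide) (γ v) u).1
    have hr : Ioo (u - β.radius) (u + β.radius) ∈ 𝓝 u :=
      Ioo_mem_nhds (by linarith [β.radius_pos]) (by linarith [β.radius_pos])
    filter_upwards [hc.eventually_mem (β.nhd_mem_nhds β.mem_nhd_self), hr] with u' hu' hur
    have h1 : ((u' - u, 0) : ℝ × ℝ) ∈ β.chart.target := by
      rw [β.target_eq]
      exact ⟨⟨by linarith [hur.1], by linarith [hur.2]⟩, neg_lt_zero.2 β.radius_pos, β.radius_pos⟩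
    have h2 : flow 0 u' (γ v) = β.lift (u' - u, 0) := by
      have := flow_box H β β.mem_nhd_self (s := u' - u)
        (by rw [β.chart_center, zero_add]; exact h1)
      rwa [β.chart_center, zero_add, ← flow_add H (by decide), sub_add_cancel] at this
    have h3 : ∀ a b : ℝ, (fun r => flow 0 (b - a) (flow 0 a (γ r))) = fun r => flow 0 b (γ r) :=
      fun a b => by simp_rw [← flow_add H (i := 0) (by decide), sub_add_cancel]
    constructor
    · rintro ⟨m, hm, hm'⟩
      have := flowsAlong_flow_comp_box H β hm' hm β.mem_nhd_self (t := u' - u)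
        (by rw [β.chart_center, zero_add]; exact h1)
      rwa [h3] at this
    · rintro ⟨m, hm, hm'⟩
      have := flowsAlong_flow_comp_box H β hm' hm hu' (t := u - u') (by
        rw [h2, β.lift_pt h1, β.chart.right_inv h1]
        convert β.zero_mem_target using 1
        simp)
      rwa [h3] at this
  refine PreconnectedSpace.induction₂' (fun u u' => P u → P u') hstep
    ⟨fun a b c h1 h2 h3 => h2 (h1 h3)⟩ 0 u ⟨l v, hl, ?_⟩
  simp only [flow_zero H (i := 0) (by decide)]
  exact h

/-- The frames transported along the leaves from an orthogonal trajectory depend continuously on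
both parameters. -/
theorem continuous_flow_flow (z : FrameBundle X F) :
    Continuous fun w : ℝ × ℝ => flow 0 w.1 (flow 1 w.2 z) := by
  rw [continuous_iff_continuousAt]
  rintro ⟨u₀, v₀⟩
  obtain ⟨β⟩ := exists_box_at H.immersed H.planar (flow 0 u₀ (flow 1 v₀ z))
  obtain ⟨m, -, hm⟩ := flowsAlong_flow_comp H (flowsAlong_flow H (i := 1) (by decide) z v₀)
    one_pos u₀
  have hc : ContinuousAt (fun w : ℝ × ℝ => flow 0 u₀ (flow 1 w.2 z)) (u₀, v₀) :=
    ContinuousAt.comp (f := Prod.snd) (x := (u₀, v₀)) hm.1 continuousAt_snd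
  have hn := β.nhd_mem_nhds β.mem_nhd_self
  have hc' : ContinuousAt
      (fun w : ℝ × ℝ => β.chart (flow 0 u₀ (flow 1 w.2 z)).pt + (w.1 - u₀, 0)) (u₀, v₀) := by
    have h1 : ContinuousAt (fun y : FrameBundle X F => β.chart y.pt) (flow 0 u₀ (flow 1 v₀ z)) :=
      β.continuousOn_chart_pt.continuousAt hn
    have h2 := ContinuousAt.comp (f := fun w : ℝ × ℝ => flow 0 u₀ (flow 1 w.2 z))
      (x := (u₀, v₀)) h1 hc
    exact h2.add (by fun_prop)
  have hval : β.chart (flow 0 u₀ (flow 1 v₀ z)).pt + (u₀ - u₀, 0) = 0 := by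
    rw [β.chart_center]; simp
  have ht : β.chart.target ∈ 𝓝 (β.chart (flow 0 u₀ (flow 1 v₀ z)).pt + (u₀ - u₀, 0)) := by
    rw [hval]; exact β.chart.open_target.mem_nhds β.zero_mem_target
  have hlift := (β.continuousOn_lift.continuousAt ht)
  refine (ContinuousAt.comp (f := fun w : ℝ × ℝ =>
    β.chart (flow 0 u₀ (flow 1 w.2 z)).pt + (w.1 - u₀, 0)) (x := (u₀, v₀)) hlift hc').congr ?_
  filter_upwards [hc.eventually_mem hn, hc'.eventually_mem ht] with w h1 h2
  rw [Function.comp_apply, ← flow_box H β h1 h2, ← flow_add H (by decide), sub_add_cancel]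

omit H

/-- The curvature of the leaf through the base point of a frame, with respect to the third vector
of the frame. -/
def bend (z : FrameBundle X F) : ℝ :=
  inner ℝ (deriv (fun s => (flow 0 s z).fr 0) 0) (z.fr 2)

omit [T2Space M] in
/-- A derivative of a frame vector along a curve, read off from a box. -/
theorem FlowsAlong.hasDerivAt_fr (hX : IsImmersedSurface X) {i : Fin 3} (hi : i ≠ 2) {l : ℝ → ℝ}
    {γ : ℝ → FrameBundle X F} {s : ℝ} (h : FlowsAlong i l γ s) {z : FrameBundle X F}
    (β : AdaptedBox X F z.pt z.fr) (hγ : γ s ∈ β.nhd) (j : Fin 3) :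
    HasDerivAt (fun r => (γ r).fr j)
      (fderiv ℝ (β.frame j) (β.chart (γ s).pt) (l s • β.field i (β.chart (γ s).pt))) s := by
  have h1 := h.hasDerivAt_chart hX hi β hγ
  have h2 : DifferentiableAt ℝ (β.frame j) (β.chart (γ s).pt) :=
    ((β.smooth_frame j).contDiffAt (β.chart.open_target.mem_nhds (β.mem_target hγ))).differentiableAt
      (by simp)
  refine (h2.hasFDerivAt.comp_hasDerivAt s h1).congr_of_eventuallyEq ?_
  filter_upwards [h.1.eventually_mem (β.nhd_mem_nhds hγ)] with r hr using β.fr_eq hr j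

omit [T2Space M] in
/-- The structure equations along a leaf, in terms of a box. -/
theorem FlowsAlong.hasDerivAt_fr_leaf (hX : IsImmersedSurface X) {γ : ℝ → FrameBundle X F} {s : ℝ}
    (h : FlowsAlong 0 (fun _ => 1) γ s) {z : FrameBundle X F} (β : AdaptedBox X F z.pt z.fr)
    (hγ : γ s ∈ β.nhd) :
    HasDerivAt (fun r => (γ r).fr 0) (β.curv (β.chart (γ s).pt).1 • (γ s).fr 2) s ∧
    HasDerivAt (fun r => (γ r).fr 1) 0 s ∧
    HasDerivAt (fun r => (γ r).fr 2) (-β.curv (β.chart (γ s).pt).1 • (γ s).fr 0) s := by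
  have hf : ∀ w, (1 : ℝ) • β.field 0 w = (1, 0) := fun w => one_smul _ _
  have ht := β.mem_target hγ
  refine ⟨?_, ?_, ?_⟩
  · have := h.hasDerivAt_fr hX (by decide) β hγ 0
    rw [hf, (β.hasFDerivAt_T _ ht).fderiv, ofCols_apply, ← β.fr_eq hγ] at this
    simpa using this
  · have := h.hasDerivAt_fr hX (by decide) β hγ 1
    rwa [hf, β.fderiv_B _ ht] at this
  · have := h.hasDerivAt_fr hX (by decide) β hγ 2
    rw [hf, (β.hasFDerivAt_N _ ht).fderiv, ofCols_apply, ← β.fr_eq hγ] at this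
    simpa using this

omit [T2Space M] in
/-- Along an orthogonal trajectory, the derivatives of the leaf tangent and of the normal are
parallel to the trajectory. -/
theorem FlowsAlong.exists_hasDerivAt_fr_orthogonal (hX : IsImmersedSurface X)
    (hF : F.IsPlanarGeodesic X) {l : ℝ → ℝ} {γ : ℝ → FrameBundle X F} {s : ℝ}
    (h : FlowsAlong 1 l γ s) :
    (∃ a : ℝ, HasDerivAt (fun r => (γ r).fr 0) (a • (γ s).fr 1) s) ∧
    ∃ a : ℝ, HasDerivAt (fun r => (γ r).fr 2) (a • (γ s).fr 1) s := by
  obtain ⟨β⟩ := exists_box_at hX hF (γ s)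
  have hγ := β.mem_nhd_self
  have hf : ∀ w, l s • β.field 1 w = (0, l s * (β.stretch w)⁻¹) := fun w => by
    simp [AdaptedBox.field]
  have ht := β.mem_target hγ
  constructor
  · have := h.hasDerivAt_fr hX (by decide) β hγ 0
    rw [hf, (β.hasFDerivAt_T _ ht).fderiv, ofCols_apply, ← β.fr_eq hγ, ← β.fr_eq hγ, zero_smul,
      zero_add, smul_smul] at this
    exact ⟨_, this⟩
  · have := h.hasDerivAt_fr hX (by decide) β hγ 2
    rw [hf, (β.hasFDerivAt_N _ ht).fderiv, ofCols_apply, ← β.fr_eq hγ, ← β.fr_eq hγ, zero_smul,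
      zero_add, smul_smul] at this
    exact ⟨_, this⟩

include H

theorem bend_eq {z : FrameBundle X F} (β : AdaptedBox X F z.pt z.fr) {y : FrameBundle X F}
    (hy : y ∈ β.nhd) : bend y = β.curv (β.chart y.pt).1 := by
  have h := (flowsAlong_flow H (i := 0) (by decide) y 0).hasDerivAt_fr_leaf H.immersed β
    (by rwa [flow_zero H (by decide)])
  rw [bend, h.1.deriv, flow_zero H (by decide), inner_smul_left, real_inner_self_eq_norm_sq,
    y.norm_fr]
  simp

/-- The structure equations along a leaf: the frame turns about its second vector. -/
theorem hasDerivAt_fr_flow (z : FrameBundle X F) (s : ℝ) :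
    HasDerivAt (fun r => (flow 0 r z).fr 0) (bend (flow 0 s z) • (flow 0 s z).fr 2) s ∧
    HasDerivAt (fun r => (flow 0 r z).fr 1) 0 s ∧
    HasDerivAt (fun r => (flow 0 r z).fr 2) (-bend (flow 0 s z) • (flow 0 s z).fr 0) s := by
  obtain ⟨β⟩ := exists_box_at H.immersed H.planar (flow 0 s z)
  have h := (flowsAlong_flow H (i := 0) (by decide) z s).hasDerivAt_fr_leaf H.immersed β
    β.mem_nhd_self
  rwa [← bend_eq H β β.mem_nhd_self] at h

theorem contDiff_bend_flow (z : FrameBundle X F) : ContDiff ℝ ∞ fun s => bend (flow 0 s z) := by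
  rw [contDiff_iff_contDiffAt]
  intro s
  obtain ⟨β⟩ := exists_box_at H.immersed H.planar (flow 0 s z)
  have hr : Ioo (-β.radius) β.radius ∈ 𝓝 (s - s) := by
    rw [sub_self]; exact Ioo_mem_nhds (neg_lt_zero.2 β.radius_pos) β.radius_pos
  have h1 : ContDiffAt ℝ ∞ (fun r => β.curv (r - s)) s :=
    ContDiffAt.comp s (β.smooth_curv.contDiffAt hr) (by fun_prop)
  refine h1.congr_of_eventuallyEq ?_
  have hr' : ∀ᶠ r in 𝓝 s, r - s ∈ Ioo (-β.radius) β.radius :=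
    ContinuousAt.eventually_mem (f := fun r : ℝ => r - s) (by fun_prop) hr
  filter_upwards [hr'] with r hr2
  have ht : ((r - s, 0) : ℝ × ℝ) ∈ β.chart.target := by
    rw [β.target_eq]
    exact ⟨hr2, neg_lt_zero.2 β.radius_pos, β.radius_pos⟩
  have h2 := flow_box H β β.mem_nhd_self (s := r - s)
    (by rwa [β.chart_center, zero_add])
  rw [β.chart_center, zero_add, ← flow_add H (by decide), sub_add_cancel] at h2
  rw [h2, bend_eq H β (β.lift_mem_nhd ht), β.lift_pt ht, β.chart.right_inv ht]

/-- Along an orthogonal trajectory the curvature of the leaves is constant. -/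
theorem bend_comp_const {γ : ℝ → FrameBundle X F}
    (h : ∀ v, ∃ l : ℝ, FlowsAlong 1 (fun _ => l) γ v) (v v' : ℝ) :
    bend (γ v) = bend (γ v') := by
  have hd : ∀ v, HasDerivAt (fun r => bend (γ r)) 0 v := by
    intro v
    obtain ⟨l, hl⟩ := h v
    obtain ⟨β⟩ := exists_box_at H.immersed H.planar (γ v)
    have h1 := hl.hasDerivAt_chart H.immersed (by decide) β β.mem_nhd_self
    have h2 : HasDerivAt (fun r => (β.chart (γ r).pt).1) 0 v := by
      have := (hasFDerivAt_fst (𝕜 := ℝ) (E := ℝ) (F := ℝ)).comp_hasDerivAt v h1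
      have h0 : ContinuousLinearMap.fst ℝ ℝ ℝ (l • β.field 1 (β.chart (γ v).pt)) = 0 := by
        simp [AdaptedBox.field]
      rw [h0] at this
      exact this
    have hr : Ioo (-β.radius) β.radius ∈ 𝓝 (β.chart (γ v).pt).1 := by
      rw [β.chart_center]; exact Ioo_mem_nhds (neg_lt_zero.2 β.radius_pos) β.radius_pos
    have h3 := ((β.smooth_curv.contDiffAt hr).differentiableAt (by simp)).hasDerivAt.comp v h2
    rw [mul_zero] at h3
    refine h3.congr_of_eventuallyEq ?_
    filter_upwards [hl.1.eventually_mem (β.nhd_mem_nhds β.mem_nhd_self)] with r hr2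
    exact bend_eq H β hr2
  exact is_const_of_deriv_eq_zero (fun v => (hd v).differentiableAt) (fun v => (hd v).deriv) v v'

end Flows

/-! ### The development of the surface -/

theorem hasDerivAt_integral_of_continuous {f : ℝ → ℝ} (hf : Continuous f) (u : ℝ) :
    HasDerivAt (fun u => ∫ s in (0 : ℝ)..u, f s) (f u) u :=
  intervalIntegral.integral_hasDerivAt_right (hf.intervalIntegrable _ _)
    (hf.stronglyMeasurableAtFilter _ _) hf.continuousAt

theorem contDiff_integral {f : ℝ → ℝ} (hf : ContDiff ℝ ∞ f) :
    ContDiff ℝ ∞ fun u => ∫ s in (0 : ℝ)..u, f s := by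
  rw [contDiff_infty_iff_deriv]
  refine ⟨fun u => (hasDerivAt_integral_of_continuous hf.continuous u).differentiableAt, ?_⟩
  rwa [show deriv (fun u => ∫ s in (0 : ℝ)..u, f s) = f from
    funext fun u => (hasDerivAt_integral_of_continuous hf.continuous u).deriv]

theorem eq_of_hasDerivAt_zero {f : ℝ → E3} (h : ∀ u, HasDerivAt f 0 u) (u : ℝ) : f u = f 0 :=
  is_const_of_deriv_eq_zero (fun v => (h v).differentiableAt) (fun v => (h v).deriv) u 0

section Development

variable {M : Type*} [TopologicalSpace M] [ChartedSpace (EuclideanSpace ℝ (Fin 2)) M]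
  [IsManifold (𝓡 2) ∞ M] {X : M → E3} {F : Foliation M}

/-- The frames obtained from `z` by moving the time `w.2` along the orthogonal trajectory through
`z`, then the time `w.1` along the leaf. -/
def sheet (z : FrameBundle X F) (w : ℝ × ℝ) : FrameBundle X F := flow 0 w.1 (flow 1 w.2 z)

/-- The angle by which the frame has turned at time `u` along the leaf: the integral of the
curvature. -/
def turning (z : FrameBundle X F) (u : ℝ) : ℝ := ∫ s in (0 : ℝ)..u, bend (flow 0 s z)

/-- First coordinate of the leaf in its plane, with respect to the vectors `0` and `2` of the frame
at time `0`. -/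
def profileX (z : FrameBundle X F) (u : ℝ) : ℝ := ∫ s in (0 : ℝ)..u, Real.cos (turning z s)

/-- Second coordinate of the leaf in its plane. -/
def profileY (z : FrameBundle X F) (u : ℝ) : ℝ := ∫ s in (0 : ℝ)..u, Real.sin (turning z s)

/-- Signed speed of the curves `u = const` with respect to the second vector of the frame. -/
def speed (z : FrameBundle X F) (u v : ℝ) : ℝ :=
  inner ℝ (deriv (fun r => X (sheet z (u, r)).pt) v) ((flow 1 v z).fr 1)

theorem turning_zero (z : FrameBundle X F) : turning z 0 = 0 := by simp [turning]

variable [T2Space M] (H : IsCompletePlanar X F) (z : FrameBundle X F)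

include H

theorem contDiff_turning : ContDiff ℝ ∞ (turning z) := contDiff_integral (contDiff_bend_flow H z)

theorem hasDerivAt_turning (u : ℝ) : HasDerivAt (turning z) (bend (flow 0 u z)) u :=
  hasDerivAt_integral_of_continuous (contDiff_bend_flow H z).continuous u

theorem contDiff_profileX : ContDiff ℝ ∞ (profileX z) :=
  contDiff_integral (contDiff_turning H z).cos

theorem contDiff_profileY : ContDiff ℝ ∞ (profileY z) :=
  contDiff_integral (contDiff_turning H z).sin

theorem hasDerivAt_profileX (u : ℝ) : HasDerivAt (profileX z) (Real.cos (turning z u)) u :=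
  hasDerivAt_integral_of_continuous (contDiff_turning H z).cos.continuous u

theorem hasDerivAt_profileY (u : ℝ) : HasDerivAt (profileY z) (Real.sin (turning z u)) u :=
  hasDerivAt_integral_of_continuous (contDiff_turning H z).sin.continuous u

theorem sheet_zero (v : ℝ) : sheet z (0, v) = flow 1 v z := flow_zero H (by decide) _

theorem continuous_sheet : Continuous (sheet z) := continuous_flow_flow H z

theorem flowsAlong_sheet_leaf (u v : ℝ) : FlowsAlong 0 (fun _ => 1) (fun r => sheet z (r, v)) u :=
  flowsAlong_flow H (by decide) _ u

/-- The curves `u = const` are orthogonal trajectories. -/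
theorem exists_flowsAlong_sheet (u v : ℝ) :
    ∃ m > 0, FlowsAlong 1 (fun _ => m) (fun r => sheet z (u, r)) v :=
  flowsAlong_flow_comp H (flowsAlong_flow H (by decide) z v) one_pos u

/-- The leaves through the points of the spine have the same curvature function. -/
theorem bend_sheet (u v : ℝ) : bend (sheet z (u, v)) = bend (flow 0 u z) := by
  have := bend_comp_const H (γ := fun r => sheet z (u, r)) (fun v => by
    obtain ⟨m, -, h⟩ := exists_flowsAlong_sheet H z u v
    exact ⟨m, h⟩) v 0
  simpa [sheet, flow_zero H (i := 1) (by decide)] using this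

theorem hasDerivAt_sheet_fr (u v : ℝ) :
    HasDerivAt (fun r => (sheet z (r, v)).fr 0) (bend (flow 0 u z) • (sheet z (u, v)).fr 2) u ∧
    HasDerivAt (fun r => (sheet z (r, v)).fr 1) 0 u ∧
    HasDerivAt (fun r => (sheet z (r, v)).fr 2) (-bend (flow 0 u z) • (sheet z (u, v)).fr 0) u := by
  have := hasDerivAt_fr_flow H (flow 1 v z) u
  rwa [show bend (flow 0 u (flow 1 v z)) = bend (flow 0 u z) from bend_sheet H z u v] at this

theorem sheet_fr_one (u v : ℝ) : (sheet z (u, v)).fr 1 = (flow 1 v z).fr 1 := by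
  rw [← sheet_zero H]
  exact eq_of_hasDerivAt_zero (f := fun u => (sheet z (u, v)).fr 1)
    (fun u => (hasDerivAt_sheet_fr H z u v).2.1) u

/-- The frame along a leaf is the frame on the spine, rotated by the turning angle. -/
theorem sheet_fr_zero_two (u v : ℝ) :
    (sheet z (u, v)).fr 0 = Real.cos (turning z u) • (flow 1 v z).fr 0
      + Real.sin (turning z u) • (flow 1 v z).fr 2 ∧
    (sheet z (u, v)).fr 2 = -Real.sin (turning z u) • (flow 1 v z).fr 0
      + Real.cos (turning z u) • (flow 1 v z).fr 2 := by
  -- rotating the frame back by the turning angle gives frame vectors that do not depend on `u`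
  have h0 : Real.cos (turning z u) • (sheet z (u, v)).fr 0
      - Real.sin (turning z u) • (sheet z (u, v)).fr 2 = (flow 1 v z).fr 0 := by
    have := eq_of_hasDerivAt_zero (f := fun u => Real.cos (turning z u) • (sheet z (u, v)).fr 0
      - Real.sin (turning z u) • (sheet z (u, v)).fr 2) (fun u => ?_) u
    · simpa [turning_zero, sheet_zero H] using this
    · obtain ⟨h1, -, h2⟩ := hasDerivAt_sheet_fr H z u v
      have ht := hasDerivAt_turning H z u
      exact ((ht.cos.smul h1).sub (ht.sin.smul h2)).congr_deriv (by module)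
  have h2 : Real.sin (turning z u) • (sheet z (u, v)).fr 0
      + Real.cos (turning z u) • (sheet z (u, v)).fr 2 = (flow 1 v z).fr 2 := by
    have := eq_of_hasDerivAt_zero (f := fun u => Real.sin (turning z u) • (sheet z (u, v)).fr 0
      + Real.cos (turning z u) • (sheet z (u, v)).fr 2) (fun u => ?_) u
    · simpa [turning_zero, sheet_zero H] using this
    · obtain ⟨h1, -, h2⟩ := hasDerivAt_sheet_fr H z u v
      have ht := hasDerivAt_turning H z u
      exact ((ht.sin.smul h1).add (ht.cos.smul h2)).congr_deriv (by module)
  have hcs := Real.cos_sq_add_sin_sq (turning z u)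
  rw [← h0, ← h2]
  constructor
  · calc (sheet z (u, v)).fr 0
        = (Real.cos (turning z u) ^ 2 + Real.sin (turning z u) ^ 2) • (sheet z (u, v)).fr 0 := by
          rw [hcs, one_smul]
      _ = _ := by module
  · calc (sheet z (u, v)).fr 2
        = (Real.cos (turning z u) ^ 2 + Real.sin (turning z u) ^ 2) • (sheet z (u, v)).fr 2 := by
          rw [hcs, one_smul]
      _ = _ := by module

/-- The surface is swept out by a planar curve whose plane is carried along the spine. -/
theorem X_sheet (u v : ℝ) :
    X (sheet z (u, v)).pt = X (flow 1 v z).pt + profileX z u • (flow 1 v z).fr 0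
      + profileY z u • (flow 1 v z).fr 2 := by
  have := eq_of_hasDerivAt_zero (f := fun u => X (sheet z (u, v)).pt
    - (profileX z u • (flow 1 v z).fr 0 + profileY z u • (flow 1 v z).fr 2)) (fun u => ?_) u
  · simp only [sheet_zero H, profileX, profileY, intervalIntegral.integral_same, zero_smul,
      add_zero, sub_zero] at this
    rw [add_assoc]
    exact sub_eq_iff_eq_add.1 this
  · have h1 := (flowsAlong_sheet_leaf H z u v).2
    rw [one_smul, (sheet_fr_zero_two H z u v).1] at h1
    exact (h1.sub (((hasDerivAt_profileX H z u).smul_const ((flow 1 v z).fr 0)).add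
      ((hasDerivAt_profileY H z u).smul_const ((flow 1 v z).fr 2)))).congr_deriv (sub_self _)

theorem contDiff_spine : ContDiff ℝ ∞ fun v => X (flow 1 v z).pt := by
  rw [contDiff_iff_contDiffAt]
  intro v
  have h := (FlowsAlong.smooth H.immersed H.planar (i := 1) (by decide)
    (Eventually.of_forall fun r => flowsAlong_flow H (by decide) z r) (s₀ := v)).1
  have h2 : ContMDiffAt 𝓘(ℝ, ℝ) 𝓘(ℝ, E3) ∞ (X ∘ fun v => (flow 1 v z).pt) v :=
    (H.immersed.1 _).comp v h
  exact h2.contDiffAt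

theorem contDiff_spine_fr (j : Fin 3) : ContDiff ℝ ∞ fun v => (flow 1 v z).fr j :=
  contDiff_iff_contDiffAt.2 fun v => (FlowsAlong.smooth H.immersed H.planar (i := 1) (by decide)
    (Eventually.of_forall fun r => flowsAlong_flow H (by decide) z r) (s₀ := v)).2 j

theorem hasDerivAt_spine (v : ℝ) :
    HasDerivAt (fun v => X (flow 1 v z).pt) ((flow 1 v z).fr 1) v := by
  simpa using (flowsAlong_flow H (i := 1) (by decide) z v).2

theorem contDiff_X_sheet : ContDiff ℝ ∞ fun w => X (sheet z w).pt := by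
  have : (fun w => X (sheet z w).pt) = fun w : ℝ × ℝ => X (flow 1 w.2 z).pt
      + profileX z w.1 • (flow 1 w.2 z).fr 0 + profileY z w.1 • (flow 1 w.2 z).fr 2 :=
    funext fun w => X_sheet H z w.1 w.2
  rw [this]
  exact (((contDiff_spine H z).comp contDiff_snd).add
    (((contDiff_profileX H z).comp contDiff_fst).smul
      ((contDiff_spine_fr H z 0).comp contDiff_snd))).add
    (((contDiff_profileY H z).comp contDiff_fst).smul
      ((contDiff_spine_fr H z 2).comp contDiff_snd))

theorem continuous_speed (u : ℝ) : Continuous (speed z u) := by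
  have h : ContDiff ℝ ∞ fun r => X (sheet z (u, r)).pt :=
    (contDiff_X_sheet H z).comp (contDiff_const.prodMk contDiff_id)
  exact (h.continuous_deriv (by simp)).inner (contDiff_spine_fr H z 1).continuous

/-- The speed of the curves `u = const`, as a continuous function of the parameter, is positive. -/
theorem flowsAlong_sheet (u v : ℝ) :
    0 < speed z u v ∧ FlowsAlong 1 (speed z u) (fun r => sheet z (u, r)) v := by
  obtain ⟨m, hm, h⟩ := exists_flowsAlong_sheet H z u v
  have : speed z u v = m := by
    rw [speed, h.2.deriv, sheet_fr_one H, inner_smul_left, real_inner_self_eq_norm_sq,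
      FrameBundle.norm_fr]
    simp
  refine ⟨this ▸ hm, h.1, ?_⟩
  rw [this]
  exact h.2

theorem hasFDerivAt_X_sheet (w : ℝ × ℝ) :
    HasFDerivAt (fun w => X (sheet z w).pt)
      (ofCols ((sheet z w).fr 0) (speed z w.1 w.2 • (sheet z w).fr 1)) w := by
  have hd : DifferentiableAt ℝ (fun w => X (sheet z w).pt) w :=
    (contDiff_X_sheet H z).differentiable (by simp) w
  have h0 : HasDerivAt (fun r => X (sheet z (r, w.2)).pt) _ w.1 :=
    HasFDerivAt.comp_hasDerivAt (l := fun w => X (sheet z w).pt) w.1 hd.hasFDerivAt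
      ((hasDerivAt_id w.1).prodMk (hasDerivAt_const w.1 w.2))
  have h1 : HasDerivAt (fun r => X (sheet z (w.1, r)).pt) _ w.2 :=
    HasFDerivAt.comp_hasDerivAt (l := fun w => X (sheet z w).pt) w.2 hd.hasFDerivAt
      ((hasDerivAt_const w.2 w.1).prodMk (hasDerivAt_id w.2))
  have h0' := h0.unique (flowsAlong_sheet_leaf H z w.1 w.2).2
  have h1' := h1.unique (flowsAlong_sheet H z w.1 w.2).2.2
  rw [one_smul] at h0'
  have : fderiv ℝ (fun w => X (sheet z w).pt) w
      = ofCols ((sheet z w).fr 0) (speed z w.1 w.2 • (sheet z w).fr 1) := by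
    refine ContinuousLinearMap.ext fun v => ?_
    have hv : v = v.1 • ((1 : ℝ), (0 : ℝ)) + v.2 • ((0 : ℝ), (1 : ℝ)) := by ext <;> simp
    rw [ofCols_apply, hv, map_add, map_smul, map_smul, h0', h1']
    simp
  exact this ▸ hd.hasFDerivAt

theorem injective_fderiv_X_sheet (w : ℝ × ℝ) :
    Function.Injective (fderiv ℝ (fun w => X (sheet z w).pt) w) := by
  rw [injective_iff_map_eq_zero, (hasFDerivAt_X_sheet H z w).fderiv]
  intro v hv
  have ho := orthonormal_iff_ite.1 (sheet z w).2.orthonormal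
  rw [ofCols_apply] at hv
  have h0 := congrArg (inner ℝ ((sheet z w).fr 0)) hv
  have h1 := congrArg (inner ℝ ((sheet z w).fr 1)) hv
  rw [inner_add_right, inner_smul_right, inner_smul_right, inner_smul_right, ho, ho,
    inner_zero_right] at h0 h1
  simp at h0 h1
  exact Prod.ext h0 (h1.resolve_right (flowsAlong_sheet H z w.1 w.2).1.ne')

theorem contDiffAt_chart_sheet {y : FrameBundle X F} (β : AdaptedBox X F y.pt y.fr) {w : ℝ × ℝ}
    (hw : (sheet z w).pt ∈ β.chart.source) :
    ContDiffAt ℝ ∞ (fun w => β.chart (sheet z w).pt) w :=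
  β.contDiffAt_chart_comp H.immersed (g := fun w => (sheet z w).pt)
    (FrameBundle.continuous_pt.comp (continuous_sheet H z)).continuousAt hw
    (contDiff_X_sheet H z).contDiffAt

theorem contMDiff_sheet : ContMDiff 𝓘(ℝ, ℝ × ℝ) (𝓡 2) ∞ fun w => (sheet z w).pt := by
  intro w
  obtain ⟨β⟩ := exists_box_at H.immersed H.planar (sheet z w)
  have h1 := contDiffAt_chart_sheet H z β β.mem_source
  have h2 := (β.smooth_symm.contMDiffAt (β.chart.open_target.mem_nhds
    (β.chart.map_source β.mem_source))).comp w h1.contMDiffAt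
  refine h2.congr_of_eventuallyEq ?_
  have hc : Continuous fun w => (sheet z w).pt :=
    FrameBundle.continuous_pt.comp (continuous_sheet H z)
  filter_upwards [hc.continuousAt.eventually_mem (β.chart.open_source.mem_nhds β.mem_source)]
    with w' hw'
  exact (β.chart.left_inv hw').symm

theorem exists_hasFDerivAt_chart_sheet {y : FrameBundle X F} (β : AdaptedBox X F y.pt y.fr)
    {w : ℝ × ℝ} (hw : (sheet z w).pt ∈ β.chart.source) :
    ∃ e : (ℝ × ℝ) ≃L[ℝ] ℝ × ℝ,
      HasFDerivAt (fun w => β.chart (sheet z w).pt) (e : (ℝ × ℝ) →L[ℝ] ℝ × ℝ) w := by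
  have hc : Continuous fun w => (sheet z w).pt :=
    FrameBundle.continuous_pt.comp (continuous_sheet H z)
  set G : ℝ × ℝ → ℝ × ℝ := fun w => β.chart (sheet z w).pt with hG
  have hd : DifferentiableAt ℝ G w :=
    (contDiffAt_chart_sheet H z β hw).differentiableAt (by simp)
  have hinj : Function.Injective (fderiv ℝ G w) := by
    have h2 : HasFDerivAt (fun w => X (sheet z w).pt)
        ((fderiv ℝ (X ∘ β.chart.symm) (G w)).comp (fderiv ℝ G w)) w := by
      refine HasFDerivAt.congr_of_eventuallyEq
        (((β.contDiffAt_X H.immersed (β.chart.map_source hw)).differentiableAt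
          (by simp)).hasFDerivAt.comp w hd.hasFDerivAt) ?_
      filter_upwards [hc.continuousAt.eventually_mem (β.chart.open_source.mem_nhds hw)] with w' hw'
      simp [hG, β.chart.left_inv hw']
    have h3 := injective_fderiv_X_sheet H z w
    rw [h2.fderiv] at h3
    exact Function.Injective.of_comp (f := fderiv ℝ (X ∘ β.chart.symm) (G w)) h3
  refine ⟨(LinearEquiv.ofInjectiveEndo (fderiv ℝ G w : (ℝ × ℝ) →ₗ[ℝ] ℝ × ℝ)
    hinj).toContinuousLinearEquiv, ?_⟩
  have : (((LinearEquiv.ofInjectiveEndo (fderiv ℝ G w : (ℝ × ℝ) →ₗ[ℝ] ℝ × ℝ)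
    hinj).toContinuousLinearEquiv : (ℝ × ℝ) ≃L[ℝ] ℝ × ℝ) : (ℝ × ℝ) →L[ℝ] ℝ × ℝ) = fderiv ℝ G w := by
    exact ContinuousLinearMap.ext fun v => rfl
  rw [this]
  exact hd.hasFDerivAt

theorem isLocalDiffeomorph_sheet :
    IsLocalDiffeomorph 𝓘(ℝ, ℝ × ℝ) (𝓡 2) ∞ fun w => (sheet z w).pt := by
  intro w
  obtain ⟨β⟩ := exists_box_at H.immersed H.planar (sheet z w)
  have hc : Continuous fun w => (sheet z w).pt :=
    FrameBundle.continuous_pt.comp (continuous_sheet H z)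
  set G : ℝ × ℝ → ℝ × ℝ := fun w => β.chart (sheet z w).pt with hG
  have hGs : ∀ w', (sheet z w').pt ∈ β.chart.source → ContDiffAt ℝ ∞ G w' := fun w' hw' =>
    contDiffAt_chart_sheet H z β hw'
  have hSo : IsOpen {w' | (sheet z w').pt ∈ β.chart.source} := β.chart.open_source.preimage hc
  obtain ⟨e, he⟩ := exists_hasFDerivAt_chart_sheet H z β β.mem_source
  let ψ := ((hGs w β.mem_source).toOpenPartialHomeomorph G he (by simp)).restrOpen _ hSo
  have hψ : ∀ w', ψ w' = G w' := fun w' => rfl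
  have hψs : ∀ w' ∈ ψ.source, (sheet z w').pt ∈ β.chart.source := fun w' hw' => hw'.2
  have hψw : w ∈ ψ.source :=
    ⟨(hGs w β.mem_source).mem_toOpenPartialHomeomorph_source he (by simp), β.mem_source⟩
  have hsm : ContDiffOn ℝ ∞ ψ ψ.source := fun w' hw' => (hGs w' (hψs w' hw')).contDiffWithinAt
  have hsm' : ContDiffOn ℝ ∞ ψ.symm ψ.target := fun y hy => by
    obtain ⟨e', he'⟩ := exists_hasFDerivAt_chart_sheet H z β (hψs _ (ψ.map_target hy))
    exact (ψ.contDiffAt_symm hy he' (hGs _ (hψs _ (ψ.map_target hy)))).contDiffWithinAt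
  let θ := ψ.trans β.chart.symm
  refine ⟨{ toPartialEquiv := θ.toPartialEquiv
            open_source := θ.open_source
            open_target := θ.open_target
            contMDiffOn_toFun := ?_
            contMDiffOn_invFun := ?_ }, ?_, ?_⟩
  · exact β.smooth_symm.comp (hsm.contMDiffOn.mono inter_subset_left) fun x hx => hx.2
  · exact hsm'.contMDiffOn.comp (β.smooth_chart.mono inter_subset_left) fun x hx => hx.2
  · exact ⟨hψw, β.chart.map_source β.mem_source⟩
  · intro w' hw'
    exact (β.chart.left_inv (hψs w' hw'.1)).symm

end Development

/-! ### The development is a covering map -/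

section Covering

variable {M : Type*} [TopologicalSpace M] [ChartedSpace (EuclideanSpace ℝ (Fin 2)) M]
  [IsManifold (𝓡 2) ∞ M] {X : M → E3} {F : Foliation M}

theorem FlowsAlong.reparam {i : Fin 3} {γ : ℝ → FrameBundle X F} {φ l : ℝ → ℝ} {s : ℝ}
    (h : FlowsAlong i (fun _ => 1) γ (φ s)) (hφ : HasDerivAt φ (l s) s) :
    FlowsAlong i l (fun r => γ (φ r)) s := by
  refine ⟨ContinuousAt.comp (f := φ) h.1 hφ.continuousAt, ?_⟩
  have := HasDerivAt.scomp s h.2 hφ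
  rwa [one_smul] at this

variable [T2Space M] (H : IsCompletePlanar X F) (z : FrameBundle X F)

include H

/-- The curves `u = const` of the development are the orthogonal trajectories through their
points, up to parameterization. In particular they sweep out these trajectories completely. -/
theorem exists_reparam (u₀ v₀ : ℝ) :
    ∃ φ : ℝ → ℝ, Continuous φ ∧ φ 0 = v₀ ∧
      ∀ s, flow 1 s (sheet z (u₀, v₀)) = sheet z (u₀, φ s) := by
  set y := sheet z (u₀, v₀) with hy
  -- going back along the leaves takes the trajectory through `y` to the spine of `z`, with a speed
  -- that is continuous on the whole line
  have hm : Continuous (speed y (-u₀)) := continuous_speed H y (-u₀)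
  let φ : ℝ → ℝ := fun s => v₀ + ∫ r in (0 : ℝ)..s, speed y (-u₀) r
  have hφ : ∀ s, HasDerivAt φ (speed y (-u₀) s) s := fun s =>
    (hasDerivAt_integral_of_continuous hm s).const_add v₀
  have hback : ∀ x : FrameBundle X F, flow 0 u₀ (flow 0 (-u₀) x) = x := fun x => by
    rw [← flow_add H (by decide), add_neg_cancel, flow_zero H (by decide)]
  have hback' : ∀ x : FrameBundle X F, flow 0 (-u₀) (flow 0 u₀ x) = x := fun x => by
    rw [← flow_add H (by decide), neg_add_cancel, flow_zero H (by decide)]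
  have hφ0 : φ 0 = v₀ := by simp [φ]
  have key : EqOn (fun s => sheet y (-u₀, s)) (fun s => flow 1 (φ s) z) univ :=
    FlowsAlong.eqOn H.immersed H.planar (i := 1) (by decide) hm isOpen_univ isPreconnected_univ
      (fun s _ => (flowsAlong_sheet H y (-u₀) s).2)
      (fun s _ => (flowsAlong_flow H (by decide) z (φ s)).reparam (hφ s)) (mem_univ 0) (by
        change flow 0 (-u₀) (flow 1 0 y) = flow 1 (φ 0) z
        rw [flow_zero H (by decide), hφ0, hy]
        exact hback' _)
  refine ⟨φ, continuous_iff_continuousAt.2 fun s => (hφ s).continuousAt, hφ0, fun s => ?_⟩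
  have := key (mem_univ s)
  rw [← hback (flow 1 s y)]
  exact congrArg (flow 0 u₀) this

/-- If two developments meet, then one lifts through the other. -/
theorem exists_lift (z₁ : FrameBundle X F) {q w₀ : ℝ × ℝ}
    (h : (sheet z q).pt = (sheet z₁ w₀).pt) :
    ∃ τ : ℝ × ℝ → ℝ × ℝ, Continuous τ ∧ τ w₀ = q ∧ ∀ w, (sheet z (τ w)).pt = (sheet z₁ w).pt := by
  obtain ⟨σ, hσ, hσz⟩ := FrameBundle.exists_flip_eq h.symm
  set y := flow 1 w₀.2 z₁ with hy
  set u₀ := σ 0 * -w₀.1 + q.1 with hu₀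
  have hyz : y.flip hσ = sheet z (u₀, q.2) := by
    have h1 : y = flow 0 (-w₀.1) (sheet z₁ w₀) := by
      rw [sheet, ← flow_add H (by decide), neg_add_cancel, flow_zero H (by decide)]
    have h2 := flow_flip H (i := 0) (by decide) hσ (σ 0 * -w₀.1) (sheet z₁ w₀)
    rw [← mul_assoc, hσ.mul_self, one_mul, ← h1, ← hσz, sheet, ← flow_add H (by decide)] at h2
    exact h2.symm
  obtain ⟨φ, hφ, hφ0, hφs⟩ := exists_reparam H z u₀ q.2
  refine ⟨fun w => (σ 0 * w.1 + u₀, φ (σ 1 * (w.2 - w₀.2))), by fun_prop, ?_, fun w => ?_⟩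
  · refine Prod.ext ?_ ?_
    · simp [hu₀]
    · simp [hφ0]
  · have h1 : sheet z (σ 0 * w.1 + u₀, φ (σ 1 * (w.2 - w₀.2)))
        = flow 0 (σ 0 * w.1) (sheet z (u₀, φ (σ 1 * (w.2 - w₀.2)))) :=
      flow_add H (by decide) _ _ _
    rw [h1, ← hφs, ← hyz, flow_flip H (by decide), flow_flip H (by decide), ← mul_assoc,
      ← mul_assoc, hσ.mul_self, hσ.mul_self, one_mul, one_mul, hy, ← flow_add H (by decide),
      sub_add_cancel]
    rfl

theorem sheet_origin : sheet z (0, 0) = z := by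
  rw [sheet_zero H, flow_zero H (by decide)]

theorem surjective_sheet [ConnectedSpace M] : Function.Surjective fun w => (sheet z w).pt := by
  have hopen : ∀ y : FrameBundle X F, IsOpen (range fun w => (sheet y w).pt) := fun y =>
    (isLocalDiffeomorph_sheet H y).isOpen_range
  have hclosed : IsClosed (range fun w => (sheet z w).pt) := by
    refine isClosed_of_closure_subset fun p hp => ?_
    obtain ⟨A, hA⟩ := exists_isAdaptedFrame H.immersed F p
    let y : FrameBundle X F := ⟨(p, A), hA⟩
    obtain ⟨_, ⟨w₀, rfl⟩, ⟨q, hq⟩⟩ := mem_closure_iff.1 hp _ (hopen y)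
      ⟨(0, 0), by simp only [sheet_origin H]; rfl⟩
    obtain ⟨τ, -, -, hτ⟩ := exists_lift H z y hq
    exact ⟨τ (0, 0), by simp only [hτ, sheet_origin H]; rfl⟩
  exact range_eq_univ.1 (IsClopen.eq_univ ⟨hclosed, hopen z⟩ (range_nonempty _))

theorem isCoveringMap_sheet : IsCoveringMap fun w => (sheet z w).pt := by
  refine isCoveringMap_of_sections (isLocalDiffeomorph_sheet H z).isLocalHomeomorph fun p => ?_
  obtain ⟨A, hA⟩ := exists_isAdaptedFrame H.immersed F p
  let y : FrameBundle X F := ⟨(p, A), hA⟩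
  obtain ⟨e, he0, he⟩ := (isLocalDiffeomorph_sheet H y).isLocalHomeomorph ((0, 0) : ℝ × ℝ)
  have hval : ∀ w, e w = (sheet y w).pt := fun w => (congrFun he w).symm
  obtain ⟨r, hr, hre⟩ := Metric.isOpen_iff.1 e.open_source _ he0
  refine ⟨e '' Metric.ball (0, 0) r, e.isOpen_image_of_subset_source Metric.isOpen_ball hre,
    ⟨(0, 0), Metric.mem_ball_self hr, by rw [hval, sheet_origin H]⟩,
    ((convex_ball _ _).isPreconnected).image _ (e.continuousOn.mono hre), ?_⟩
  rintro q ⟨w₀, hw₀, hq⟩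
  obtain ⟨τ, hτ, hτ0, hτs⟩ := exists_lift H z y (q := q) (w₀ := w₀) (by rw [← hval]; exact hq.symm)
  refine ⟨fun x => τ (e.symm x), hτ.comp_continuousOn (e.continuousOn_symm.mono ?_), ?_, ?_⟩
  · rintro _ ⟨w, hw, rfl⟩
    exact e.map_source (hre hw)
  · rintro _ ⟨w, hw, rfl⟩
    simp only [hτs, ← hval, e.left_inv (hre hw)]
  · have : e.symm (sheet z q).pt = w₀ := by
      rw [← hq, e.left_inv (hre hw₀)]
    simp only [this, hτ0]

end Covering

/-! ### Lines of curvature -/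

section CurvatureLines

variable {M : Type*} [TopologicalSpace M] [ChartedSpace (EuclideanSpace ℝ (Fin 2)) M]
  [IsManifold (𝓡 2) ∞ M] {X : M → E3} {F : Foliation M}

/-- The formula of Rodrigues along a curve in a frame direction: it suffices that the derivative
of the normal is a multiple of this direction. -/
theorem FlowsAlong.isPrincipalDirection (hX : IsImmersedSurface X) (hF : F.IsPlanarGeodesic X)
    {i : Fin 3} {l : ℝ → ℝ} {γ : ℝ → FrameBundle X F} {s : ℝ} (h : FlowsAlong i l γ s)
    (hl : l s ≠ 0) (hγ : MDifferentiableAt 𝓘(ℝ, ℝ) (𝓡 2) (fun r => (γ r).pt) s) {a : ℝ}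
    (ha : HasDerivAt (fun r => (γ r).fr 2) (a • (γ s).fr i) s) :
    IsPrincipalDirection X (γ s).pt (velocity (fun r => (γ r).pt) s) := by
  obtain ⟨β⟩ := exists_box_at hX hF (γ s)
  have hv : dMap X (γ s).pt (velocity (fun r => (γ r).pt) s) = l s • (γ s).fr i :=
    dMap_velocity (g := fun r => (γ r).pt) (hX.mdifferentiableAt _) hγ h.2
  have hN : ContMDiffOn (𝓡 2) 𝓘(ℝ, E3) ∞ (β.frame 2 ∘ β.chart) β.chart.source :=
    (β.smooth_frame 2).contMDiffOn.comp β.smooth_chart fun x hx => β.chart.map_source hx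
  have hNv : dMap (β.frame 2 ∘ β.chart) (γ s).pt (velocity (fun r => (γ r).pt) s)
      = a • (γ s).fr i := by
    refine dMap_velocity (g := fun r => (γ r).pt) ((hN.contMDiffAt
      (β.chart.open_source.mem_nhds β.mem_source)).mdifferentiableAt (by simp)) hγ ?_
    refine ha.congr_of_eventuallyEq ?_
    filter_upwards [h.1.eventually_mem (β.nhd_mem_nhds β.mem_nhd_self)] with r hr
    exact (β.fr_eq hr 2).symm
  refine ⟨fun h0 => ?_, β.chart.source, β.chart.open_source, β.mem_source, _, hN, fun p hp => ?_,
    -(a / l s), ?_⟩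
  · rw [h0, map_zero] at hv
    have := congrArg norm hv
    rw [norm_smul, FrameBundle.norm_fr, norm_zero, mul_one, eq_comm, norm_eq_zero] at this
    exact hl this
  · have had := β.adapted _ (β.chart.map_source hp)
    rw [β.chart.left_inv hp] at had
    exact ⟨had.orthonormal.1 2, had.mem_normalLine⟩
  · rw [hNv, hv, smul_smul, ← neg_smul]
    congr 1
    field_simp

/-- The second vector of a frame is orthogonal to the foliation. -/
theorem inner_fr_one_dMap (y : FrameBundle X F) {w : TangentSpace (𝓡 2) y.pt}
    (hw : w ∈ F.line y.pt) : inner ℝ (y.fr 1) (dMap X y.pt w) = 0 := by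
  obtain ⟨x, hx, hxv⟩ := y.2.mem_line
  obtain ⟨u, -, hu⟩ := line_eq_span F y.pt
  replace hx : x ∈ F.line y.pt := hx
  rw [hu, Submodule.mem_span_singleton] at hw hx
  obtain ⟨a, rfl⟩ := hw
  obtain ⟨b, rfl⟩ := hx
  have h0 : inner ℝ (y.fr 1) (y.fr 0) = (0 : ℝ) := y.2.orthonormal.2 (by decide)
  have h1 : ‖y.fr 0‖ = 1 := y.norm_fr 0
  have h2 : b • dMap X y.pt u = y.fr 0 := by rw [← map_smul]; exact hxv
  rw [← h2] at h0 h1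
  have hb : b ≠ 0 := by
    rintro rfl
    simp at h1
  rw [inner_smul_right] at h0
  rw [map_smul, inner_smul_right, (mul_eq_zero.1 h0).resolve_left hb, mul_zero]

variable [T2Space M] (H : IsCompletePlanar X F) (z : FrameBundle X F)

include H

theorem contMDiff_sheet_leaf (v : ℝ) :
    ContMDiff 𝓘(ℝ, ℝ) (𝓡 2) ∞ fun u => (sheet z (u, v)).pt :=
  (contMDiff_sheet H z).comp (contDiff_id.prodMk contDiff_const).contMDiff

theorem contMDiff_sheet_orthogonal (u : ℝ) :
    ContMDiff 𝓘(ℝ, ℝ) (𝓡 2) ∞ fun v => (sheet z (u, v)).pt :=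
  (contMDiff_sheet H z).comp (contDiff_const.prodMk contDiff_id).contMDiff

theorem isCurvatureLineParam_sheet : IsCurvatureLineParam X fun w => (sheet z w).pt where
  localDiffeo := isLocalDiffeomorph_sheet H z
  u_curves v := ⟨contMDiff_sheet_leaf H z v, fun u =>
    (flowsAlong_sheet_leaf H z u v).isPrincipalDirection H.immersed H.planar one_ne_zero
      ((contMDiff_sheet_leaf H z v).mdifferentiableAt (by simp))
      (hasDerivAt_sheet_fr H z u v).2.2⟩
  v_curves u := ⟨contMDiff_sheet_orthogonal H z u, fun v => by
    obtain ⟨hpos, hf⟩ := flowsAlong_sheet H z u v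
    obtain ⟨-, a, ha⟩ := hf.exists_hasDerivAt_fr_orthogonal H.immersed H.planar
    exact hf.isPrincipalDirection H.immersed H.planar hpos.ne'
      ((contMDiff_sheet_orthogonal H z u).mdifferentiableAt (by simp)) ha⟩
  orthogonal u v := by
    have h0 : HasDerivAt (fun r => X (sheet z (r, v)).pt) _ u := (flowsAlong_sheet_leaf H z u v).2
    have h1 : HasDerivAt (fun r => X (sheet z (u, r)).pt) _ v := (flowsAlong_sheet H z u v).2.2
    rw [h0.deriv, h1.deriv, inner_smul_left, inner_smul_right,
      (sheet z (u, v)).2.orthonormal.2 (by decide), mul_zero, mul_zero]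

theorem isLeafOn_sheet (v : ℝ) : F.IsLeafOn X (fun u => (sheet z (u, v)).pt) univ := by
  have hd : ∀ u, HasDerivAt (X ∘ fun r => (sheet z (r, v)).pt) ((sheet z (u, v)).fr 0) u :=
    fun u => by
      have := (flowsAlong_sheet_leaf H z u v).2
      rwa [one_smul] at this
  refine ⟨⟨(contMDiff_sheet_leaf H z v).contMDiffOn, fun u _ => ?_⟩, fun u _ => ?_⟩
  · rw [(hd u).deriv, FrameBundle.norm_fr]
  · obtain ⟨x, hx, hxv⟩ := (sheet z (u, v)).2.mem_line
    have h1 := dMap_velocity (g := fun r => (sheet z (r, v)).pt) (H.immersed.mdifferentiableAt _)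
      ((contMDiff_sheet_leaf H z v).mdifferentiableAt (by simp)) (hd u)
    rwa [H.immersed.2 _ (h1.trans hxv.symm)]

theorem isRotationMinimizingFrame_spine :
    IsRotationMinimizingFrame (fun v => X (flow 1 v z).pt) (fun v => (flow 1 v z).fr 0)
      (fun v => (flow 1 v z).fr 2) where
  smooth_r := contDiff_spine H z
  smooth_q₁ := contDiff_spine_fr H z 0
  smooth_q₂ := contDiff_spine_fr H z 2
  regular v h := by
    rw [(hasDerivAt_spine H z v).deriv] at h
    have := (flow 1 v z).norm_fr 1
    rw [h, norm_zero] at this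
    exact zero_ne_one this
  orthonormal v := by
    rw [(hasDerivAt_spine H z v).deriv, FrameBundle.norm_fr, inv_one, one_smul]
    have h := (flow 1 v z).2.orthonormal.comp ![1, 0, 2] (by decide)
    convert h using 1
    funext i
    fin_cases i <;> rfl
  parallel_q₁ v := by
    obtain ⟨⟨a, ha⟩, -⟩ := (flowsAlong_flow H (i := 1) (by decide) z
      v).exists_hasDerivAt_fr_orthogonal H.immersed H.planar
    exact ⟨a, by rw [ha.deriv, (hasDerivAt_spine H z v).deriv]⟩
  parallel_q₂ v := by
    obtain ⟨-, a, ha⟩ := (flowsAlong_flow H (i := 1) (by decide) z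
      v).exists_hasDerivAt_fr_orthogonal H.immersed H.planar
    exact ⟨a, by rw [ha.deriv, (hasDerivAt_spine H z v).deriv]⟩

end CurvatureLines

end PGF

end

theorem theorem2p3 {M : Type*} [TopologicalSpace M] [T2Space M] [SecondCountableTopology M]
    [ChartedSpace (EuclideanSpace ℝ (Fin 2)) M] [IsManifold (𝓡 2) ∞ M] [ConnectedSpace M]
    (X : M → PGF.E3) (hX : PGF.IsImmersedSurface X)
    (hcomplete : PGF.IsCompleteSurface X) (horient : PGF.IsOrientable X)
    (F : PGF.Foliation M) (hF : F.IsPlanarGeodesic X) :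
    ∃ (Φ : ℝ × ℝ → M) (r q₁ q₂ : ℝ → PGF.E3) (x y : ℝ → ℝ),
      -- the Monge surface parameterization, with unit speed profile and spine curves
      (∀ u v, X (Φ (u, v)) = r v + x u • q₁ v + y u • q₂ v) ∧
      PGF.IsRotationMinimizingFrame r q₁ q₂ ∧ (∀ v, ‖deriv r v‖ = 1) ∧
      ContDiff ℝ ∞ x ∧ ContDiff ℝ ∞ y ∧ (∀ u, deriv x u ^ 2 + deriv y u ^ 2 = 1) ∧
      -- the spine curve is a curve in the surface, orthogonal to the foliation
      (∀ v, r v = X (Φ (0, v))) ∧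
      (∀ v, ∀ w ∈ F.line (Φ (0, v)), inner ℝ (deriv r v) (PGF.dMap X (Φ (0, v)) w) = 0) ∧
      -- the curves `v = const` are leaves of the foliation and unit speed geodesics
      (∀ v, F.IsLeafOn X (fun u => Φ (u, v)) univ ∧
        PGF.IsUnitSpeedGeodesicOn X (fun u => Φ (u, v)) univ) ∧
      -- the parameterization is a covering map onto the surface, by curvature line coordinates
      ContMDiff 𝓘(ℝ, ℝ × ℝ) (𝓡 2) ∞ Φ ∧ PGF.IsCurvatureLineParam X Φ ∧
      IsCoveringMap Φ ∧ Function.Surjective Φ := by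
  have H : PGF.IsCompletePlanar X F := ⟨hX, hF, hcomplete⟩
  obtain ⟨p⟩ : Nonempty M := inferInstance
  obtain ⟨A, hA⟩ := PGF.exists_isAdaptedFrame hX F p
  let z : PGF.FrameBundle X F := ⟨(p, A), hA⟩
  refine ⟨fun w => (PGF.sheet z w).pt, fun v => X (PGF.flow 1 v z).pt,
    fun v => (PGF.flow 1 v z).fr 0, fun v => (PGF.flow 1 v z).fr 2, PGF.profileX z, PGF.profileY z,
    PGF.X_sheet H z, PGF.isRotationMinimizingFrame_spine H z, fun v => ?_,
    PGF.contDiff_profileX H z, PGF.contDiff_profileY H z, fun u => ?_, fun v => ?_, fun v w hw => ?_,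
    fun v => ⟨PGF.isLeafOn_sheet H z v,
      (hF _ univ isOpen_univ ordConnected_univ (PGF.isLeafOn_sheet H z v)).1⟩,
    PGF.contMDiff_sheet H z, PGF.isCurvatureLineParam_sheet H z, PGF.isCoveringMap_sheet H z,
    PGF.surjective_sheet H z⟩
  · rw [(PGF.hasDerivAt_spine H z v).deriv, PGF.FrameBundle.norm_fr]
  · rw [(PGF.hasDerivAt_profileX H z u).deriv, (PGF.hasDerivAt_profileY H z u).deriv,
      Real.cos_sq_add_sin_sq]
  · simp only [PGF.sheet_zero H]
  · rw [(PGF.hasDerivAt_spine H z v).deriv, ← PGF.sheet_fr_one H z 0 v]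
    exact PGF.inner_fr_one_dMap _ hw
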